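/- Let $d\ge 1$, let $\langle x\rangle=(1+|x|^2)^{1/2}$ on $\mathbb R^d$, let $Q$ be the multiplication by $x$ and $P=-i\nabla$ in $L^2(\mathbb R^d)=L^2(\mathbb R^d;\mathbb C)$, let $H_0=|P|^2=-\Delta$ with domain $\mathcal H^2(\mathbb R^d)$, and let $A$ be the self-adjoint realization of $(P\cdot Q+Q\cdot P)/2$, i.e. $Af=-i(x\cdot\nabla f+\tfrac d2 f)$ on $\{f\in L^2: x\cdot\nabla f\in L^2\}$. Let $\alpha,\beta>0$, $k,w\in\mathbb R$, $\rho_{sr},\rho_{lr},\rho_{lr}'\in(0,1]$. Let $v\in C^1(\mathbb R^d;\mathbb R^d)$ have bounded derivative, and let $\kappa\in C_c^\infty(\mathbb R;\mathbb R)$ satisfy $\kappa=1$ on $[-1,1]$ and $0\le\kappa\le1$. Let $V_{sr},\tilde V_{sr},V_{lr},V_c:\mathbb R^d\to\mathbb R$ be measurable functions such that $V_c$ is compactly supported, $V_c(Q)$ is $H_0$-compact, the functions $\langle x\rangle^{1+\rho_{sr}}V_{sr}$, $\langle x\rangle^{1+\rho_{sr}}\tilde V_{sr}$, $\langle x\rangle^{\rho_{lr}}V_{lr}$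 are bounded, and the distributions $\langle x\rangle^{\rho_{lr}'}x\cdot\nabla V_{lr}$ and $\langle x\rangle^{\rho_{sr}}\,v\cdot\nabla\tilde V_{sr}$ are bounded functions. Put $$W_{\alpha\beta}(x)=w\,(1-\kappa(|x|))\,|x|^{-\beta}\sin(k|x|^\alpha),\qquad V=V_{sr}+v\cdot\nabla\tilde V_{sr}+V_{lr}+V_c+W_{\alpha\beta},\qquad H=H_0+V(Q);$$ then $\mathcal D(H)=\mathcal D(H_0)=\mathcal H^2(\mathbb R^d)$. Assume that there are $\epsilon_c>0$ and $\lambda_c>0$ such that for all $\varphi\in\mathcal D(H)\cap\mathcal D(A)$ $$\langle\varphi,[(V_c+v\cdot\nabla\tilde V_{sr})(Q),iA]\varphi\rangle\ \ge\ (\epsilon_c-2)\langle\varphi,H_0\varphi\rangle-\lambda_c\|\varphi\|^2,$$ where the commutator is taken in the sense of forms: $\langle\varphi,[T,iA]\varphi\rangle=\langle T\varphi,iA\varphi\rangle+\langle iA\varphi,T\varphi\rangle$. Assume moreover that $\beta\ge 1/2$ unless $|\alpha-1|+\beta>1$. Then there is $w_0>0$, depending on all the above data except $w$, such that the following holds for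 every $w\in\mathbb R$, where, unless $\alpha+\beta\le2$ or $\beta\ge1/2$, it is required that $|w|\le w_0$: if $E\in\mathbb R$ and $\psi\in\mathcal D(H)$ satisfy $H\psi=E\psi$, and $\psi$ belongs to the domain of the multiplication operator $e^{\gamma\langle Q\rangle}$ for every $\gamma\ge0$, then $\psi=0$. -/

import Mathlib

open MeasureTheory
open scoped ContDiff

noncomputable section

namespace OscSchrodinger

/-- The configuration space `ℝ^d` with its Euclidean norm. -/
abbrev Space (d : ℕ) : Type := EuclideanSpace ℝ (Fin d)

/-- The Hilbert space `L²(ℝ^d; ℂ)` for Lebesgue measure. -/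
abbrev L2 (d : ℕ) : Type := Lp ℂ 2 (volume : Measure (Space d))

/-- The Japanese bracket `⟨x⟩ = (1 + |x|²)^{1/2}`. -/
def bracket {d : ℕ} (x : Space d) : ℝ := Real.sqrt (1 + ‖x‖ ^ 2)

/-- The divergence `∑ⱼ ∂ⱼ bⱼ` of a vector field `b`. -/
def divergence {d : ℕ} (b : Space d → Space d) (x : Space d) : ℝ :=
  ∑ i : Fin d, (fderiv ℝ b x (EuclideanSpace.single i 1)) i

/-- `HasFieldDeriv b u g` : the distribution `b · ∇u` is (given by the function) `g`, that is
`∫ u div(φ b) = - ∫ φ g` for every real test function `φ ∈ C_c^∞(ℝ^d)`.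
It is used for `b` of class `C¹` and for locally integrable `u` and `g` only. -/
def HasFieldDeriv {d : ℕ} {F : Type*} [NormedAddCommGroup F] [NormedSpace ℝ F]
    (b : Space d → Space d) (u g : Space d → F) : Prop :=
  ∀ φ : Space d → ℝ, ContDiff ℝ ∞ φ → HasCompactSupport φ →
    ∫ x, divergence (fun y => φ y • b y) x • u x = - ∫ x, φ x • g x

section FieldOperators

variable {d : ℕ}

theorem integrable_test_smul (f : L2 d) {φ : Space d → ℝ} (hφ : Continuous φ)
    (hc : HasCompactSupport φ) : Integrable (fun x => φ x • f x) :=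
  ((Lp.memLp f).locallyIntegrable (by norm_num)).integrable_smul_left_of_hasCompactSupport hφ hc

theorem continuous_divergence {b : Space d → Space d} (hb : ContDiff ℝ 1 b) :
    Continuous (divergence b) := by
  have h := hb.continuous_fderiv (by norm_num)
  unfold divergence
  fun_prop

theorem hasCompactSupport_divergence {b : Space d → Space d} (hc : HasCompactSupport b) :
    HasCompactSupport (divergence b) := by
  have h := hc.fderiv (𝕜 := ℝ)
  refine h.mono ?_
  intro x hx
  contrapose! hx
  simp only [Function.mem_support, not_not] at hx ⊢
  simp [divergence, hx]

theorem integrable_divergence_smul {b : Space d → Space d} (hb : ContDiff ℝ 1 b) (f : L2 d)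
    {φ : Space d → ℝ} (hφ : ContDiff ℝ ∞ φ) (hc : HasCompactSupport φ) :
    Integrable (fun x => divergence (fun y => φ y • b y) x • f x) :=
  integrable_test_smul f
    (continuous_divergence ((hφ.of_le (by exact_mod_cast le_top)).smul hb))
    (hasCompactSupport_divergence hc.smul_right)

theorem HasFieldDeriv.add {b : Space d → Space d} (hb : ContDiff ℝ 1 b) {f f' g g' : L2 d}
    (h : HasFieldDeriv b f g) (h' : HasFieldDeriv b f' g') :
    HasFieldDeriv b (f + f' : L2 d) (g + g' : L2 d) := by
  intro φ hφ hc
  have e1 : ∫ x, divergence (fun y => φ y • b y) x • (f + f' : L2 d) x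
      = ∫ x, (divergence (fun y => φ y • b y) x • f x
          + divergence (fun y => φ y • b y) x • f' x) := by
    refine integral_congr_ae ?_
    filter_upwards [Lp.coeFn_add f f'] with x hx
    rw [hx, Pi.add_apply, smul_add]
  have e2 : ∫ x, φ x • (g + g' : L2 d) x = ∫ x, (φ x • g x + φ x • g' x) := by
    refine integral_congr_ae ?_
    filter_upwards [Lp.coeFn_add g g'] with x hx
    rw [hx, Pi.add_apply, smul_add]
  rw [e1, e2, integral_add (integrable_divergence_smul hb f hφ hc)
    (integrable_divergence_smul hb f' hφ hc),
    integral_add (integrable_test_smul g hφ.continuous hc)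
    (integrable_test_smul g' hφ.continuous hc), h φ hφ hc, h' φ hφ hc, neg_add]

theorem HasFieldDeriv.smul {b : Space d → Space d} {f g : L2 d} (c : ℂ)
    (h : HasFieldDeriv b f g) : HasFieldDeriv b (c • f : L2 d) (c • g : L2 d) := by
  intro φ hφ hc
  have e1 : ∫ x, divergence (fun y => φ y • b y) x • (c • f : L2 d) x
      = ∫ x, c • (divergence (fun y => φ y • b y) x • f x) := by
    refine integral_congr_ae ?_
    filter_upwards [Lp.coeFn_smul c f] with x hx
    rw [hx, Pi.smul_apply, smul_comm]
  have e2 : ∫ x, φ x • (c • g : L2 d) x = ∫ x, c • (φ x • g x) := by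
    refine integral_congr_ae ?_
    filter_upwards [Lp.coeFn_smul c g] with x hx
    rw [hx, Pi.smul_apply, smul_comm]
  rw [e1, e2, integral_smul, integral_smul, h φ hφ hc, smul_neg]

theorem HasFieldDeriv.unique {b : Space d → Space d} {f g g' : L2 d}
    (h : HasFieldDeriv b f g) (h' : HasFieldDeriv b f g') : g = g' := by
  refine Lp.ext ?_
  refine ae_eq_of_integral_contDiff_smul_eq
    ((Lp.memLp g).locallyIntegrable (by norm_num))
    ((Lp.memLp g').locallyIntegrable (by norm_num)) ?_
  intro φ hφ hc
  have := (h φ hφ hc).symm.trans (h' φ hφ hc)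
  exact neg_injective this

/-- The operator `f ↦ b · ∇f` in `L²(ℝ^d)` on its maximal domain, the set of all `f ∈ L²` such that
the distribution `b · ∇f` belongs to `L²`. -/
def fieldOp (b : Space d → Space d) (hb : ContDiff ℝ 1 b) : L2 d →ₗ.[ℂ] L2 d where
  domain :=
    { carrier := {f | ∃ g : L2 d, HasFieldDeriv b f g}
      add_mem' := by
        rintro f f' ⟨g, hg⟩ ⟨g', hg'⟩
        exact ⟨g + g', hg.add hb hg'⟩
      zero_mem' := by
        refine ⟨0, ?_⟩
        have h0 : HasFieldDeriv b (0 : Space d → ℂ) (0 : Space d → ℂ) := by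
          intro φ _ _
          simp
        intro φ hφ hc
        have e1 : ∫ x, divergence (fun y => φ y • b y) x • (0 : L2 d) x = 0 := by
          refine (integral_congr_ae ?_).trans (integral_zero _ ℂ)
          filter_upwards [Lp.coeFn_zero ℂ 2 (volume : Measure (Space d))] with x hx
          rw [hx, Pi.zero_apply, smul_zero]
        have e2 : ∫ x, φ x • (0 : L2 d) x = 0 := by
          refine (integral_congr_ae ?_).trans (integral_zero _ ℂ)
          filter_upwards [Lp.coeFn_zero ℂ 2 (volume : Measure (Space d))] with x hx
          rw [hx, Pi.zero_apply, smul_zero]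
        rw [e1, e2, neg_zero]
      smul_mem' := by
        rintro c f ⟨g, hg⟩
        exact ⟨c • g, hg.smul c⟩ }
  toFun :=
    { toFun := fun f => Classical.choose f.2
      map_add' := fun f f' =>
        (Classical.choose_spec (f + f').2).unique
          ((Classical.choose_spec f.2).add hb (Classical.choose_spec f'.2))
      map_smul' := fun c f =>
        (Classical.choose_spec (c • f).2).unique ((Classical.choose_spec f.2).smul c) }

/-- The value of `fieldOp b` at `f` is the weak derivative `b · ∇f`. -/
theorem fieldOp_spec (b : Space d → Space d) (hb : ContDiff ℝ 1 b) (f : (fieldOp b hb).domain) :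
    HasFieldDeriv b ((f : L2 d) : Space d → ℂ) (fieldOp b hb f) :=
  Classical.choose_spec f.2

end FieldOperators

/-- The weak partial derivative `∂ⱼ = i Pⱼ` in `L²(ℝ^d)`, on its maximal domain. -/
def partialOp (d : ℕ) (j : Fin d) : L2 d →ₗ.[ℂ] L2 d :=
  fieldOp (fun _ => EuclideanSpace.single j 1) contDiff_const

/-- The Sobolev space `H²(ℝ^d)` : the `L²` functions whose distributional derivatives up to the
second order belong to `L²`. -/
def sobolevTwo (d : ℕ) : Submodule ℂ (L2 d) where
  carrier := {f | ∀ i : Fin d, ∃ hi : f ∈ (partialOp d i).domain,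
    ∀ j : Fin d, partialOp d i ⟨f, hi⟩ ∈ (partialOp d j).domain}
  add_mem' := by
    intro f g hf hg i
    obtain ⟨hfi, hf'⟩ := hf i
    obtain ⟨hgi, hg'⟩ := hg i
    refine ⟨Submodule.add_mem _ hfi hgi, fun j => ?_⟩
    have : partialOp d i ⟨f + g, Submodule.add_mem _ hfi hgi⟩
        = partialOp d i ⟨f, hfi⟩ + partialOp d i ⟨g, hgi⟩ :=
      (partialOp d i).map_add ⟨f, hfi⟩ ⟨g, hgi⟩
    rw [this]
    exact Submodule.add_mem _ (hf' j) (hg' j)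
  zero_mem' := by
    intro i
    refine ⟨Submodule.zero_mem _, fun j => ?_⟩
    have : partialOp d i ⟨0, Submodule.zero_mem _⟩ = 0 := (partialOp d i).map_zero
    rw [this]
    exact Submodule.zero_mem _
  smul_mem' := by
    intro c f hf i
    obtain ⟨hfi, hf'⟩ := hf i
    refine ⟨Submodule.smul_mem _ c hfi, fun j => ?_⟩
    have : partialOp d i ⟨c • f, Submodule.smul_mem _ c hfi⟩ = c • partialOp d i ⟨f, hfi⟩ :=
      (partialOp d i).map_smul c ⟨f, hfi⟩
    rw [this]
    exact Submodule.smul_mem _ c (hf' j)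

theorem sobolevTwo_mem_fst {d : ℕ} (f : sobolevTwo d) (i : Fin d) :
    (f : L2 d) ∈ (partialOp d i).domain := (f.2 i).1

theorem sobolevTwo_mem_snd {d : ℕ} (f : sobolevTwo d) (i j : Fin d) :
    partialOp d i ⟨f, sobolevTwo_mem_fst f i⟩ ∈ (partialOp d j).domain := (f.2 i).2 j

/-- The second weak derivative `∂ᵢ² f` of `f ∈ H²(ℝ^d)`. -/
def secondPartial {d : ℕ} (i : Fin d) : sobolevTwo d →ₗ[ℂ] L2 d where
  toFun f := partialOp d i ⟨partialOp d i ⟨f, sobolevTwo_mem_fst f i⟩, sobolevTwo_mem_snd f i i⟩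
  map_add' f g := by
    rw [← LinearPMap.map_add]
    congr 1
    apply Subtype.ext
    exact (partialOp d i).map_add ⟨f, sobolevTwo_mem_fst f i⟩ ⟨g, sobolevTwo_mem_fst g i⟩
  map_smul' c f := by
    rw [RingHom.id_apply, ← LinearPMap.map_smul]
    congr 1
    apply Subtype.ext
    exact (partialOp d i).map_smul c ⟨f, sobolevTwo_mem_fst f i⟩

/-- The free operator `H₀ = |P|² = -Δ` with domain `H²(ℝ^d)`. -/
def freeH (d : ℕ) : L2 d →ₗ.[ℂ] L2 d where
  domain := sobolevTwo d
  toFun := -∑ i : Fin d, secondPartial i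

/-- The generator of dilations `A`, the self-adjoint realization of `(P·Q + Q·P)/2`:
`A f = -i (x · ∇f + (d/2) f)` on the domain of all `f ∈ L²` with `x · ∇f ∈ L²`. -/
def dilationGen (d : ℕ) : L2 d →ₗ.[ℂ] L2 d :=
  (-Complex.I) • (fieldOp (fun x => x) contDiff_id
    + (((d : ℂ) / 2) • (LinearMap.id : L2 d →ₗ[ℂ] L2 d)).toPMap ⊤)

/-- The maximal domain `{f ∈ L² : U f ∈ L²}` of multiplication by a real function `U`. -/
def mulDomain {d : ℕ} (U : Space d → ℝ) : Submodule ℂ (L2 d) where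
  carrier := {f | MemLp (fun x => (U x : ℂ) * f x) 2 volume}
  add_mem' := by
    intro f g hf hg
    have h : MemLp (fun x => (U x : ℂ) * f x + (U x : ℂ) * g x) 2 volume := MemLp.add hf hg
    refine (memLp_congr_ae ?_).mp h
    filter_upwards [Lp.coeFn_add f g] with x hx
    rw [hx, Pi.add_apply, mul_add]
  zero_mem' := by
    have h : MemLp (fun _ : Space d => (0 : ℂ)) 2 volume := MemLp.zero'
    refine (memLp_congr_ae ?_).mp h
    filter_upwards [Lp.coeFn_zero ℂ 2 (volume : Measure (Space d))] with x hx
    rw [hx, Pi.zero_apply, mul_zero]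
  smul_mem' := by
    intro c f hf
    have h : MemLp (fun x => c * ((U x : ℂ) * f x)) 2 volume := MemLp.const_smul hf c
    refine (memLp_congr_ae ?_).mp h
    filter_upwards [Lp.coeFn_smul c f] with x hx
    rw [hx, Pi.smul_apply, smul_eq_mul]
    ring

theorem mulDomain_memLp {d : ℕ} {U : Space d → ℝ} (f : mulDomain U) :
    MemLp (fun x => (U x : ℂ) * (f : L2 d) x) 2 volume := f.2

/-- The operator `U(Q)` of multiplication by a real function `U`, with its maximal domain. -/
def mulOp {d : ℕ} (U : Space d → ℝ) : L2 d →ₗ.[ℂ] L2 d where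
  domain := mulDomain U
  toFun :=
    { toFun := fun f => (mulDomain_memLp f).toLp (fun x => (U x : ℂ) * (f : L2 d) x)
      map_add' := by
        intro f g
        rw [← MemLp.toLp_add]
        refine MemLp.toLp_congr _ _ ?_
        filter_upwards [Lp.coeFn_add (f : L2 d) (g : L2 d)] with x hx
        rw [Submodule.coe_add, hx, Pi.add_apply, Pi.add_apply, mul_add]
      map_smul' := by
        intro c f
        rw [RingHom.id_apply, ← MemLp.toLp_const_smul]
        refine MemLp.toLp_congr _ _ ?_
        filter_upwards [Lp.coeFn_smul c (f : L2 d)] with x hx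
        rw [Submodule.coe_smul, hx, Pi.smul_apply, Pi.smul_apply, smul_eq_mul, smul_eq_mul]
        ring }

/-- `S` is `T`-compact: `D(T) ⊆ D(S)`, and whenever `(uₙ)` and `(T uₙ)` are bounded, `(S uₙ)` has a
convergent subsequence. -/
def IsRelCompact {d : ℕ} (S T : L2 d →ₗ.[ℂ] L2 d) : Prop :=
  ∃ hdom : T.domain ≤ S.domain, ∀ u : ℕ → T.domain,
    (∃ C : ℝ, ∀ n, ‖(u n : L2 d)‖ ≤ C ∧ ‖T (u n)‖ ≤ C) →
    ∃ n : ℕ → ℕ, StrictMono n ∧ ∃ g : L2 d,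
      Filter.Tendsto (fun m => S ⟨u (n m), hdom (u (n m)).2⟩) Filter.atTop (nhds g)

/-- The quadratic form `⟨f, [T, iS] f⟩ = ⟨T f, i S f⟩ + ⟨i S f, T f⟩` of the commutator of two
symmetric operators, for `f ∈ D(T) ∩ D(S)`. It is real valued. -/
def commutatorForm {d : ℕ} (T S : L2 d →ₗ.[ℂ] L2 d) (f : L2 d) (hT : f ∈ T.domain)
    (hS : f ∈ S.domain) : ℝ :=
  (inner ℂ (T ⟨f, hT⟩) (Complex.I • S ⟨f, hS⟩)
    + inner ℂ (Complex.I • S ⟨f, hS⟩) (T ⟨f, hT⟩) : ℂ).re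

/-- `u` is essentially bounded. -/
def EssBounded {d : ℕ} (u : Space d → ℝ) : Prop :=
  ∃ C : ℝ, ∀ᵐ x ∂(volume : Measure (Space d)), |u x| ≤ C

/-- All the data, except for the coupling constant `w`, of an oscillating potential
`V = V_sr + v·∇Ṽ_sr + V_lr + V_c + W_{αβ}`, with the conditions they satisfy. -/
structure PotentialData (d : ℕ) where
  α : ℝ
  β : ℝ
  k : ℝ
  ρsr : ℝ
  ρlr : ℝ
  ρlr' : ℝ
  /-- the vector field `v` -/
  v : Space d → Space d
  /-- the cut-off function `κ` -/
  κ : ℝ → ℝ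
  Vsr : Space d → ℝ
  /-- the function `Ṽ_sr` -/
  Vtsr : Space d → ℝ
  /-- the function representing the distribution `v·∇Ṽ_sr` -/
  vgradVtsr : Space d → ℝ
  Vlr : Space d → ℝ
  Vc : Space d → ℝ
  α_pos : 0 < α
  β_pos : 0 < β
  ρsr_mem : ρsr ∈ Set.Ioc (0 : ℝ) 1
  ρlr_mem : ρlr ∈ Set.Ioc (0 : ℝ) 1
  ρlr'_mem : ρlr' ∈ Set.Ioc (0 : ℝ) 1
  v_contDiff : ContDiff ℝ 1 v
  v_bounded : ∃ C : ℝ, ∀ x, ‖fderiv ℝ v x‖ ≤ C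
  κ_smooth : ContDiff ℝ ∞ κ
  κ_compact : HasCompactSupport κ
  κ_one : ∀ t ∈ Set.Icc (-1 : ℝ) 1, κ t = 1
  κ_mem : ∀ t, κ t ∈ Set.Icc (0 : ℝ) 1
  Vsr_meas : AEMeasurable Vsr volume
  Vsr_bounded : EssBounded fun x => bracket x ^ (1 + ρsr) * Vsr x
  Vtsr_meas : AEMeasurable Vtsr volume
  Vtsr_bounded : EssBounded fun x => bracket x ^ (1 + ρsr) * Vtsr x
  vgradVtsr_meas : AEMeasurable vgradVtsr volume
  vgradVtsr_eq : HasFieldDeriv v Vtsr vgradVtsr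
  vgradVtsr_bounded : EssBounded fun x => bracket x ^ ρsr * vgradVtsr x
  Vlr_meas : AEMeasurable Vlr volume
  Vlr_bounded : EssBounded fun x => bracket x ^ ρlr * Vlr x
  /-- the distribution `⟨x⟩^{ρlr'} x·∇V_lr` is a bounded function -/
  xgradVlr_bounded : ∃ g : Space d → ℝ, AEMeasurable g volume ∧
    HasFieldDeriv (fun x => x) Vlr g ∧ EssBounded fun x => bracket x ^ ρlr' * g x
  Vc_meas : AEMeasurable Vc volume
  Vc_compactSupport : HasCompactSupport Vc
  Vc_relCompact : IsRelCompact (mulOp Vc) (freeH d)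

namespace PotentialData

variable {d : ℕ} (D : PotentialData d)

/-- The oscillating part `W_{αβ}(x) = w (1 - κ(|x|)) |x|^{-β} sin(k |x|^α)`. -/
def W (w : ℝ) (x : Space d) : ℝ :=
  w * (1 - D.κ ‖x‖) * ‖x‖ ^ (-D.β) * Real.sin (D.k * ‖x‖ ^ D.α)

/-- The potential `V = V_sr + v·∇Ṽ_sr + V_lr + V_c + W_{αβ}`. -/
def V (w : ℝ) (x : Space d) : ℝ :=
  D.Vsr x + D.vgradVtsr x + D.Vlr x + D.Vc x + D.W w x

/-- The Schrödinger operator `H = H₀ + V(Q)`. -/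
def H (w : ℝ) : L2 d →ₗ.[ℂ] L2 d := freeH d + mulOp (D.V w)

/-- The form `[(V_c + v·∇Ṽ_sr)(Q), iA]` is `H₀`-form-lower-bounded with relative bound less than
`2`. The form is tested on `D(H) ∩ D(A)`, where `D(H) = D(H₀) = H²(ℝ^d)`; the condition `hU` is
automatic since `(V_c + v·∇Ṽ_sr)(Q)` is `H₀`-bounded. -/
def CommutatorLowerBound : Prop :=
  ∃ εc > (0 : ℝ), ∃ lc > (0 : ℝ), ∀ (φ : L2 d) (h0 : φ ∈ (freeH d).domain)
    (hA : φ ∈ (dilationGen d).domain) (hU : φ ∈ (mulOp fun x => D.Vc x + D.vgradVtsr x).domain),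
    commutatorForm (mulOp fun x => D.Vc x + D.vgradVtsr x) (dilationGen d) φ hU hA
      ≥ (εc - 2) * (inner ℂ φ (freeH d ⟨φ, h0⟩)).re - lc * ‖φ‖ ^ 2

end PotentialData

end OscSchrodinger

end

/-!
# Absence of eigenfunctions that decay faster than every exponential

The proof is a Carleman estimate, obtained by the virial argument of Froese and Herbst and applied to
the eigenfunction with the weight `e^{γ⟨x⟩}` for `γ → ∞`.

For a test function `u` put `f = e^{γ⟨x⟩} u`. The conjugated operator
`conjOp γ q f = e^{γ⟨x⟩} (-Δ + q) u` differs from `-Δ + q - γ² |∇⟨x⟩|²` by `(2γ/⟨x⟩) iA`, which is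
antisymmetric to leading order, and a lower-order term. Pairing it with `iAf` gives the virial estimate
(`virial_estimate`): `2 ‖∇f‖²`, plus half of the positive term `4 ‖(γ/⟨x⟩)^{1/2} A f‖²`, is bounded by
the commutator of `q` with `iA` and terms of order `γ`. The term `γ² |∇⟨x⟩|²` does no harm, as it
increases along rays. Pairing with `f` gives the energy estimate (`energy_estimate`): `‖∇f‖²` equals
`γ² ∫ |∇⟨x⟩|² |f|²` up to the potential energy, which is small compared with `γ²` because `q` is
infinitesimally bounded with respect to `-Δ` (`potential_energy_le`). If the commutator of `q` stays
below `2 H₀` plus the remaining positive term (`CommutatorBound`), the two estimates contradict each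
other for large `γ` unless `∫ |∇⟨x⟩|² |f|²` is small, which is the Carleman estimate (`carleman`).

The potential `V - E` satisfies the commutator bound (`PotentialData.commutatorBound`). The part
`V_c + v · ∇Ṽ_sr` is covered by the hypothesis; `V_lr` has bounded `x · ∇V_lr`; `V_sr`, and `W` if
`β ≥ 1/2`, decay at least like `⟨x⟩^{-1/2}` and are absorbed by the term with weight `γ/⟨x⟩`. If
`β < 1/2`, then either `α ≤ β`, and `x · ∇W` is bounded, or `α + β > 2`. In the latter case the field
`W x` is to leading order the gradient of a bounded function `m` of size `w`, and the energy identity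
with weight `m` bounds the commutator of `W` by `w` times the energy
(`oscillating_commutator_le`); this is where `w` has to be small.

To apply the Carleman estimate to an eigenfunction `ψ`, smooth approximations of `ψ` in the graph norm
(`exists_isSmoothH2_approx`) are cut off at `|x| ~ 1/ε`. The gradient terms this creates are
controlled by the Caccioppoli inequality (`caccioppoli`) at the price of the larger weight
`e^{4(γ+1)⟨x⟩}`, against which `|ψ|²` is integrable (`carleman_cutoff`). The limit `ε → 0` gives
`∫ (|∇⟨x⟩|² - η) e^{2γ⟨x⟩} |ψ|² ≤ 0` for every `η > 0` and all large `γ`, and `γ → ∞` forces `ψ = 0`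
(`eq_zero_of_weighted_integral_nonpos`).
-/

noncomputable section

namespace OscSchrodinger

/-! ### Classical derivatives -/

section

variable {d : ℕ} {F : Type*} [NormedAddCommGroup F] [NormedSpace ℝ F]

/-- The classical partial derivative `∂ⱼ f`. -/
def pd (j : Fin d) (f : Space d → F) (x : Space d) : F :=
  fderiv ℝ f x (EuclideanSpace.single j 1)

/-- The classical Laplacian `∑ⱼ ∂ⱼ² f`. -/
def lap (f : Space d → F) (x : Space d) : F := ∑ j, pd j (pd j f) x

/-- The squared length `∑ⱼ |∂ⱼ f|²` of the gradient. -/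
def gradSq (f : Space d → F) (x : Space d) : ℝ := ∑ j, ‖pd j f x‖ ^ 2

/-- The operator `x · ∇ + d / 2`, that is `iA` in terms of the generator of dilations `A`. -/
def eul (f : Space d → F) (x : Space d) : F := fderiv ℝ f x x + ((d : ℝ) / 2) • f x

theorem fderiv_apply_eq_sum (f : Space d → F) (x y : Space d) :
    fderiv ℝ f x y = ∑ j, y j • pd j f x := by
  have h : y = ∑ j, y j • EuclideanSpace.single j (1 : ℝ) := by
    ext i
    simp [Finset.sum_apply, Pi.single_apply]
  conv_lhs => rw [h]
  simp only [map_sum, map_smul, pd]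

theorem contDiff_pd {f : Space d → F} (hf : ContDiff ℝ ∞ f) (j : Fin d) :
    ContDiff ℝ ∞ (pd j f) :=
  (hf.fderiv_right (m := ∞) (by simp)).clm_apply contDiff_const

theorem continuous_pd {f : Space d → F} (hf : ContDiff ℝ 1 f) (j : Fin d) :
    Continuous (pd j f) :=
  (hf.continuous_fderiv (by norm_num)).clm_apply continuous_const

theorem contDiff_lap {f : Space d → F} (hf : ContDiff ℝ ∞ f) : ContDiff ℝ ∞ (lap f) :=
  ContDiff.sum fun j _ => contDiff_pd (contDiff_pd hf j) j

theorem contDiff_eul {f : Space d → F} (hf : ContDiff ℝ ∞ f) : ContDiff ℝ ∞ (eul f) :=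
  ((hf.fderiv_right (m := ∞) (by simp)).clm_apply contDiff_id).add (contDiff_const.smul hf)

theorem continuous_gradSq {f : Space d → F} (hf : ContDiff ℝ 1 f) : Continuous (gradSq f) :=
  continuous_finsetSum _ fun j _ => (continuous_pd hf j).norm.pow 2

theorem gradSq_nonneg (f : Space d → F) (x : Space d) : 0 ≤ gradSq f x :=
  Finset.sum_nonneg fun _ _ => by positivity

theorem pd_support {f : Space d → F} (hf : HasCompactSupport f) (j : Fin d) :
    HasCompactSupport (pd j f) :=
  hf.fderiv_apply (𝕜 := ℝ) _

theorem lap_support {f : Space d → F} (hf : HasCompactSupport f) : HasCompactSupport (lap f) := by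
  have h : ∀ s : Finset (Fin d), HasCompactSupport fun x => ∑ j ∈ s, pd j (pd j f) x := by
    classical
    intro s
    induction s using Finset.induction_on with
    | empty =>
      simp only [Finset.sum_empty]
      exact HasCompactSupport.zero
    | insert a s ha ih =>
      simp only [Finset.sum_insert ha]
      exact (pd_support (pd_support hf a) a).add ih
  exact h Finset.univ

theorem eul_support {f : Space d → F} (hf : HasCompactSupport f) : HasCompactSupport (eul f) := by
  refine HasCompactSupport.add ?_ hf.smul_left
  refine (hf.fderiv (𝕜 := ℝ)).mono fun x hx => ?_
  contrapose! hx
  simp only [Function.mem_support, not_not] at hx ⊢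
  simp [hx]

theorem norm_fderiv_self_sq_le (f : Space d → F) (x : Space d) :
    ‖fderiv ℝ f x x‖ ^ 2 ≤ ‖x‖ ^ 2 * gradSq f x := by
  rw [fderiv_apply_eq_sum, EuclideanSpace.norm_sq_eq, gradSq]
  calc ‖∑ j, x j • pd j f x‖ ^ 2 ≤ (∑ j, ‖x j‖ * ‖pd j f x‖) ^ 2 := by
        gcongr
        exact (norm_sum_le _ _).trans_eq (by simp only [norm_smul])
    _ ≤ _ := Finset.sum_mul_sq_le_sq_mul_sq _ _ _

/-! ### Product rules -/

theorem pd_add {f g : Space d → F} {x : Space d} (j : Fin d) (hf : DifferentiableAt ℝ f x)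
    (hg : DifferentiableAt ℝ g x) : pd j (fun y => f y + g y) x = pd j f x + pd j g x := by
  simp only [pd]
  rw [fderiv_fun_add hf hg]
  rfl

theorem pd_sub {f g : Space d → F} {x : Space d} (j : Fin d) (hf : DifferentiableAt ℝ f x)
    (hg : DifferentiableAt ℝ g x) : pd j (fun y => f y - g y) x = pd j f x - pd j g x := by
  simp only [pd]
  rw [fderiv_fun_sub hf hg]
  rfl

theorem pd_smul {p : Space d → ℝ} {f : Space d → F} {x : Space d} (j : Fin d)
    (hp : DifferentiableAt ℝ p x) (hf : DifferentiableAt ℝ f x) :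
    pd j (fun y => p y • f y) x = p x • pd j f x + pd j p x • f x := by
  simp only [pd]
  rw [fderiv_fun_smul hp hf]
  simp

theorem pd_mul {p f : Space d → ℝ} {x : Space d} (j : Fin d)
    (hp : DifferentiableAt ℝ p x) (hf : DifferentiableAt ℝ f x) :
    pd j (fun y => p y * f y) x = p x * pd j f x + pd j p x * f x :=
  pd_smul j hp hf

theorem pd_sum {ι : Type*} {s : Finset ι} {f : ι → Space d → F} {x : Space d} (j : Fin d)
    (hf : ∀ i ∈ s, DifferentiableAt ℝ (f i) x) :
    pd j (fun y => ∑ i ∈ s, f i y) x = ∑ i ∈ s, pd j (f i) x := by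
  simp only [pd]
  rw [fderiv_fun_sum hf]
  simp only [sum_apply]

theorem pd_inner {f g : Space d → ℂ} {x : Space d} (j : Fin d)
    (hf : DifferentiableAt ℝ f x) (hg : DifferentiableAt ℝ g x) :
    pd j (fun y => inner ℝ (f y) (g y)) x = inner ℝ (f x) (pd j g x) + inner ℝ (pd j f x) (g x) := by
  simp only [pd]
  rw [fderiv_inner_apply ℝ hf hg]

theorem pd_coord (j k : Fin d) (x : Space d) :
    pd j (fun y : Space d => y k) x = if k = j then 1 else 0 := by
  have : (fun y : Space d => y k) = (EuclideanSpace.proj k : Space d →L[ℝ] ℝ) := rfl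
  rw [pd, this, ContinuousLinearMap.fderiv]
  simp

theorem pd_comm {f : Space d → F} (hf : ContDiff ℝ ∞ f) (j k : Fin d) (x : Space d) :
    pd j (pd k f) x = pd k (pd j f) x := by
  have hd : DifferentiableAt ℝ (fderiv ℝ f) x :=
    (hf.fderiv_right (m := 1) (WithTop.coe_le_coe.2 (le_top : (1 + 1 : ℕ∞) ≤ ⊤))).differentiable (by norm_num) x
  have key : ∀ a b : Fin d, pd a (pd b f) x
      = fderiv ℝ (fderiv ℝ f) x (EuclideanSpace.single a 1) (EuclideanSpace.single b 1) := by
    intro a b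
    have : pd b f = fun y => fderiv ℝ f y (EuclideanSpace.single b 1) := rfl
    rw [this, pd, fderiv_clm_apply hd (by fun_prop)]
    simp
  rw [key, key]
  exact (hf.contDiffAt.isSymmSndFDerivAt (by
    rw [minSmoothness_of_isRCLikeNormedField]
    exact WithTop.coe_le_coe.2 (le_top : (2 : ℕ∞) ≤ ⊤))) _ _

theorem lap_smul {p : Space d → ℝ} {f : Space d → F} (hp : ContDiff ℝ ∞ p) (hf : ContDiff ℝ ∞ f)
    (x : Space d) : lap (fun y => p y • f y) x
      = p x • lap f x + (2 : ℝ) • ∑ j, pd j p x • pd j f x + lap p x • f x := by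
  have dp : Differentiable ℝ p := hp.differentiable (by simp)
  have df : Differentiable ℝ f := hf.differentiable (by simp)
  have dpp : ∀ j, Differentiable ℝ (pd j p) := fun j => (contDiff_pd hp j).differentiable (by simp)
  have dff : ∀ j, Differentiable ℝ (pd j f) := fun j => (contDiff_pd hf j).differentiable (by simp)
  have h : ∀ j, pd j (pd j fun y => p y • f y) x
      = p x • pd j (pd j f) x + (2 : ℝ) • (pd j p x • pd j f x) + pd j (pd j p) x • f x := by
    intro j
    have h1 : pd j (fun y => p y • f y) = fun y => p y • pd j f y + pd j p y • f y := by
      funext y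
      exact pd_smul j (dp y) (df y)
    rw [h1, pd_add j ((dp x).fun_smul (dff j x)) ((dpp j x).fun_smul (df x)), pd_smul j (dp x) (dff j x),
      pd_smul j (dpp j x) (df x), two_smul]
    abel
  simp only [lap, h, Finset.sum_add_distrib, Finset.smul_sum, Finset.sum_smul]

/-! ### Integration by parts -/

theorem integral_pd_eq_zero {h : Space d → F} (hh : ContDiff ℝ 1 h)
    (hc : HasCompactSupport h) (j : Fin d) : ∫ x, pd j h x = 0 := by
  have hi : Integrable h := hh.continuous.integrable_of_hasCompactSupport hc
  have hi' : Integrable (pd j h) := (continuous_pd hh j).integrable_of_hasCompactSupport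
    (pd_support hc j)
  have := integral_smul_fderiv_eq_neg_fderiv_smul_of_integrable (𝕜 := ℝ) (f := fun _ : Space d => (1 : ℝ))
    (g := h) (μ := volume) (v := EuclideanSpace.single j 1) (by simp)
    (by simpa [pd] using (show Integrable (fun x => pd j h x) volume from hi'))
    (by simpa using hi) (fun _ _ => by fun_prop) (fun x _ => hh.differentiable (by norm_num) x)
  simpa [pd] using this

/-- A function that is pointwise the divergence of a compactly supported `C¹` field
has integral zero. -/
theorem integral_eq_zero_of_eq_sum_pd {a : Space d → F} {h : Fin d → Space d → F}
    (hh : ∀ j, ContDiff ℝ 1 (h j)) (hc : ∀ j, HasCompactSupport (h j))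
    (ha : ∀ x, a x = ∑ j, pd j (h j) x) : ∫ x, a x = 0 := by
  simp only [ha]
  rw [integral_finsetSum _ fun j _ => (continuous_pd (hh j) j).integrable_of_hasCompactSupport
    (pd_support (hc j) j)]
  exact Finset.sum_eq_zero fun j _ => integral_pd_eq_zero (hh j) (hc j) j

end

/-! ### Energy and virial identities -/

section

variable {d : ℕ} {f : Space d → ℂ}

theorem contDiff_one_of_smooth {G F : Type*} [NormedAddCommGroup G] [NormedSpace ℝ G]
    [NormedAddCommGroup F] [NormedSpace ℝ F] {f : G → F} (hf : ContDiff ℝ ∞ f) : ContDiff ℝ 1 f :=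
  hf.of_le (WithTop.coe_le_coe.2 (le_top : (1 : ℕ∞) ≤ ⊤))

theorem contDiff_coord {n : WithTop ℕ∞} (k : Fin d) : ContDiff ℝ n fun y : Space d => y k :=
  (EuclideanSpace.proj k : Space d →L[ℝ] ℝ).contDiff

theorem pd_norm_sq {x : Space d} (j : Fin d) (hf : DifferentiableAt ℝ f x) :
    pd j (fun y => ‖f y‖ ^ 2) x = 2 * inner ℝ (f x) (pd j f x) := by
  have h : (fun y => ‖f y‖ ^ 2) = fun y => inner ℝ (f y) (f y) := by
    funext y
    rw [real_inner_self_eq_norm_sq]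
  rw [h, pd_inner j hf hf, real_inner_comm]
  ring

/-- The energy identity `∫ m ⟪f, Δf⟫ = -∫ m |∇f|² - ∫ ⟪f, ∇m · ∇f⟫`. -/
theorem integral_energy {m : Space d → ℝ} (hm : ContDiff ℝ 1 m) (hf : ContDiff ℝ ∞ f)
    (hc : HasCompactSupport f) :
    ∫ x, (m x * inner ℝ (f x) (lap f x) + m x * gradSq f x
      + ∑ j, pd j m x * inner ℝ (f x) (pd j f x)) = 0 := by
  have df : Differentiable ℝ f := hf.differentiable (by simp)
  have dff : ∀ j, Differentiable ℝ (pd j f) := fun j => (contDiff_pd hf j).differentiable (by simp)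
  refine integral_eq_zero_of_eq_sum_pd (h := fun j x => m x * inner ℝ (f x) (pd j f x)) ?_ ?_ ?_
  · intro j
    exact hm.mul ((contDiff_one_of_smooth hf).inner ℝ (contDiff_one_of_smooth (contDiff_pd hf j)))
  · intro j
    refine hc.mono fun x hx => ?_
    contrapose! hx
    simp only [Function.mem_support, not_not] at hx ⊢
    simp [hx]
  · intro x
    have h : ∀ j, pd j (fun x => m x * inner ℝ (f x) (pd j f x)) x
        = m x * inner ℝ (f x) (pd j (pd j f) x) + m x * ‖pd j f x‖ ^ 2
          + pd j m x * inner ℝ (f x) (pd j f x) := by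
      intro j
      rw [pd_mul j (hm.differentiable (by norm_num) x) ((df x).inner ℝ (dff j x)),
        pd_inner j (df x) (dff j x), real_inner_self_eq_norm_sq]
      ring
    simp only [h, Finset.sum_add_distrib, lap, gradSq, inner_sum, Finset.mul_sum]

/-- `⟨hf, iA f⟩ + ⟨iA f, hf⟩ = -⟨f, (x · ∇h) f⟩`. -/
theorem integral_mul_inner_eul {h : Space d → ℝ} (hh : ContDiff ℝ 1 h) (hf : ContDiff ℝ ∞ f)
    (hc : HasCompactSupport f) :
    ∫ x, (h x * (2 * inner ℝ (f x) (eul f x)) + fderiv ℝ h x x * ‖f x‖ ^ 2) = 0 := by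
  have df : Differentiable ℝ f := hf.differentiable (by simp)
  have dh : Differentiable ℝ h := hh.differentiable (by norm_num)
  refine integral_eq_zero_of_eq_sum_pd (h := fun j x => x j * (h x * ‖f x‖ ^ 2)) ?_ ?_ ?_
  · intro j
    exact (contDiff_coord j).mul (hh.mul ((contDiff_one_of_smooth hf).norm_sq ℝ))
  · intro j
    refine hc.mono fun x hx => ?_
    contrapose! hx
    simp only [Function.mem_support, not_not] at hx ⊢
    simp [hx]
  · intro x
    have hj : ∀ j, pd j (fun x => x j * (h x * ‖f x‖ ^ 2)) x
        = h x * ‖f x‖ ^ 2 + (x j • pd j h x) * ‖f x‖ ^ 2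
          + h x * (2 * inner ℝ (f x) (x j • pd j f x)) := by
      intro j
      rw [pd_mul j ((contDiff_coord (n := 1) j).differentiable (by norm_num) x)
        ((dh x).fun_mul ((df x).norm_sq ℝ)), pd_mul j (dh x) ((df x).norm_sq ℝ),
        pd_norm_sq j (df x), pd_coord, inner_smul_right]
      simp only [if_true, smul_eq_mul]
      ring
    simp only [hj, Finset.sum_add_distrib, eul, fderiv_apply_eq_sum, inner_add_right, inner_sum,
      Finset.mul_sum, Finset.sum_mul, Finset.sum_const, inner_smul_right, real_inner_self_eq_norm_sq,
      mul_add, Finset.card_univ, Fintype.card_fin, nsmul_eq_mul]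
    ring

/-- The Rellich identity `⟨Δf, iA f⟩ + ⟨iA f, Δf⟩ = -2 ‖∇f‖²`, which expresses `[H₀, iA] = 2 H₀`. -/
theorem integral_rellich (hf : ContDiff ℝ ∞ f) (hc : HasCompactSupport f) :
    ∫ x, (2 * inner ℝ (lap f x) (eul f x) + 2 * gradSq f x) = 0 := by
  have df : Differentiable ℝ f := hf.differentiable (by simp)
  have dff : ∀ j, Differentiable ℝ (pd j f) := fun j => (contDiff_pd hf j).differentiable (by simp)
  have c1 : ∀ j, ContDiff ℝ 1 (pd j f) := fun j => contDiff_one_of_smooth (contDiff_pd hf j)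
  have dx : ∀ (k : Fin d) (x : Space d), DifferentiableAt ℝ (fun y : Space d => y k) x :=
    fun k => (contDiff_coord (n := 1) k).differentiable (by norm_num)
  refine integral_eq_zero_of_eq_sum_pd (h := fun j x =>
    (∑ k, x k * (2 * inner ℝ (pd j f x) (pd k f x)) - x j * ∑ k, ‖pd k f x‖ ^ 2)
      + d * inner ℝ (pd j f x) (f x)) ?_ ?_ ?_
  · intro j
    refine ContDiff.add (ContDiff.sub (ContDiff.sum fun k _ => ?_) ?_) ?_
    · exact (contDiff_coord k).mul (contDiff_const.mul ((c1 j).inner ℝ (c1 k)))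
    · exact (contDiff_coord j).mul (ContDiff.sum fun k _ => (c1 k).norm_sq ℝ)
    · exact contDiff_const.mul ((c1 j).inner ℝ (contDiff_one_of_smooth hf))
  · intro j
    refine (hc.fderiv (𝕜 := ℝ)).mono fun x hx => ?_
    contrapose! hx
    simp only [Function.mem_support, not_not] at hx ⊢
    simp [pd, hx]
  · intro x
    have hj : ∀ j, pd j (fun x => (∑ k, x k * (2 * inner ℝ (pd j f x) (pd k f x))
          - x j * ∑ k, ‖pd k f x‖ ^ 2) + d * inner ℝ (pd j f x) (f x)) x
        = (∑ k, (x k * (2 * (inner ℝ (pd j f x) (pd j (pd k f) x)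
              + inner ℝ (pd j (pd j f) x) (pd k f x)))
              + (if k = j then 1 else 0) * (2 * inner ℝ (pd j f x) (pd k f x)))
            - (x j * ∑ k, 2 * inner ℝ (pd k f x) (pd j (pd k f) x) + ∑ k, ‖pd k f x‖ ^ 2))
          + d * (inner ℝ (pd j f x) (pd j f x) + inner ℝ (pd j (pd j f) x) (f x)) := by
      intro j
      have d1 : ∀ k, DifferentiableAt ℝ (fun x => inner ℝ (pd j f x) (pd k f x)) x :=
        fun k => (dff j x).inner ℝ (dff k x)
      have d2 : ∀ k, DifferentiableAt ℝ (fun x => ‖pd k f x‖ ^ 2) x :=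
        fun k => (dff k x).norm_sq ℝ
      have d3 : DifferentiableAt ℝ (fun x => inner ℝ (pd j f x) (f x)) x := (dff j x).inner ℝ (df x)
      have d4 : ∀ k, DifferentiableAt ℝ (fun x => 2 * inner ℝ (pd j f x) (pd k f x)) x :=
        fun k => (d1 k).const_mul _
      have d5 : ∀ k, DifferentiableAt ℝ
          (fun x : Space d => x k * (2 * inner ℝ (pd j f x) (pd k f x))) x :=
        fun k => (dx k x).fun_mul (d4 k)
      have d6 : DifferentiableAt ℝ (fun x => ∑ k, ‖pd k f x‖ ^ 2) x :=
        DifferentiableAt.fun_sum fun k _ => d2 k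
      have cm : ∀ (c : ℝ) {g : Space d → ℝ}, DifferentiableAt ℝ g x →
          pd j (fun y => c * g y) x = c * pd j g x := by
        intro c g hg
        simp [pd, fderiv_const_mul hg]
      rw [pd_add j ((DifferentiableAt.fun_sum fun k _ => d5 k).fun_sub ((dx j x).fun_mul d6))
        (d3.const_mul _), pd_sub j (DifferentiableAt.fun_sum fun k _ => d5 k)
        ((dx j x).fun_mul d6), pd_sum j fun k _ => d5 k, pd_mul j (dx j x) d6,
        pd_sum j fun k _ => d2 k, cm _ d3, pd_inner j (dff j x) (df x)]
      simp only [fun k => pd_mul j (dx k x) (d4 k), fun k => cm 2 (d1 k),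
        fun k => pd_inner j (dff j x) (dff k x), pd_coord, fun k => pd_norm_sq j (dff k x),
        if_true, one_mul]
    have hA : ∑ j, ∑ k, x k * (2 * inner ℝ (pd j f x) (pd j (pd k f) x))
        = ∑ j, x j * ∑ k, 2 * inner ℝ (pd k f x) (pd j (pd k f) x) := by
      rw [Finset.sum_comm]
      refine Finset.sum_congr rfl fun k _ => ?_
      rw [Finset.mul_sum]
      refine Finset.sum_congr rfl fun j _ => ?_
      rw [pd_comm hf]
    have hB : ∑ j, ∑ k, x k * (2 * inner ℝ (pd j (pd j f) x) (pd k f x))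
        = 2 * inner ℝ (lap f x) (fderiv ℝ f x x) := by
      rw [Finset.sum_comm]
      simp only [lap, fderiv_apply_eq_sum, sum_inner, inner_sum, inner_smul_right, Finset.mul_sum]
      exact Finset.sum_congr rfl fun j _ => Finset.sum_congr rfl fun k _ => by ring
    have hC : ∑ j, (d : ℝ) * inner ℝ (pd j (pd j f) x) (f x) = d * inner ℝ (lap f x) (f x) := by
      simp only [lap, sum_inner, Finset.mul_sum]
    rw [Finset.sum_congr rfl fun j _ => hj j]
    simp only [mul_add, Finset.sum_add_distrib, Finset.sum_sub_distrib, hA, hB, hC, ite_mul,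
      one_mul, zero_mul, Finset.sum_ite_eq', Finset.mem_univ, if_true, real_inner_self_eq_norm_sq,
      Finset.sum_const, Finset.card_univ, Fintype.card_fin, nsmul_eq_mul, gradSq, eul,
      inner_add_right, inner_smul_right, ← Finset.mul_sum]
    ring

end

/-! ### The bracket and the conjugated operator -/

section

variable {d : ℕ}

theorem bracket_sq (x : Space d) : bracket x ^ 2 = 1 + ‖x‖ ^ 2 :=
  Real.sq_sqrt (by positivity)

theorem one_le_bracket (x : Space d) : 1 ≤ bracket x := by
  rw [bracket, Real.one_le_sqrt]
  nlinarith [sq_nonneg ‖x‖]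

theorem bracket_pos (x : Space d) : 0 < bracket x := lt_of_lt_of_le one_pos (one_le_bracket x)

theorem contDiff_bracket {n : WithTop ℕ∞} : ContDiff ℝ n (bracket : Space d → ℝ) :=
  (contDiff_const.add (contDiff_norm_sq ℝ)).sqrt fun x => by positivity

theorem hasFDerivAt_bracket (x : Space d) :
    HasFDerivAt (bracket : Space d → ℝ) ((bracket x)⁻¹ • innerSL ℝ x) x := by
  have h1 : HasFDerivAt (fun y : Space d => 1 + ‖y‖ ^ 2) (2 • innerSL ℝ x) x :=
    (hasStrictFDerivAt_norm_sq x).hasFDerivAt.const_add 1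
  have h2 := h1.sqrt (by positivity)
  refine h2.congr_fderiv ?_
  ext y
  simp [bracket]
  field_simp

theorem fderiv_bracket (x y : Space d) : fderiv ℝ bracket x y = inner ℝ x y / bracket x := by
  rw [(hasFDerivAt_bracket x).fderiv]
  simp
  field_simp

theorem pd_bracket (j : Fin d) (x : Space d) : pd j bracket x = x j / bracket x := by
  rw [pd, fderiv_bracket]
  congr 1
  simp [EuclideanSpace.inner_single_right]

/-- `|∇⟨x⟩|² = |x|² / ⟨x⟩²`. -/
def slopeSq (x : Space d) : ℝ := ‖x‖ ^ 2 / bracket x ^ 2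

theorem slopeSq_nonneg (x : Space d) : 0 ≤ slopeSq x := by unfold slopeSq; positivity

theorem slopeSq_le_one (x : Space d) : slopeSq x ≤ 1 := by
  rw [slopeSq, div_le_one (by have := bracket_pos x; positivity), bracket_sq]
  linarith

theorem slopeSq_eq (x : Space d) : slopeSq x = 1 - 1 / bracket x ^ 2 := by
  have := bracket_pos x
  rw [slopeSq]
  field_simp
  rw [bracket_sq]
  ring

theorem contDiff_slopeSq {n : WithTop ℕ∞} : ContDiff ℝ n (slopeSq : Space d → ℝ) :=
  (contDiff_norm_sq ℝ).div (contDiff_bracket.pow 2) fun x => by have := bracket_pos x; positivity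

/-- `|∇⟨x⟩|²` increases along rays, so that its commutator term in the virial identity has the
favourable sign. -/
theorem fderiv_slopeSq_self_nonneg (x : Space d) : 0 ≤ fderiv ℝ slopeSq x x := by
  have hb := bracket_pos x
  have h : (slopeSq : Space d → ℝ) = fun y => 1 - (bracket y ^ 2)⁻¹ := by
    funext y
    rw [slopeSq_eq, one_div]
  have h1 := ((hasDerivAt_inv (x := bracket x ^ 2) (by positivity)).comp_hasFDerivAt x
    ((hasFDerivAt_bracket x).pow 2)).const_sub 1
  simp only [Function.comp_def] at h1
  rw [h, h1.fderiv]
  simp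
  positivity

/-- Test functions: `C_c^∞(ℝ^d; F)`. -/
structure IsTest {F : Type*} [NormedAddCommGroup F] [NormedSpace ℝ F] (f : Space d → F) :
    Prop where
  smooth : ContDiff ℝ ∞ f
  supp : HasCompactSupport f

namespace IsTest

variable {F : Type*} [NormedAddCommGroup F] [NormedSpace ℝ F] {f : Space d → F}

theorem pd (hf : IsTest f) (j : Fin d) : IsTest (pd j f) :=
  ⟨contDiff_pd hf.smooth j, pd_support hf.supp j⟩

theorem lap (hf : IsTest f) : IsTest (lap f) := ⟨contDiff_lap hf.smooth, lap_support hf.supp⟩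

theorem eul (hf : IsTest f) : IsTest (eul f) := ⟨contDiff_eul hf.smooth, eul_support hf.supp⟩

theorem smul {p : Space d → ℝ} (hp : ContDiff ℝ ∞ p) (hf : IsTest f) :
    IsTest fun x => p x • f x :=
  ⟨hp.smul hf.smooth, hf.supp.smul_left⟩

theorem memLp (hf : IsTest f) : MemLp f 2 volume :=
  hf.smooth.continuous.memLp_of_hasCompactSupport hf.supp

theorem norm_sq (hf : IsTest f) {p : Space d → ℝ} (hp : Continuous p) :
    Integrable fun x => p x * ‖f x‖ ^ 2 := by
  refine Continuous.integrable_of_hasCompactSupport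
    (hp.mul (hf.smooth.continuous.norm.pow 2)) (hf.supp.mono fun x hx => ?_)
  contrapose! hx
  simp only [Function.mem_support, not_not] at hx ⊢
  simp [hx]

theorem norm_sq' (hf : IsTest f) : Integrable fun x => ‖f x‖ ^ 2 := by
  simpa using hf.norm_sq continuous_const (p := fun _ => 1)

theorem gradSq (hf : IsTest f) : Integrable (gradSq f) := by
  unfold OscSchrodinger.gradSq
  exact integrable_finsetSum _ fun j _ => (hf.pd j).norm_sq'

end IsTest

theorem integrable_inner_of_memLp {u v : Space d → ℂ} (hu : MemLp u 2 volume)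
    (hv : MemLp v 2 volume) : Integrable fun x => inner ℝ (u x) (v x) := by
  refine Integrable.mono' (g := fun x => ‖u x‖ ^ 2 + ‖v x‖ ^ 2)
    (((memLp_two_iff_integrable_sq_norm hu.1).1 hu).add
      ((memLp_two_iff_integrable_sq_norm hv.1).1 hv)) (hu.1.inner hv.1) ?_
  refine Filter.Eventually.of_forall fun x => ?_
  rw [Real.norm_eq_abs]
  nlinarith [abs_real_inner_le_norm (u x) (v x), sq_nonneg (‖u x‖ - ‖v x‖), sq_nonneg (‖u x‖),
    sq_nonneg (‖v x‖)]

/-- The operator `e^F (-Δ + q) e^{-F}` for `F = γ ⟨x⟩`. The first-order part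
`2 ∇F · ∇ + ΔF` is written as `(2γ/⟨x⟩) iA - γ |x|² / ⟨x⟩³` with `iA = x · ∇ + d / 2`. -/
def conjOp (γ : ℝ) (q : Space d → ℝ) (f : Space d → ℂ) (x : Space d) : ℂ :=
  -lap f x + (2 * γ / bracket x) • eul f x
    + (q x - γ ^ 2 * slopeSq x - γ * slopeSq x / bracket x) • f x

theorem lap_exp_bracket_smul (γ : ℝ) {f : Space d → ℂ} (hf : ContDiff ℝ ∞ f) (x : Space d) :
    lap (fun y => Real.exp (-γ * bracket y) • f y) x
      = Real.exp (-γ * bracket x) • (lap f x - (2 * γ / bracket x) • eul f x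
        + (γ ^ 2 * slopeSq x + γ * slopeSq x / bracket x) • f x) := by
  have hb := bracket_pos x
  have db : Differentiable ℝ (bracket : Space d → ℝ) :=
    (contDiff_bracket (n := 1)).differentiable (by norm_num)
  have sp : ContDiff ℝ ∞ fun y : Space d => Real.exp (-γ * bracket y) :=
    (contDiff_const.mul contDiff_bracket).exp
  have h1 : ∀ j, pd j (fun y : Space d => Real.exp (-γ * bracket y))
      = fun y => (-γ * (y j * (bracket y)⁻¹)) * Real.exp (-γ * bracket y) := by
    intro j
    funext y
    have h := ((hasFDerivAt_bracket y).const_mul (-γ)).exp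
    rw [pd, h.fderiv]
    simp [EuclideanSpace.inner_single_right]
    ring
  have h2 : ∀ j, pd j (fun y : Space d => (bracket y)⁻¹) x = -(x j / bracket x ^ 3) := by
    intro j
    have h := (hasDerivAt_inv hb.ne').comp_hasFDerivAt x (hasFDerivAt_bracket x)
    have h' : (fun y : Space d => (bracket y)⁻¹) = Inv.inv ∘ bracket := rfl
    rw [pd, h', h.fderiv]
    simp [EuclideanSpace.inner_single_right]
    field_simp
  have h3 : ∀ j, pd j (pd j fun y : Space d => Real.exp (-γ * bracket y)) x
      = (-γ * (1 / bracket x - x j ^ 2 / bracket x ^ 3) + γ ^ 2 * x j ^ 2 / bracket x ^ 2)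
        * Real.exp (-γ * bracket x) := by
    intro j
    have dx : DifferentiableAt ℝ (fun y : Space d => y j) x :=
      (contDiff_coord (n := 1) j).differentiable (by norm_num) x
    have di : DifferentiableAt ℝ (fun y : Space d => (bracket y)⁻¹) x := (db x).inv hb.ne'
    have dm : DifferentiableAt ℝ (fun y : Space d => y j * (bracket y)⁻¹) x := dx.fun_mul di
    rw [h1, pd_mul j (dm.const_mul _) (sp.differentiable (by simp) x), h1,
      pd_mul (p := fun _ => -γ) j (by fun_prop) dm, pd_mul j dx di, h2, pd_coord]
    simp only [pd, fderiv_fun_const, if_true]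
    simp
    field_simp
    ring
  have hn : ∑ j, x j ^ 2 = ‖x‖ ^ 2 := by
    rw [EuclideanSpace.real_norm_sq_eq]
  have h4 : lap (fun y : Space d => Real.exp (-γ * bracket y)) x
      = (-γ * (d / bracket x - ‖x‖ ^ 2 / bracket x ^ 3) + γ ^ 2 * slopeSq x)
        * Real.exp (-γ * bracket x) := by
    simp only [lap, h3, ← Finset.sum_mul, Finset.sum_add_distrib, ← Finset.mul_sum,
      Finset.sum_sub_distrib, Finset.sum_const, Finset.card_univ, Fintype.card_fin, nsmul_eq_mul,
      ← Finset.sum_div, hn, slopeSq]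
    ring
  rw [lap_smul sp hf, h4]
  have h5 : ∑ j, pd j (fun y : Space d => Real.exp (-γ * bracket y)) x • pd j f x
      = (-γ * (bracket x)⁻¹ * Real.exp (-γ * bracket x)) • fderiv ℝ f x x := by
    rw [fderiv_apply_eq_sum, Finset.smul_sum]
    refine Finset.sum_congr rfl fun j _ => ?_
    rw [h1, smul_smul]
    congr 1
    ring
  rw [h5, eul, slopeSq]
  match_scalars <;> field_simp <;> ring

/-- Conjugation by the weight: with `f = e^F u`, `e^F (-Δ + q) u = conjOp γ q f`. -/
theorem conjOp_exp_smul (γ : ℝ) (q : Space d → ℝ) {u : Space d → ℂ} (hu : ContDiff ℝ ∞ u)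
    (x : Space d) : conjOp γ q (fun y => Real.exp (γ * bracket y) • u y) x
      = Real.exp (γ * bracket x) • (-lap u x + q x • u x) := by
  have hs : ContDiff ℝ ∞ fun y : Space d => Real.exp (γ * bracket y) • u y :=
    (contDiff_const.mul contDiff_bracket).exp.smul hu
  have h := lap_exp_bracket_smul γ hs x
  have h0 : (fun y : Space d => Real.exp (-γ * bracket y) • Real.exp (γ * bracket y) • u y) = u := by
    funext y
    rw [smul_smul, ← Real.exp_add]
    simp
  rw [h0] at h
  have h1 : Real.exp (γ * bracket x) * Real.exp (-γ * bracket x) = 1 := by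
    rw [← Real.exp_add]
    simp
  rw [h, smul_add, smul_neg, smul_smul (Real.exp (γ * bracket x)), h1, one_smul, conjOp]
  module

end

/-! ### The virial estimate -/

section

variable {d : ℕ} {γ : ℝ} {q : Space d → ℝ} {f : Space d → ℂ}

/-- `q` maps test functions to `L²`. -/
def IsTestMultiplier (q : Space d → ℝ) : Prop :=
  ∀ f : Space d → ℂ, IsTest f → MemLp (fun x => q x • f x) 2 volume

theorem memLp_conjOp (hq : IsTestMultiplier q) (hf : IsTest f) :
    MemLp (conjOp γ q f) 2 volume := by
  have h1 : MemLp (fun x => -lap f x) 2 volume := hf.lap.memLp.neg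
  have h2 : MemLp (fun x => (2 * γ / bracket x) • eul f x) 2 volume :=
    (hf.eul.smul (contDiff_const.div contDiff_bracket fun x => (bracket_pos x).ne')).memLp
  have h3 : MemLp (fun x => (γ ^ 2 * slopeSq x + γ * slopeSq x / bracket x) • f x) 2 volume :=
    (hf.smul ((contDiff_const.mul contDiff_slopeSq).add ((contDiff_const.mul contDiff_slopeSq).div
      contDiff_bracket fun x => (bracket_pos x).ne'))).memLp
  refine (((h1.add h2).add (hq f hf)).sub h3).ae_eq (Filter.Eventually.of_forall fun x => ?_)
  simp only [conjOp, Pi.add_apply, Pi.sub_apply]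
  module

theorem memLp_bracket_conjOp (hq : IsTestMultiplier q) (hf : IsTest f) :
    MemLp (fun x => bracket x • conjOp γ q f x) 2 volume := by
  have h1 : MemLp (fun x => bracket x • -lap f x) 2 volume :=
    (IsTest.smul (f := fun x => -lap f x) contDiff_bracket
      ⟨hf.lap.smooth.neg, hf.lap.supp.neg⟩).memLp
  have h2 : MemLp (fun x => (bracket x * (2 * γ / bracket x)) • eul f x) 2 volume :=
    (hf.eul.smul (contDiff_bracket.mul
      (contDiff_const.div contDiff_bracket fun x => (bracket_pos x).ne'))).memLp
  have h3 : MemLp (fun x => (bracket x * (γ ^ 2 * slopeSq x + γ * slopeSq x / bracket x)) • f x)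
      2 volume :=
    (hf.smul (contDiff_bracket.mul ((contDiff_const.mul contDiff_slopeSq).add
      ((contDiff_const.mul contDiff_slopeSq).div
      contDiff_bracket fun x => (bracket_pos x).ne')))).memLp
  refine (((h1.add h2).add (hq _ (hf.smul contDiff_bracket))).sub h3).ae_eq
    (Filter.Eventually.of_forall fun x => ?_)
  simp only [conjOp, Pi.add_apply, Pi.sub_apply]
  module

theorem integrable_conjOp (hq : IsTestMultiplier q) (hf : IsTest f) :
    Integrable fun x => ‖bracket x • conjOp γ q f x‖ ^ 2 :=
  (memLp_two_iff_integrable_sq_norm (memLp_bracket_conjOp hq hf).1).1 (memLp_bracket_conjOp hq hf)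

theorem IsTestMultiplier.integrable_inner (hq : IsTestMultiplier q) (hf : IsTest f)
    {v : Space d → ℂ} (hv : IsTest v) : Integrable fun x => q x * inner ℝ (f x) (v x) := by
  have h := integrable_inner_of_memLp (hq f hf) hv.memLp
  simpa only [real_inner_smul_left] using h

theorem IsTestMultiplier.norm_sq (hq : IsTestMultiplier q) (hf : IsTest f) :
    Integrable fun x => q x * ‖f x‖ ^ 2 := by
  simpa only [real_inner_self_eq_norm_sq] using hq.integrable_inner hf hf

theorem IsTest.integrable_inner (hf : IsTest f) {v : Space d → ℂ} (hv : IsTest v)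
    {p : Space d → ℝ} (hp : Continuous p) : Integrable fun x => p x * inner ℝ (f x) (v x) := by
  refine Continuous.integrable_of_hasCompactSupport
    (hp.mul (hf.smooth.continuous.inner hv.smooth.continuous)) (hf.supp.mono fun x hx => ?_)
  contrapose! hx
  simp only [Function.mem_support, not_not] at hx ⊢
  simp [hx]

/-- Pointwise form of the virial estimate, with `B = ⟨x⟩`, `t = |∇⟨x⟩|²`, `D = x · ∇t`, `z = f x`,
`L = Δf x`, `e = iAf x`, `G = |∇f x|²` and `r` the value of the conjugated operator at `f`. The first
two terms on the right have integral zero. -/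
theorem virial_pointwise {B t D G : ℝ} {L e z r : ℂ} (hγ : 1 ≤ γ) (hB : 1 ≤ B) (ht : 0 ≤ t)
    (ht1 : t ≤ 1) (hD : 0 ≤ D) {q : ℝ}
    (hr : r = -L + (2 * γ / B) • e + (q - γ ^ 2 * t - γ * t / B) • z) :
    2 * G + 2 * (γ / B * ‖e‖ ^ 2) + q * (2 * inner ℝ z e)
      ≤ (2 * inner ℝ L e + 2 * G) + γ ^ 2 * (t * (2 * inner ℝ z e) + D * ‖z‖ ^ 2)
        + γ * ‖z‖ ^ 2 + ‖B • r‖ ^ 2 := by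
  have hγ0 : 0 < γ := by linarith
  have hB0 : 0 < B := by linarith
  have h1 : inner ℝ r e = -inner ℝ L e + 2 * γ / B * ‖e‖ ^ 2
      + (q - γ ^ 2 * t - γ * t / B) * inner ℝ z e := by
    rw [hr, inner_add_left, inner_add_left, inner_neg_left, real_inner_smul_left,
      real_inner_smul_left, real_inner_self_eq_norm_sq]
  -- The weight `⟨x⟩` on `r` is the price of the degenerate coefficient `γ / ⟨x⟩` of `|e|²`.
  have h2 : 2 * inner ℝ r e ≤ γ / B * ‖e‖ ^ 2 + ‖B • r‖ ^ 2 := by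
    have ha : inner ℝ r e ≤ ‖r‖ * ‖e‖ := real_inner_le_norm r e
    have hb : 0 ≤ γ / B * (‖e‖ - B / γ * ‖r‖) ^ 2 := by positivity
    have hc : γ / B * (‖e‖ - B / γ * ‖r‖) ^ 2
        = γ / B * ‖e‖ ^ 2 - 2 * (‖r‖ * ‖e‖) + B / γ * ‖r‖ ^ 2 := by
      field_simp
      ring
    have hd : B / γ * ‖r‖ ^ 2 ≤ ‖B • r‖ ^ 2 := by
      rw [norm_smul, mul_pow, Real.norm_eq_abs, sq_abs]
      gcongr
      rw [div_le_iff₀ hγ0]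
      nlinarith [mul_le_mul hB hγ (by norm_num) (by positivity)]
    linarith
  have h3 : γ * t / B * (2 * inner ℝ z e) ≤ γ / B * ‖e‖ ^ 2 + γ * ‖z‖ ^ 2 := by
    have ha : inner ℝ z e ≤ ‖z‖ * ‖e‖ := real_inner_le_norm z e
    have hb : 0 ≤ γ / B * (‖e‖ - t * ‖z‖) ^ 2 := by positivity
    have hc : γ / B * (‖e‖ - t * ‖z‖) ^ 2
        = γ / B * ‖e‖ ^ 2 - γ * t / B * (2 * (‖z‖ * ‖e‖)) + γ * (t ^ 2 / B) * ‖z‖ ^ 2 := by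
      field_simp
      ring
    have hd : t ^ 2 / B ≤ 1 := by
      rw [div_le_one hB0]
      nlinarith
    have he : γ * (t ^ 2 / B) * ‖z‖ ^ 2 ≤ γ * 1 * ‖z‖ ^ 2 := by gcongr
    have hf : γ * t / B * (2 * inner ℝ z e) ≤ γ * t / B * (2 * (‖z‖ * ‖e‖)) := by gcongr
    linarith
  have h4 : 0 ≤ γ ^ 2 * (D * ‖z‖ ^ 2) := by positivity
  have h5 : 2 * (γ / B * ‖e‖ ^ 2) * 2 = 2 * (2 * γ / B * ‖e‖ ^ 2) := by ring
  linarith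

/-- The virial estimate. Pairing the conjugated operator with `iAf` yields `[H₀, iA] = 2 H₀`, the
commutator of `q`, and the positive term `4 ‖(γ/⟨x⟩)^{1/2} A f‖²` of the antisymmetric part. One half
of the latter absorbs the lower-order terms and the other half is kept. -/
theorem virial_estimate (hγ : 1 ≤ γ) (hq : IsTestMultiplier q) (hf : IsTest f) :
    2 * ∫ x, gradSq f x ≤ (∫ x, -(q x * (2 * inner ℝ (f x) (eul f x))))
      - 2 * (∫ x, γ / bracket x * ‖eul f x‖ ^ 2) + γ * (∫ x, ‖f x‖ ^ 2)
      + ∫ x, ‖bracket x • conjOp γ q f x‖ ^ 2 := by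
  have cb : Continuous fun x : Space d => γ / bracket x :=
    continuous_const.div (contDiff_bracket (n := 0)).continuous fun x => (bracket_pos x).ne'
  have i1 := hf.gradSq.const_mul 2
  have i2 := (hf.eul.norm_sq cb).const_mul 2
  have i3 : Integrable fun x => q x * (2 * inner ℝ (f x) (eul f x)) := by
    refine ((hq.integrable_inner hf hf.eul).const_mul 2).congr
      (Filter.Eventually.of_forall fun x => ?_)
    ring
  have i4 := (hf.lap.integrable_inner hf.eul (p := fun _ => 2) continuous_const).add i1
  have i5 : Integrable fun x => slopeSq x * (2 * inner ℝ (f x) (eul f x))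
      + fderiv ℝ slopeSq x x * ‖f x‖ ^ 2 := by
    refine Integrable.add ?_ (hf.norm_sq ?_)
    · refine ((hf.integrable_inner hf.eul (contDiff_slopeSq (n := 0)).continuous).const_mul 2).congr
        (Filter.Eventually.of_forall fun x => ?_)
      ring
    · exact ((contDiff_slopeSq (n := 1)).continuous_fderiv (by norm_num)).clm_apply continuous_id
  have i6 := hf.norm_sq'.const_mul γ
  have i7 := integrable_conjOp (γ := γ) hq hf
  have key := integral_mono ((i1.add i2).add i3) (((i4.add (i5.const_mul (γ ^ 2))).add i6).add i7)
    (fun x => virial_pointwise (G := gradSq f x) hγ (one_le_bracket x) (slopeSq_nonneg x)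
      (slopeSq_le_one x) (fderiv_slopeSq_self_nonneg x) (z := f x) (L := lap f x) (e := eul f x)
      (r := conjOp γ q f x) (q := q x) rfl)
  rw [integral_add' (i1.add i2) i3, integral_add' i1 i2,
    integral_add' ((i4.add (i5.const_mul _)).add i6) i7, integral_add' (i4.add (i5.const_mul _)) i6,
    integral_add' i4 (i5.const_mul _), integral_const_mul, integral_const_mul, integral_const_mul,
    integral_const_mul] at key
  have z1 := integral_rellich hf.smooth hf.supp
  have z2 := integral_mul_inner_eul (contDiff_slopeSq (n := 1)) hf.smooth hf.supp
  simp only [Pi.add_apply] at key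
  rw [z1, z2] at key
  rw [integral_neg]
  linarith

end

/-! ### Energy estimates -/

section

variable {d : ℕ} {γ : ℝ} {q : Space d → ℝ} {f : Space d → ℂ}

theorem IsTestMultiplier.sq_norm_sq (hq : IsTestMultiplier q) (hf : IsTest f) :
    Integrable fun x => q x ^ 2 * ‖f x‖ ^ 2 := by
  have h := (memLp_two_iff_integrable_sq_norm (hq f hf).1).1 (hq f hf)
  refine h.congr (Filter.Eventually.of_forall fun x => ?_)
  simp [mul_pow]

theorem IsTestMultiplier.abs_norm_sq (hq : IsTestMultiplier q) (hf : IsTest f) :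
    Integrable fun x => |q x| * ‖f x‖ ^ 2 := by
  refine (hq.norm_sq hf).abs.congr (Filter.Eventually.of_forall fun x => ?_)
  simp [abs_mul]

theorem norm_sq_conjOp_le (x : Space d) :
    ‖conjOp γ q f x‖ ^ 2 ≤ ‖bracket x • conjOp γ q f x‖ ^ 2 := by
  rw [norm_smul, mul_pow, Real.norm_eq_abs, sq_abs]
  have hb : 1 ≤ bracket x ^ 2 := one_le_pow₀ (one_le_bracket x)
  exact le_mul_of_one_le_left (by positivity) hb

/-- The equation satisfied by `f` modulo `conjOp γ q f`, solved for `Δf`. -/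
theorem lap_eq_conjOp (x : Space d) : lap f x = (2 * γ / bracket x) • eul f x
    + (q x - γ ^ 2 * slopeSq x - γ * slopeSq x / bracket x) • f x - conjOp γ q f x := by
  rw [conjOp]
  module

/-- The energy identity for the conjugated operator. -/
theorem energy_identity (hq : IsTestMultiplier q) (hf : IsTest f) :
    (∫ x, gradSq f x) + (∫ x, q x * ‖f x‖ ^ 2) - γ ^ 2 * (∫ x, slopeSq x * ‖f x‖ ^ 2)
      - (∫ x, inner ℝ (f x) (conjOp γ q f x)) = 0 := by
  have hbd : ContDiff ℝ 1 fun x : Space d => γ / bracket x :=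
    contDiff_const.div contDiff_bracket fun x => (bracket_pos x).ne'
  have z1 := integral_energy (m := fun _ => 1) contDiff_const hf.smooth hf.supp
  have z2 := integral_mul_inner_eul hbd hf.smooth hf.supp
  have z3 : ∀ x : Space d, fderiv ℝ (fun x : Space d => γ / bracket x) x x
      = -(γ * slopeSq x / bracket x) := by
    intro x
    have hb := bracket_pos x
    have h := ((hasDerivAt_inv hb.ne').comp_hasFDerivAt x (hasFDerivAt_bracket x)).const_mul γ
    have h' : (fun x : Space d => γ / bracket x) = fun x => γ * (Inv.inv ∘ bracket) x := by
      funext y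
      simp [div_eq_mul_inv]
    rw [h', h.fderiv, slopeSq]
    simp
    field_simp
  have i1 : Integrable fun x => (1 : ℝ) * inner ℝ (f x) (lap f x) + 1 * gradSq f x
      + ∑ j, pd j (fun _ : Space d => (1 : ℝ)) x * inner ℝ (f x) (pd j f x) := by
    refine ((hf.integrable_inner hf.lap (p := fun _ => 1) continuous_const).add
      (hf.gradSq.const_mul 1)).congr (Filter.Eventually.of_forall fun x => ?_)
    simp [pd]
  have i2 : Integrable fun x => γ / bracket x * (2 * inner ℝ (f x) (eul f x))
      + fderiv ℝ (fun x : Space d => γ / bracket x) x x * ‖f x‖ ^ 2 := by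
    refine Integrable.add ?_ (hf.norm_sq ?_)
    · refine ((hf.integrable_inner hf.eul hbd.continuous).const_mul 2).congr
        (Filter.Eventually.of_forall fun x => ?_)
      ring
    · exact (hbd.continuous_fderiv (by norm_num)).clm_apply continuous_id
  have j1 := hf.gradSq
  have j2 := hq.norm_sq hf
  have j3 := (hf.norm_sq (contDiff_slopeSq (n := 0)).continuous).const_mul (γ ^ 2)
  have j4 := integrable_inner_of_memLp hf.memLp (memLp_conjOp (γ := γ) hq hf)
  have z := integral_sub i1 i2
  rw [z1, z2, sub_zero] at z
  rw [← integral_const_mul, ← integral_add' j1 j2, ← integral_sub' (j1.add j2) j3,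
    ← integral_sub' ((j1.add j2).sub j3) j4, ← z]
  refine integral_congr_ae (Filter.Eventually.of_forall fun x => ?_)
  simp only [Pi.add_apply, Pi.sub_apply]
  rw [z3, lap_eq_conjOp (γ := γ) (q := q), inner_sub_right, inner_add_right, inner_smul_right,
    inner_smul_right, real_inner_self_eq_norm_sq]
  simp [pd]
  ring

theorem abs_inner_conjOp_le (x : Space d) :
    |inner ℝ (f x) (conjOp γ q f x)| ≤ ‖f x‖ ^ 2 / 2 + ‖bracket x • conjOp γ q f x‖ ^ 2 / 2 := by
  have h1 := abs_real_inner_le_norm (f x) (conjOp γ q f x)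
  have h2 := norm_sq_conjOp_le (γ := γ) (q := q) (f := f) x
  nlinarith [sq_nonneg (‖f x‖ - ‖conjOp γ q f x‖)]

/-- Up to the potential energy, the kinetic energy equals `γ² ∫ |∇⟨x⟩|² |f|²`. -/
theorem energy_estimate (hq : IsTestMultiplier q) (hf : IsTest f) :
    |(∫ x, gradSq f x) - γ ^ 2 * (∫ x, slopeSq x * ‖f x‖ ^ 2)| ≤ (∫ x, |q x| * ‖f x‖ ^ 2)
      + (∫ x, ‖f x‖ ^ 2) + ∫ x, ‖bracket x • conjOp γ q f x‖ ^ 2 := by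
  have h := energy_identity (γ := γ) hq hf
  have h1 : |∫ x, q x * ‖f x‖ ^ 2| ≤ ∫ x, |q x| * ‖f x‖ ^ 2 := by
    refine (abs_integral_le_integral_abs).trans_eq ?_
    simp [abs_mul]
  have iR := integrable_conjOp (γ := γ) hq hf
  have h2 : |∫ x, inner ℝ (f x) (conjOp γ q f x)|
      ≤ (∫ x, ‖f x‖ ^ 2) / 2 + (∫ x, ‖bracket x • conjOp γ q f x‖ ^ 2) / 2 := by
    refine (abs_integral_le_integral_abs).trans ?_
    rw [← integral_div, ← integral_div, ← integral_add (hf.norm_sq'.div_const _) (iR.div_const _)]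
    exact integral_mono (integrable_inner_of_memLp hf.memLp (memLp_conjOp hq hf)).abs
      ((hf.norm_sq'.div_const _).add (iR.div_const _)) abs_inner_conjOp_le
  have h3 : 0 ≤ ∫ x, ‖f x‖ ^ 2 := integral_nonneg fun x => by positivity
  have h4 : 0 ≤ ∫ x, ‖bracket x • conjOp γ q f x‖ ^ 2 := integral_nonneg fun x => by positivity
  rw [abs_le] at *
  constructor <;> linarith

/-- The first-order term of the conjugated operator is bounded by `γ |∇f|`: the factor `|x| / ⟨x⟩` of
`|(x/⟨x⟩) · ∇f|` is the root of `slopeSq`. -/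
theorem gradient_term_le (x : Space d) :
    ‖(2 * γ / bracket x) • fderiv ℝ f x x‖ ^ 2 ≤ 4 * γ ^ 2 * slopeSq x * gradSq f x := by
  have hb := bracket_pos x
  have h := norm_fderiv_self_sq_le f x
  have e : 4 * γ ^ 2 * slopeSq x * gradSq f x
      = (2 * γ / bracket x) ^ 2 * (‖x‖ ^ 2 * gradSq f x) := by
    rw [slopeSq]
    field_simp
    ring
  rw [norm_smul, mul_pow, Real.norm_eq_abs, sq_abs, e]
  gcongr

/-- `‖Δf‖` is of order `γ ‖∇f‖ + γ² ‖f‖`, modulo `q f` and the conjugated operator. -/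
theorem norm_sq_lap_le (hγ : 1 ≤ γ) (x : Space d) :
    ‖lap f x‖ ^ 2 ≤ 16 * γ ^ 2 * gradSq f x + 4 * (d + 2) ^ 2 * γ ^ 4 * ‖f x‖ ^ 2
      + 4 * (q x ^ 2 * ‖f x‖ ^ 2) + 4 * ‖bracket x • conjOp γ q f x‖ ^ 2 := by
  have hb := one_le_bracket x
  have hb0 := bracket_pos x
  have t0 := slopeSq_nonneg x
  have t1 := slopeSq_le_one x
  have hγ0 : 0 < γ := by linarith
  set c : ℝ := γ * d / bracket x - γ ^ 2 * slopeSq x - γ * slopeSq x / bracket x with hc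
  have e : lap f x = (2 * γ / bracket x) • fderiv ℝ f x x + c • f x + q x • f x
      - conjOp γ q f x := by
    rw [lap_eq_conjOp (γ := γ) (q := q), eul, hc]
    match_scalars <;> field_simp <;> ring
  have h1 : ‖lap f x‖ ≤ ‖(2 * γ / bracket x) • fderiv ℝ f x x‖ + ‖c • f x‖ + ‖q x • f x‖
      + ‖conjOp γ q f x‖ := by
    rw [e]
    exact (norm_sub_le _ _).trans (by gcongr; exact norm_add₃_le)
  have h2 : ‖lap f x‖ ^ 2 ≤ 4 * (‖(2 * γ / bracket x) • fderiv ℝ f x x‖ ^ 2 + ‖c • f x‖ ^ 2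
      + ‖q x • f x‖ ^ 2 + ‖conjOp γ q f x‖ ^ 2) := by
    set a1 := ‖(2 * γ / bracket x) • fderiv ℝ f x x‖
    set a2 := ‖c • f x‖
    set a3 := ‖q x • f x‖
    set a4 := ‖conjOp γ q f x‖
    calc ‖lap f x‖ ^ 2 ≤ (a1 + a2 + a3 + a4) ^ 2 := by gcongr
      _ ≤ _ := by nlinarith [sq_nonneg (a1 - a2), sq_nonneg (a1 - a3), sq_nonneg (a1 - a4),
          sq_nonneg (a2 - a3), sq_nonneg (a2 - a4), sq_nonneg (a3 - a4)]
  have h3 := gradient_term_le (γ := γ) (f := f) x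
  have h3' : 4 * γ ^ 2 * slopeSq x * gradSq f x ≤ 4 * γ ^ 2 * 1 * gradSq f x := by
    have := gradSq_nonneg f x
    gcongr
  have h4 : ‖c • f x‖ ^ 2 ≤ (d + 2) ^ 2 * γ ^ 4 * ‖f x‖ ^ 2 := by
    rw [norm_smul, mul_pow, Real.norm_eq_abs]
    have hγ2 : γ ≤ γ ^ 2 := by nlinarith
    have b1 : γ * d / bracket x ≤ d * γ ^ 2 := by
      rw [div_le_iff₀ hb0]
      calc γ * d ≤ γ ^ 2 * d := by gcongr
        _ = d * γ ^ 2 * 1 := by ring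
        _ ≤ d * γ ^ 2 * bracket x := by gcongr
    have b2 : γ ^ 2 * slopeSq x ≤ γ ^ 2 := by nlinarith [sq_nonneg γ]
    have b3 : γ * slopeSq x / bracket x ≤ γ ^ 2 := by
      rw [div_le_iff₀ hb0]
      calc γ * slopeSq x ≤ γ ^ 2 * 1 := by gcongr
        _ ≤ γ ^ 2 * bracket x := by gcongr
    have b4 : 0 ≤ γ * d / bracket x := by positivity
    have b5 : 0 ≤ γ * slopeSq x / bracket x := by positivity
    have b6 : 0 ≤ γ ^ 2 * slopeSq x := by positivity
    have b7 : 0 ≤ d * γ ^ 2 := by positivity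
    have hcb : |c| ≤ (d + 2) * γ ^ 2 := by
      rw [hc, abs_le]
      constructor <;> nlinarith
    calc |c| ^ 2 * ‖f x‖ ^ 2 ≤ ((d + 2) * γ ^ 2) ^ 2 * ‖f x‖ ^ 2 := by gcongr
      _ = _ := by ring
  have h5 : ‖q x • f x‖ ^ 2 = q x ^ 2 * ‖f x‖ ^ 2 := by simp [mul_pow]
  have h6 := norm_sq_conjOp_le (γ := γ) (q := q) (f := f) x
  rw [h5] at h2
  linarith

/-- `q(Q)` is relatively bounded with respect to the Laplacian with bound zero
(on test functions, and in terms of squares of norms). -/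
def IsInfinitesimal (q : Space d → ℝ) : Prop :=
  ∀ η : ℝ, 0 < η → ∃ C : ℝ, 0 ≤ C ∧ ∀ f : Space d → ℂ, IsTest f →
    ∫ x, q x ^ 2 * ‖f x‖ ^ 2 ≤ η * (∫ x, ‖lap f x‖ ^ 2) + C * ∫ x, ‖f x‖ ^ 2

/-- For a function `f` solving the conjugated equation approximately, the potential energy is
small compared with `γ²`: the Laplacian of `f` is of size `γ²` and `q` is infinitesimal. -/
theorem potential_energy_le (hq : IsTestMultiplier q) (hr : IsInfinitesimal q) {δ : ℝ}
    (hδ : 0 < δ) : ∃ C : ℝ, 0 ≤ C ∧ ∀ γ : ℝ, 1 ≤ γ → ∀ f : Space d → ℂ, IsTest f →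
      ∫ x, |q x| * ‖f x‖ ^ 2 ≤ δ * ((∫ x, gradSq f x) + γ ^ 2 * ∫ x, ‖f x‖ ^ 2)
        + C * ((∫ x, ‖f x‖ ^ 2) + ∫ x, ‖bracket x • conjOp γ q f x‖ ^ 2) := by
  obtain ⟨η, hη, hη1, hη2⟩ : ∃ η : ℝ, 0 < η ∧ η ≤ 1 / 8 ∧ 16 * (d + 2) ^ 2 * η ≤ δ ^ 2 := by
    refine ⟨min (1 / 8) (δ ^ 2 / (16 * (d + 2) ^ 2)), by positivity, min_le_left _ _, ?_⟩
    calc 16 * (d + 2) ^ 2 * min (1 / 8) (δ ^ 2 / (16 * (d + 2) ^ 2))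
        ≤ 16 * (d + 2) ^ 2 * (δ ^ 2 / (16 * ((d : ℝ) + 2) ^ 2)) := by
          gcongr
          exact min_le_right _ _
      _ = δ ^ 2 := by field_simp
  obtain ⟨C, hC, hCf⟩ := hr η hη
  refine ⟨δ + C / δ, by positivity, fun γ hγ f hf => ?_⟩
  have hγ0 : 0 < γ := by linarith
  have iR := integrable_conjOp (γ := γ) hq hf
  have iL : Integrable fun x => ‖lap f x‖ ^ 2 := hf.lap.norm_sq'
  set G := ∫ x, gradSq f x
  set N := ∫ x, ‖f x‖ ^ 2
  set R := ∫ x, ‖bracket x • conjOp γ q f x‖ ^ 2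
  set Z := ∫ x, q x ^ 2 * ‖f x‖ ^ 2
  have hN : 0 ≤ N := integral_nonneg fun x => by positivity
  have hR : 0 ≤ R := integral_nonneg fun x => by positivity
  have hG : 0 ≤ G := integral_nonneg fun x => gradSq_nonneg f x
  have hL : ∫ x, ‖lap f x‖ ^ 2
      ≤ 16 * γ ^ 2 * G + 4 * (d + 2) ^ 2 * γ ^ 4 * N + 4 * Z + 4 * R := by
    have j1 := hf.gradSq.const_mul (16 * γ ^ 2)
    have j2 := hf.norm_sq'.const_mul (4 * ((d : ℝ) + 2) ^ 2 * γ ^ 4)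
    have j3 := (hq.sq_norm_sq hf).const_mul 4
    have j4 := iR.const_mul 4
    rw [← integral_const_mul, ← integral_const_mul, ← integral_const_mul, ← integral_const_mul,
      ← integral_add' j1 j2, ← integral_add' (j1.add j2) j3, ← integral_add' ((j1.add j2).add j3) j4]
    exact integral_mono iL (((j1.add j2).add j3).add j4) fun x => norm_sq_lap_le hγ x
  -- `|q| ≤ δγ²/2 + q²/(2δγ²)`; the relative bound of `q²` compensates for `‖Δf‖² ~ γ⁴ ‖f‖²`.
  have hY : ∫ x, |q x| * ‖f x‖ ^ 2 ≤ δ * γ ^ 2 / 2 * N + 1 / (2 * δ * γ ^ 2) * Z := by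
    have j1 := hf.norm_sq'.const_mul (δ * γ ^ 2 / 2)
    have j2 := (hq.sq_norm_sq hf).const_mul (1 / (2 * δ * γ ^ 2))
    rw [← integral_const_mul, ← integral_const_mul, ← integral_add j1 j2]
    refine integral_mono (hq.abs_norm_sq hf) (j1.add j2) fun x => ?_
    have e : δ * γ ^ 2 / 2 * ‖f x‖ ^ 2 + 1 / (2 * δ * γ ^ 2) * (q x ^ 2 * ‖f x‖ ^ 2)
        = |q x| * ‖f x‖ ^ 2
          + 1 / (2 * δ * γ ^ 2) * (δ * γ ^ 2 - |q x|) ^ 2 * ‖f x‖ ^ 2 := by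
      rw [← sq_abs (q x)]
      field_simp
      ring
    dsimp only
    rw [e]
    exact le_add_of_nonneg_right (by positivity)
  have hZ0 := hCf f hf
  -- The term `4 η Z` on the right is absorbed because `η ≤ 1/8`.
  have hZ : Z ≤ 2 * η * (16 * γ ^ 2 * G + 4 * (d + 2) ^ 2 * γ ^ 4 * N + 4 * R) + 2 * C * N := by
    have hZn : 0 ≤ Z := integral_nonneg fun x => by positivity
    have : η * (∫ x, ‖lap f x‖ ^ 2)
        ≤ η * (16 * γ ^ 2 * G + 4 * (d + 2) ^ 2 * γ ^ 4 * N + 4 * Z + 4 * R) := by gcongr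
    nlinarith
  have hdd : (4 : ℝ) ≤ (d + 2) ^ 2 := by
    have : (0 : ℝ) ≤ d := by positivity
    nlinarith
  have hη3 : 64 * η ≤ δ ^ 2 := by nlinarith
  have hg1 : 1 ≤ γ ^ 2 := by nlinarith
  have hfin : 1 / (2 * δ * γ ^ 2) * Z
      ≤ δ / 4 * G + δ / 4 * (γ ^ 2 * N) + δ * R + C / δ * N := by
    rw [one_div, inv_mul_le_iff₀ (by positivity)]
    refine hZ.trans ?_
    have a1 : 2 * η * (16 * γ ^ 2 * G) ≤ 2 * δ * γ ^ 2 * (δ / 4 * G) := by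
      have : 64 * η * (γ ^ 2 * G) ≤ δ ^ 2 * (γ ^ 2 * G) := by gcongr
      linarith
    have a2 : 2 * η * (4 * (d + 2) ^ 2 * γ ^ 4 * N) ≤ 2 * δ * γ ^ 2 * (δ / 4 * (γ ^ 2 * N)) := by
      have : 16 * (d + 2) ^ 2 * η * (γ ^ 4 * N) ≤ δ ^ 2 * (γ ^ 4 * N) := by gcongr
      linarith
    have a3 : 2 * η * (4 * R) ≤ 2 * δ * γ ^ 2 * (δ * R) := by
      have h1 : 64 * η * R ≤ δ ^ 2 * R := by gcongr
      have h2 : δ ^ 2 * R * 1 ≤ δ ^ 2 * R * γ ^ 2 := by gcongr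
      have h3 : 0 ≤ η * R := by positivity
      linarith
    have a4 : 2 * C * N ≤ 2 * δ * γ ^ 2 * (C / δ * N) := by
      have h1 : 2 * δ * γ ^ 2 * (C / δ * N) = 2 * C * N * γ ^ 2 := by field_simp
      rw [h1]
      exact le_mul_of_one_le_right (by positivity) hg1
    linarith
  have hδG : 0 ≤ δ * G := by positivity
  have hδN : 0 ≤ δ * (γ ^ 2 * N) := by positivity
  have hδn : 0 ≤ δ * N := by positivity
  have hCR : 0 ≤ C / δ * R := by positivity
  linarith

end

/-! ### The Carleman estimate -/

section

variable {d : ℕ} {q : Space d → ℝ}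

/-- The bound on the commutator of the potential `q` with `iA` that is needed for the Carleman
estimate: up to terms of lower order in `γ` and a small multiple of the kinetic energy, it is
controlled by less than `2 H₀` and by half of the positive term `4 ‖(γ/⟨x⟩)^{1/2} A f‖²`
of the virial identity. -/
def CommutatorBound (q : Space d → ℝ) : Prop :=
  ∃ ε : ℝ, 0 < ε ∧ ∃ K : ℝ, 0 ≤ K ∧ ∀ γ : ℝ, 1 ≤ γ → ∀ f : Space d → ℂ, IsTest f →
    ∫ x, -(q x * (2 * inner ℝ (f x) (eul f x))) ≤ (2 - ε) * (∫ x, gradSq f x)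
      + 2 * (∫ x, γ / bracket x * ‖eul f x‖ ^ 2)
      + ε / 4 * ((∫ x, gradSq f x) + γ ^ 2 * (∫ x, slopeSq x * ‖f x‖ ^ 2)
        + ∫ x, |q x| * ‖f x‖ ^ 2)
      + K * γ * ((∫ x, ‖f x‖ ^ 2) + ∫ x, ‖bracket x • conjOp γ q f x‖ ^ 2)

/-- The Carleman estimate for the conjugated operator: the virial estimate bounds the kinetic energy
by terms of order `γ`, whereas by the energy estimate it is of order `γ² |x|² / ⟨x⟩²`. -/
theorem carleman_conj (hq : IsTestMultiplier q) (hr : IsInfinitesimal q) (hc : CommutatorBound q)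
    {η : ℝ} (hη : 0 < η) : ∃ γ₀ : ℝ, 1 ≤ γ₀ ∧ ∀ γ : ℝ, γ₀ ≤ γ → ∀ f : Space d → ℂ, IsTest f →
      ∫ x, slopeSq x * ‖f x‖ ^ 2
        ≤ η * ((∫ x, ‖f x‖ ^ 2) + ∫ x, ‖bracket x • conjOp γ q f x‖ ^ 2) := by
  obtain ⟨ε, hε, K, hK, hcf⟩ := hc
  obtain ⟨δ, hδ, hδ1, hδ2⟩ : ∃ δ : ℝ, 0 < δ ∧ δ ≤ 1 / 2 ∧ 16 * δ ≤ η :=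
    ⟨min (1 / 2) (η / 16), by positivity, min_le_left _ _, by
      linarith [min_le_right (1 / 2) (η / 16)]⟩
  obtain ⟨C, hC, hY⟩ := potential_energy_le hq hr hδ
  set M : ℝ := ε * (2 * C + 2) + ε + K + 1 with hM
  have hM0 : 0 < M := by positivity
  refine ⟨max 1 (4 * M / (ε * η)), le_max_left _ _, fun γ hγ f hf => ?_⟩
  have hγ1 : 1 ≤ γ := (le_max_left _ _).trans hγ
  have hγ0 : 0 < γ := by linarith
  have hγM : 4 * M ≤ γ * (ε * η) := by
    rw [← div_le_iff₀ (by positivity)]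
    exact (le_max_right _ _).trans hγ
  have e1 := virial_estimate hγ1 hq hf
  have e2 := hcf γ hγ1 f hf
  have e3 := energy_estimate (γ := γ) hq hf
  have e4 := hY γ hγ1 f hf
  have hS : ∫ x, slopeSq x * ‖f x‖ ^ 2 ≤ ∫ x, ‖f x‖ ^ 2 := by
    refine integral_mono (hf.norm_sq (contDiff_slopeSq (n := 0)).continuous) hf.norm_sq' fun x => ?_
    exact mul_le_of_le_one_left (by positivity) (slopeSq_le_one x)
  have hN : 0 ≤ ∫ x, ‖f x‖ ^ 2 := integral_nonneg fun x => by positivity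
  have hR : 0 ≤ ∫ x, ‖bracket x • conjOp γ q f x‖ ^ 2 := integral_nonneg fun x => by positivity
  have hY0 : 0 ≤ ∫ x, |q x| * ‖f x‖ ^ 2 := integral_nonneg fun x => by positivity
  set G := ∫ x, gradSq f x
  set N := ∫ x, ‖f x‖ ^ 2
  set R := ∫ x, ‖bracket x • conjOp γ q f x‖ ^ 2
  set S := ∫ x, slopeSq x * ‖f x‖ ^ 2
  set Y := ∫ x, |q x| * ‖f x‖ ^ 2
  set Q := ∫ x, γ / bracket x * ‖eul f x‖ ^ 2
  obtain ⟨e3a, e3b⟩ := abs_le.1 e3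
  have hNR : 0 ≤ N + R := by linarith
  have hγNR : N + R ≤ γ * (N + R) := le_mul_of_one_le_left hNR hγ1
  have hR' : R ≤ γ * R := le_mul_of_one_le_left hR hγ1
  have hSN : γ ^ 2 * S ≤ γ ^ 2 * N := by gcongr
  -- Virial estimate and commutator bound: the kinetic energy is `O(γ)` up to the `ε / 4` terms.
  have f1 : ε * G ≤ ε / 4 * (G + γ ^ 2 * S + Y) + (K + 1) * γ * (N + R) := by
    nlinarith
  have f2 : Y ≤ 4 * (δ * (γ ^ 2 * N)) + (2 * C + 1) * (N + R) := by
    have h1 : δ * G ≤ δ * (γ ^ 2 * N + Y + N + R) := by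
      gcongr
      linarith
    have h2 : δ * Y ≤ 1 / 2 * Y := by gcongr
    have h3 : δ * (N + R) ≤ 1 / 2 * (N + R) := by gcongr
    linarith
  -- By the energy estimate `G` is `γ² S` up to `Y + N + R`.
  have f3 : ε / 2 * (γ ^ 2 * S) ≤ ε * Y + ε * (N + R) + (K + 1) * γ * (N + R) := by
    have h1 : ε * (γ ^ 2 * S - Y - N - R) ≤ ε * G := by
      gcongr
      linarith
    have h2 : ε * G ≤ ε * (γ ^ 2 * S + Y + N + R) := by
      gcongr
      linarith
    nlinarith [mul_nonneg hε.le hY0, mul_nonneg hε.le hNR]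
  have f4 : ε / 2 * (γ ^ 2 * S) ≤ 4 * δ * ε * (γ ^ 2 * N) + M * γ * (N + R) := by
    have h1 : ε * Y ≤ ε * (4 * (δ * (γ ^ 2 * N)) + (2 * C + 1) * (N + R)) := by gcongr
    have h2 : ε * (2 * C + 2) * (N + R) ≤ ε * (2 * C + 2) * (γ * (N + R)) := by gcongr
    have h3 : 0 ≤ ε * (γ * (N + R)) := by positivity
    rw [hM]
    linarith
  -- Division by `γ²`: `γ ≥ 4 M / (ε η)` and `16 δ ≤ η` make both terms small.
  have f5 : M * γ * (N + R) ≤ ε * η / 4 * (γ ^ 2 * (N + R)) := by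
    have h1 : 4 * M * (γ * (N + R)) ≤ γ * (ε * η) * (γ * (N + R)) := by gcongr
    linarith
  have f6 : 4 * δ * ε * (γ ^ 2 * N) ≤ ε * η / 4 * (γ ^ 2 * (N + R)) := by
    have h1 : 16 * δ * (ε * (γ ^ 2 * N)) ≤ η * (ε * (γ ^ 2 * (N + R))) := by
      gcongr
      linarith
    linarith
  have f7 : ε / 2 * γ ^ 2 * S ≤ ε / 2 * γ ^ 2 * (η * (N + R)) := by linarith
  exact le_of_mul_le_mul_left f7 (by positivity)

/-- The Carleman estimate for `-Δ + q` with the weight `e^{γ⟨x⟩}`. -/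
theorem carleman (hq : IsTestMultiplier q) (hr : IsInfinitesimal q) (hc : CommutatorBound q)
    {η : ℝ} (hη : 0 < η) : ∃ γ₀ : ℝ, 1 ≤ γ₀ ∧ ∀ γ : ℝ, γ₀ ≤ γ → ∀ u : Space d → ℂ, IsTest u →
      ∫ x, (slopeSq x - η) * ‖Real.exp (γ * bracket x) • u x‖ ^ 2
        ≤ η * ∫ x, ‖(bracket x * Real.exp (γ * bracket x)) • (-lap u x + q x • u x)‖ ^ 2 := by
  obtain ⟨γ₀, h1, h⟩ := carleman_conj hq hr hc hη
  refine ⟨γ₀, h1, fun γ hγ u hu => ?_⟩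
  have ht : IsTest fun x => Real.exp (γ * bracket x) • u x :=
    hu.smul (contDiff_const.mul contDiff_bracket).exp
  have key := h γ hγ _ ht
  simp only [conjOp_exp_smul γ q hu.smooth, smul_smul] at key
  have e : ∫ x, (slopeSq x - η) * ‖Real.exp (γ * bracket x) • u x‖ ^ 2
      = (∫ x, slopeSq x * ‖Real.exp (γ * bracket x) • u x‖ ^ 2)
        - η * ∫ x, ‖Real.exp (γ * bracket x) • u x‖ ^ 2 := by
    rw [← integral_const_mul, ← integral_sub (ht.norm_sq (contDiff_slopeSq (n := 0)).continuous)
      (ht.norm_sq'.const_mul η)]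
    simp only [sub_mul]
  rw [e]
  linarith

/-- The commutator of a rapidly oscillating potential `W` with `iA`: if `W x` is a gradient `∇m` up
to lower-order terms, with `m` bounded by `μ`, the form of the commutator can be rewritten by means
of the energy identity with weight `m`, and is of the size `μ` times the energy. -/
theorem oscillating_commutator_le {W m e : Space d → ℝ} {μ K : ℝ} (hμ : 0 ≤ μ)
    (hW : Continuous W) (hWK : ∀ x, |W x| ≤ K)
    (hm : ContDiff ℝ 1 m) (hmμ : ∀ x, |m x| ≤ μ) (hpd : ∀ j x, pd j m x = (W x + e x) * x j)
    (he : ∀ x, |e x| * ‖x‖ ≤ μ) (hq : IsTestMultiplier q) {γ : ℝ} (hγ : 1 ≤ γ)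
    {f : Space d → ℂ} (hf : IsTest f) :
    ∫ x, -(W x * (2 * inner ℝ (f x) (eul f x))) ≤ 5 * μ * ((∫ x, gradSq f x)
      + γ ^ 2 * (∫ x, slopeSq x * ‖f x‖ ^ 2) + ∫ x, |q x| * ‖f x‖ ^ 2)
      + (μ * (2 * (d + 1) + 2) + d * K) * γ
        * ((∫ x, ‖f x‖ ^ 2) + ∫ x, ‖bracket x • conjOp γ q f x‖ ^ 2) := by
  have hK : 0 ≤ K := (abs_nonneg _).trans (hWK 0)
  have iR := integrable_conjOp (γ := γ) hq hf
  have z := integral_energy hm hf.smooth hf.supp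
  have iP : Integrable fun x => m x * inner ℝ (f x) (lap f x) + m x * gradSq f x
      + ∑ j, pd j m x * inner ℝ (f x) (pd j f x) := by
    refine ((hf.integrable_inner hf.lap hm.continuous).add ?_).add
      (integrable_finsetSum _ fun j _ => hf.integrable_inner (hf.pd j) (continuous_pd hm j))
    simp only [gradSq, Finset.mul_sum]
    exact integrable_finsetSum _ fun j _ => (hf.pd j).norm_sq hm.continuous
  have iW : Integrable fun x => -(W x * (2 * inner ℝ (f x) (eul f x))) := by
    refine ((hf.integrable_inner hf.eul hW).const_mul (-2)).congr
      (Filter.Eventually.of_forall fun x => ?_)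
    ring
  have j1 := hf.gradSq
  have j2 := (hf.norm_sq (contDiff_slopeSq (n := 0)).continuous).const_mul (γ ^ 2)
  have j3 := hq.abs_norm_sq hf
  have j4 := ((j1.add j2).add j3).const_mul (5 * μ)
  have j5 := (hf.norm_sq'.add iR).const_mul ((μ * (2 * (d + 1) + 2) + d * K) * γ)
  have hpt : ∀ x, -(W x * (2 * inner ℝ (f x) (eul f x)))
      ≤ -2 * (m x * inner ℝ (f x) (lap f x) + m x * gradSq f x
          + ∑ j, pd j m x * inner ℝ (f x) (pd j f x))
        + 5 * μ * (gradSq f x + γ ^ 2 * (slopeSq x * ‖f x‖ ^ 2) + |q x| * ‖f x‖ ^ 2)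
        + (μ * (2 * (d + 1) + 2) + d * K) * γ
          * (‖f x‖ ^ 2 + ‖bracket x • conjOp γ q f x‖ ^ 2) := by
    intro x
    have hb := one_le_bracket x
    have hb0 := bracket_pos x
    have t0 := slopeSq_nonneg x
    have t1 := slopeSq_le_one x
    have hγ0 : 0 < γ := by linarith
    have hg0 := gradSq_nonneg f x
    have hsum : ∑ j, pd j m x * inner ℝ (f x) (pd j f x)
        = (W x + e x) * inner ℝ (f x) (fderiv ℝ f x x) := by
      rw [fderiv_apply_eq_sum, inner_sum, Finset.mul_sum]
      refine Finset.sum_congr rfl fun j _ => ?_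
      rw [hpd, inner_smul_right]
      ring
    -- `Δf` is eliminated by means of the conjugated operator; this is where `q` enters.
    have hlap : inner ℝ (f x) (lap f x)
        = inner ℝ (f x) ((2 * γ / bracket x) • fderiv ℝ f x x)
          + (γ * d / bracket x + q x - γ ^ 2 * slopeSq x - γ * slopeSq x / bracket x) * ‖f x‖ ^ 2
          - inner ℝ (f x) (conjOp γ q f x) := by
      rw [lap_eq_conjOp (γ := γ) (q := q), eul, inner_sub_right, inner_add_right,
        inner_smul_right, inner_smul_right, inner_add_right, inner_smul_right,
        real_inner_self_eq_norm_sq, inner_smul_right]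
      ring
    have hgrad : |inner ℝ (f x) ((2 * γ / bracket x) • fderiv ℝ f x x)|
        ≤ γ ^ 2 * slopeSq x * ‖f x‖ ^ 2 + gradSq f x := by
      have h1 := abs_real_inner_le_norm (f x) (fderiv ℝ f x x)
      have h2 := norm_fderiv_self_sq_le f x
      have h3 : 2 * (γ / bracket x) * (‖f x‖ * ‖fderiv ℝ f x x‖)
          ≤ 2 * (γ / bracket x) * (‖f x‖ * (‖x‖ * Real.sqrt (gradSq f x))) := by
        gcongr
        rw [← Real.sqrt_sq (norm_nonneg x), ← Real.sqrt_mul (by positivity)]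
        exact Real.le_sqrt_of_sq_le h2
      have h4 : Real.sqrt (gradSq f x) ^ 2 = gradSq f x := Real.sq_sqrt hg0
      have h5 : γ ^ 2 * slopeSq x * ‖f x‖ ^ 2 = (γ / bracket x * ‖x‖ * ‖f x‖) ^ 2 := by
        rw [slopeSq]
        field_simp
      rw [inner_smul_right, abs_mul, abs_of_nonneg (by positivity)]
      calc 2 * γ / bracket x * |inner ℝ (f x) (fderiv ℝ f x x)|
          ≤ 2 * γ / bracket x * (‖f x‖ * ‖fderiv ℝ f x x‖) := by gcongr
        _ = 2 * (γ / bracket x) * (‖f x‖ * ‖fderiv ℝ f x x‖) := by ring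
        _ ≤ 2 * (γ / bracket x) * (‖f x‖ * (‖x‖ * Real.sqrt (gradSq f x))) := h3
        _ ≤ (γ / bracket x * ‖x‖ * ‖f x‖) ^ 2 + Real.sqrt (gradSq f x) ^ 2 := by
          nlinarith [sq_nonneg (γ / bracket x * ‖x‖ * ‖f x‖ - Real.sqrt (gradSq f x))]
        _ = _ := by rw [h4, h5]
    have hr := abs_inner_conjOp_le (γ := γ) (q := q) (f := f) x
    have hL : |inner ℝ (f x) (lap f x)| ≤ 2 * (γ ^ 2 * slopeSq x * ‖f x‖ ^ 2) + gradSq f x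
        + γ * (d + 1) * ‖f x‖ ^ 2 + |q x| * ‖f x‖ ^ 2 + ‖f x‖ ^ 2 / 2
        + ‖bracket x • conjOp γ q f x‖ ^ 2 / 2 := by
      have b1 : γ * d / bracket x * ‖f x‖ ^ 2 ≤ γ * d * ‖f x‖ ^ 2 := by
        gcongr
        exact div_le_self (by positivity) hb
      have b2 : γ * slopeSq x / bracket x * ‖f x‖ ^ 2 ≤ γ * ‖f x‖ ^ 2 := by
        gcongr
        exact (div_le_self (by positivity) hb).trans (mul_le_of_le_one_right hγ0.le t1)
      have b3 : 0 ≤ γ * d / bracket x * ‖f x‖ ^ 2 := by positivity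
      have b4 : 0 ≤ γ * slopeSq x / bracket x * ‖f x‖ ^ 2 := by positivity
      have b5 : 0 ≤ γ ^ 2 * slopeSq x * ‖f x‖ ^ 2 := by positivity
      have b6 : q x * ‖f x‖ ^ 2 ≤ |q x| * ‖f x‖ ^ 2 := by
        gcongr
        exact le_abs_self _
      have b7 : -(|q x| * ‖f x‖ ^ 2) ≤ q x * ‖f x‖ ^ 2 := by
        rw [← neg_mul]
        gcongr
        exact neg_abs_le _
      have b8 : 0 ≤ γ * ‖f x‖ ^ 2 := by positivity
      have b9 : 0 ≤ γ * d * ‖f x‖ ^ 2 := by positivity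
      rw [hlap]
      obtain ⟨g1, g2⟩ := abs_le.1 hgrad
      obtain ⟨r1, r2⟩ := abs_le.1 hr
      rw [abs_le]
      constructor <;> linarith
    have hmL : 2 * (m x * inner ℝ (f x) (lap f x)) ≤ 2 * (μ * |inner ℝ (f x) (lap f x)|) := by
      refine mul_le_mul_of_nonneg_left ?_ (by norm_num)
      refine (le_abs_self _).trans ?_
      rw [abs_mul]
      exact mul_le_mul_of_nonneg_right (hmμ x) (abs_nonneg _)
    have hmG : 2 * (m x * gradSq f x) ≤ 2 * (μ * gradSq f x) := by
      have := (le_abs_self _).trans (hmμ x)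
      gcongr
    have heB : 2 * (e x * inner ℝ (f x) (fderiv ℝ f x x)) ≤ μ * (‖f x‖ ^ 2 + gradSq f x) := by
      have h1 := abs_real_inner_le_norm (f x) (fderiv ℝ f x x)
      have h2 : ‖fderiv ℝ f x x‖ ≤ ‖x‖ * Real.sqrt (gradSq f x) := by
        rw [← Real.sqrt_sq (norm_nonneg x), ← Real.sqrt_mul (by positivity)]
        exact Real.le_sqrt_of_sq_le (norm_fderiv_self_sq_le f x)
      have h4 : Real.sqrt (gradSq f x) ^ 2 = gradSq f x := Real.sq_sqrt hg0
      calc 2 * (e x * inner ℝ (f x) (fderiv ℝ f x x))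
          ≤ 2 * (|e x| * (‖f x‖ * (‖x‖ * Real.sqrt (gradSq f x)))) := by
            refine mul_le_mul_of_nonneg_left ?_ (by norm_num)
            refine (le_abs_self _).trans ?_
            rw [abs_mul]
            gcongr
            exact h1.trans (by gcongr)
        _ = (|e x| * ‖x‖) * (2 * (‖f x‖ * Real.sqrt (gradSq f x))) := by ring
        _ ≤ μ * (2 * (‖f x‖ * Real.sqrt (gradSq f x))) := by
          gcongr
          exact he x
        _ ≤ μ * (‖f x‖ ^ 2 + gradSq f x) := by
          gcongr
          nlinarith [sq_nonneg (‖f x‖ - Real.sqrt (gradSq f x))]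
    have hWd : -(d * W x * ‖f x‖ ^ 2) ≤ d * K * ‖f x‖ ^ 2 := by
      have := neg_le_of_abs_le (hWK x)
      have h1 : d * ‖f x‖ ^ 2 * (-W x) ≤ d * ‖f x‖ ^ 2 * K := by
        gcongr
        linarith
      linarith
    have hbf : W x * (2 * inner ℝ (f x) (eul f x))
        = 2 * (W x * inner ℝ (f x) (fderiv ℝ f x x)) + d * W x * ‖f x‖ ^ 2 := by
      rw [eul, inner_add_right, inner_smul_right, real_inner_self_eq_norm_sq]
      ring
    have hμL := mul_le_mul_of_nonneg_left hL hμ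
    have n0 : 0 ≤ ‖f x‖ ^ 2 := by positivity
    have c1 : μ * ‖f x‖ ^ 2 ≤ γ * (μ * ‖f x‖ ^ 2) := le_mul_of_one_le_left (by positivity) hγ
    have c2 : d * K * ‖f x‖ ^ 2 ≤ γ * (d * K * ‖f x‖ ^ 2) :=
      le_mul_of_one_le_left (by positivity) hγ
    have c3 : μ * ‖bracket x • conjOp γ q f x‖ ^ 2
        ≤ γ * (μ * ‖bracket x • conjOp γ q f x‖ ^ 2) := le_mul_of_one_le_left (by positivity) hγ
    have c4 : 0 ≤ μ * γ * d * ‖bracket x • conjOp γ q f x‖ ^ 2 := by positivity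
    have c5 : 0 ≤ d * K * γ * ‖bracket x • conjOp γ q f x‖ ^ 2 := by positivity
    have c6 : 0 ≤ μ * (|q x| * ‖f x‖ ^ 2) := by positivity
    have c7 : 0 ≤ μ * (γ ^ 2 * slopeSq x * ‖f x‖ ^ 2) := by positivity
    have c8 : 0 ≤ γ * (μ * ‖bracket x • conjOp γ q f x‖ ^ 2) := by positivity
    rw [hsum, hbf]
    linarith
  have key := integral_mono iW (((iP.const_mul (-2)).add j4).add j5) hpt
  rw [integral_add' ((iP.const_mul (-2)).add j4) j5, integral_add' (iP.const_mul (-2)) j4,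
    integral_const_mul, integral_const_mul, integral_const_mul, integral_add' (j1.add j2) j3,
    integral_add' j1 j2, integral_add' hf.norm_sq' iR, z, integral_const_mul] at key
  linarith

end

/-! ### The oscillating potential -/

section

variable {d : ℕ}

/-- A radial function whose profile vanishes on `[0, 1)` vanishes near the origin, where the norm is
not differentiable. -/
theorem radial_eventuallyEq_zero {ν : ℝ → ℝ} (h0 : ∀ r, 0 ≤ r → r < 1 → ν r = 0) :
    (fun x : Space d => ν ‖x‖) =ᶠ[nhds 0] fun _ => 0 := by
  filter_upwards [Metric.ball_mem_nhds (0 : Space d) one_pos] with x hx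
  exact h0 _ (norm_nonneg x) (by simpa using hx)

theorem contDiff_radial {ν : ℝ → ℝ} {n : WithTop ℕ∞} (h0 : ∀ r, 0 ≤ r → r < 1 → ν r = 0)
    (h1 : ∀ r, 0 < r → ContDiffAt ℝ n ν r) : ContDiff ℝ n fun x : Space d => ν ‖x‖ := by
  rw [contDiff_iff_contDiffAt]
  intro x
  by_cases hx : x = 0
  · subst hx
    exact contDiffAt_const.congr_of_eventuallyEq (radial_eventuallyEq_zero h0)
  · exact (h1 _ (norm_pos_iff.2 hx)).comp x (contDiffAt_norm ℝ hx)

theorem fderiv_radial {ν ν' : ℝ → ℝ} (h0 : ∀ r, 0 ≤ r → r < 1 → ν r = 0)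
    (h1 : ∀ r, 0 < r → HasDerivAt ν (ν' r) r) (x y : Space d) :
    fderiv ℝ (fun x : Space d => ν ‖x‖) x y = ν' ‖x‖ / ‖x‖ * inner ℝ x y := by
  by_cases hx : x = 0
  · subst hx
    rw [(radial_eventuallyEq_zero h0).fderiv_eq]
    simp
  · have hn : 0 < ‖x‖ := norm_pos_iff.2 hx
    have h2 : HasFDerivAt (fun y : Space d => ‖y‖) (‖x‖⁻¹ • innerSL ℝ x) x := by
      have h3 := (hasStrictFDerivAt_norm_sq x).hasFDerivAt.sqrt (by positivity)
      simp only [Real.sqrt_sq (norm_nonneg _)] at h3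
      refine h3.congr_fderiv ?_
      ext y
      simp
      field_simp
    have h4 := (h1 _ hn).comp_hasFDerivAt x h2
    have h5 : (fun x : Space d => ν ‖x‖) = ν ∘ fun y : Space d => ‖y‖ := rfl
    rw [h5, h4.fderiv]
    simp
    field_simp

namespace PotentialData

variable (D : PotentialData d)

theorem κ_deriv_bounded : ∃ C : ℝ, 0 ≤ C ∧ ∀ r, |deriv D.κ r| ≤ C ∧ |deriv D.κ r * r| ≤ C := by
  have hc : Continuous (deriv D.κ) := D.κ_smooth.continuous_deriv (by simp)
  have hs : HasCompactSupport (deriv D.κ) := D.κ_compact.deriv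
  obtain ⟨C₁, h₁⟩ := hs.exists_bound_of_continuous hc
  obtain ⟨C₂, h₂⟩ := (hs.mul_right (f' := fun r => r)).exists_bound_of_continuous
    (hc.mul continuous_id)
  refine ⟨max C₁ C₂, (norm_nonneg _).trans ((h₁ 0).trans (le_max_left _ _)), fun r => ⟨?_, ?_⟩⟩
  · exact (h₁ r).trans (le_max_left _ _)
  · exact (h₂ r).trans (le_max_right _ _)

theorem κ_of_lt_one {r : ℝ} (h0 : 0 ≤ r) (h1 : r < 1) : 1 - D.κ r = 0 := by
  rw [D.κ_one r ⟨by linarith, h1.le⟩, sub_self]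

theorem deriv_κ_of_lt_one {r : ℝ} (h0 : 0 ≤ r) (h1 : r < 1) : deriv D.κ r = 0 := by
  have h : D.κ =ᶠ[nhds r] fun _ => 1 := by
    filter_upwards [Ioo_mem_nhds (show (-1 : ℝ) < r by linarith) h1] with t ht
    exact D.κ_one t ⟨ht.1.le, ht.2.le⟩
  rw [h.deriv_eq]
  simp

theorem abs_one_sub_κ_le (r : ℝ) : |1 - D.κ r| ≤ 1 := by
  have := D.κ_mem r
  rw [abs_le]
  constructor <;> linarith [this.1, this.2]

theorem hasDerivAt_κ (r : ℝ) : HasDerivAt D.κ (deriv D.κ r) r :=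
  ((D.κ_smooth.differentiable (by simp)) r).hasDerivAt

/-- The radial profile of `W`. -/
def profile (w r : ℝ) : ℝ := w * (1 - D.κ r) * r ^ (-D.β) * Real.sin (D.k * r ^ D.α)

theorem W_eq (w : ℝ) : D.W (d := d) w = fun x => D.profile w ‖x‖ := rfl

theorem profile_of_lt_one (w r : ℝ) (h0 : 0 ≤ r) (h1 : r < 1) : D.profile w r = 0 := by
  rw [profile, D.κ_of_lt_one h0 h1]
  ring

theorem contDiff_W (w : ℝ) : ContDiff ℝ 1 (D.W w) := by
  rw [W_eq]
  refine contDiff_radial (D.profile_of_lt_one w) fun r hr => ?_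
  unfold profile
  have hκ : ContDiffAt ℝ 1 D.κ r := (contDiff_one_of_smooth D.κ_smooth).contDiffAt
  exact ((contDiffAt_const.mul (contDiffAt_const.sub hκ)).mul
    (Real.contDiffAt_rpow_const_of_ne hr.ne')).mul
    ((contDiffAt_const.mul (Real.contDiffAt_rpow_const_of_ne hr.ne')).sin)

theorem abs_profile_le (w : ℝ) {r : ℝ} (hr : 0 ≤ r) {s : ℝ} (hs : -D.β ≤ s) :
    |D.profile w r| ≤ |w| * r ^ s := by
  rcases lt_or_ge r 1 with h1 | h1
  · rw [D.profile_of_lt_one w r hr h1, abs_zero]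
    positivity
  · rw [profile, abs_mul, abs_mul, abs_mul]
    calc |w| * |1 - D.κ r| * |r ^ (-D.β)| * |Real.sin (D.k * r ^ D.α)|
        ≤ |w| * 1 * r ^ s * 1 := by
          gcongr
          · exact D.abs_one_sub_κ_le r
          · rw [abs_of_nonneg (by positivity)]
            exact Real.rpow_le_rpow_of_exponent_le h1 hs
          · exact Real.abs_sin_le_one _
      _ = _ := by ring

theorem abs_W_le (w : ℝ) (x : Space d) : |D.W w x| ≤ |w| := by
  have h := D.abs_profile_le w (norm_nonneg x) (s := 0) (by linarith [D.β_pos])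
  simpa [W_eq] using h

/-- For `β ≥ 1/2` the square of `W` decays like `⟨x⟩⁻¹`. -/
theorem W_sq_mul_bracket_le (hβ : 1 / 2 ≤ D.β) (w : ℝ) (x : Space d) :
    D.W w x ^ 2 * bracket x ≤ 2 * w ^ 2 := by
  change D.profile w ‖x‖ ^ 2 * bracket x ≤ 2 * w ^ 2
  rcases lt_or_ge ‖x‖ 1 with h1 | h1
  · rw [D.profile_of_lt_one w _ (norm_nonneg x) h1]
    nlinarith [sq_nonneg w]
  · have h := D.abs_profile_le w (norm_nonneg x) (s := -(1 / 2)) (by linarith)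
    have hb : bracket x ≤ 2 * ‖x‖ := by
      have h2 := bracket_sq x
      nlinarith [bracket_pos x]
    have hx : 0 < ‖x‖ := by linarith
    have h2 : (‖x‖ ^ (-(1 / 2) : ℝ)) ^ 2 = ‖x‖⁻¹ := by
      rw [← Real.rpow_natCast, ← Real.rpow_mul hx.le, ← Real.rpow_neg_one]
      norm_num
    calc D.profile w ‖x‖ ^ 2 * bracket x ≤ (|w| * ‖x‖ ^ (-(1 / 2) : ℝ)) ^ 2 * (2 * ‖x‖) := by
          rw [← sq_abs (D.profile w ‖x‖)]
          gcongr
          exact (bracket_pos x).le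
      _ = 2 * w ^ 2 := by
          rw [mul_pow, h2, sq_abs]
          field_simp

/-- The derivative of `(1 - κ(r)) r^a φ(k r^α)`, which covers the profile of `W` (`φ = sin`) and its
primitive (`φ = cos`). -/
theorem hasDerivAt_profile_aux (a : ℝ) {φ φ' : ℝ → ℝ} (hφ : ∀ s, HasDerivAt φ (φ' s) s) {r : ℝ}
    (hr : 0 < r) : HasDerivAt (fun r => (1 - D.κ r) * r ^ a * φ (D.k * r ^ D.α))
      (-deriv D.κ r * r ^ a * φ (D.k * r ^ D.α)
        + (1 - D.κ r) * (a * r ^ (a - 1)) * φ (D.k * r ^ D.α)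
        + (1 - D.κ r) * r ^ a * (φ' (D.k * r ^ D.α) * (D.k * (D.α * r ^ (D.α - 1))))) r := by
  have h1 := (D.hasDerivAt_κ r).const_sub 1
  have h2 := Real.hasDerivAt_rpow_const (p := a) (Or.inl hr.ne')
  have h3 := (Real.hasDerivAt_rpow_const (p := D.α) (Or.inl hr.ne')).const_mul D.k
  have h4 := (hφ (D.k * r ^ D.α)).comp r h3
  refine ((h1.fun_mul h2).fun_mul h4).congr_deriv ?_
  simp only [Function.comp]
  ring

/-- For `α ≤ β` the function `x · ∇W` is bounded. -/
theorem xgradW_bounded (hαβ : D.α ≤ D.β) (w : ℝ) :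
    ∃ C : ℝ, 0 ≤ C ∧ ∀ x : Space d, |fderiv ℝ (D.W w) x x| ≤ C := by
  obtain ⟨C, hC, hCκ⟩ := D.κ_deriv_bounded
  refine ⟨|w| * (C + D.β + |D.k| * D.α), by have := D.α_pos; have := D.β_pos; positivity, ?_⟩
  intro x
  have hd : ∀ r, 0 < r → HasDerivAt (D.profile w) (w *
      (-deriv D.κ r * r ^ (-D.β) * Real.sin (D.k * r ^ D.α)
        + (1 - D.κ r) * (-D.β * r ^ (-D.β - 1)) * Real.sin (D.k * r ^ D.α)
        + (1 - D.κ r) * r ^ (-D.β) * (Real.cos (D.k * r ^ D.α)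
          * (D.k * (D.α * r ^ (D.α - 1)))))) r := by
    intro r hr
    refine ((D.hasDerivAt_profile_aux (-D.β) Real.hasDerivAt_sin hr).const_mul w).congr_of_eventuallyEq
      (Filter.Eventually.of_forall fun t => ?_)
    simp only [profile]
    ring
  rw [W_eq, fderiv_radial (D.profile_of_lt_one w) hd, real_inner_self_eq_norm_sq]
  set r := ‖x‖ with hr
  rcases lt_or_ge r 1 with h1 | h1
  · rw [D.deriv_κ_of_lt_one (norm_nonneg x) h1, D.κ_of_lt_one (norm_nonneg x) h1]
    have := D.α_pos
    have := D.β_pos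
    simp
    positivity
  · have hr0 : 0 < r := by linarith
    have p1 : r ^ (-D.β - 1) * r = r ^ (-D.β) := by
      rw [← Real.rpow_add_one hr0.ne']
      ring_nf
    have p2 : r ^ (-D.β) * (r ^ (D.α - 1) * r) = r ^ (D.α - D.β) := by
      rw [← Real.rpow_add_one hr0.ne', ← Real.rpow_add hr0]
      ring_nf
    have p3 : r ^ (-D.β) ≤ 1 := Real.rpow_le_one_of_one_le_of_nonpos h1 (by linarith [D.β_pos])
    have p4 : r ^ (D.α - D.β) ≤ 1 := Real.rpow_le_one_of_one_le_of_nonpos h1 (by linarith)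
    have e : w * (-deriv D.κ r * r ^ (-D.β) * Real.sin (D.k * r ^ D.α)
        + (1 - D.κ r) * (-D.β * r ^ (-D.β - 1)) * Real.sin (D.k * r ^ D.α)
        + (1 - D.κ r) * r ^ (-D.β) * (Real.cos (D.k * r ^ D.α)
          * (D.k * (D.α * r ^ (D.α - 1))))) / r * r ^ 2
        = w * (-(deriv D.κ r * r) * r ^ (-D.β) * Real.sin (D.k * r ^ D.α)
          + (1 - D.κ r) * (-D.β * r ^ (-D.β)) * Real.sin (D.k * r ^ D.α)
          + (1 - D.κ r) * (D.k * D.α) * r ^ (D.α - D.β) * Real.cos (D.k * r ^ D.α)) := by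
      rw [← p2, ← p1]
      field_simp
    rw [e, abs_mul]
    refine mul_le_mul_of_nonneg_left ?_ (abs_nonneg w)
    refine (abs_add_three _ _ _).trans ?_
    have s1 := Real.abs_sin_le_one (D.k * r ^ D.α)
    have s2 := Real.abs_cos_le_one (D.k * r ^ D.α)
    have q1 : |-(deriv D.κ r * r) * r ^ (-D.β) * Real.sin (D.k * r ^ D.α)| ≤ C * 1 * 1 := by
      rw [abs_mul, abs_mul, abs_neg, abs_of_nonneg (Real.rpow_nonneg hr0.le (-D.β))]
      gcongr
      exact (hCκ r).2
    have q2 : |(1 - D.κ r) * (-D.β * r ^ (-D.β)) * Real.sin (D.k * r ^ D.α)|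
        ≤ 1 * (D.β * 1) * 1 := by
      rw [abs_mul, abs_mul, abs_mul, abs_neg, abs_of_nonneg (Real.rpow_nonneg hr0.le (-D.β)),
        abs_of_pos D.β_pos]
      have := D.β_pos
      gcongr
      exact D.abs_one_sub_κ_le r
    have q3 : |(1 - D.κ r) * (D.k * D.α) * r ^ (D.α - D.β) * Real.cos (D.k * r ^ D.α)|
        ≤ 1 * (|D.k| * D.α) * 1 * 1 := by
      rw [abs_mul, abs_mul, abs_mul, abs_mul,
        abs_of_nonneg (Real.rpow_nonneg hr0.le (D.α - D.β)), abs_of_pos D.α_pos]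
      have := D.α_pos
      gcongr
      exact D.abs_one_sub_κ_le r
    linarith

/-- For `α + β > 2` the field `W x` is, up to a field of lower order, the gradient of a bounded
function `m`: the primitive of `r W` gains the factor `r^{1 - α}`. -/
theorem W_eq_gradient (hαβ : 2 < D.α + D.β) (hk : D.k ≠ 0) :
    ∃ M : ℝ, 0 ≤ M ∧ ∀ w : ℝ, ∃ m e : Space d → ℝ, ContDiff ℝ 1 m ∧ (∀ x, |m x| ≤ M * |w|) ∧
      (∀ j x, pd j m x = (D.W w x + e x) * x j) ∧ ∀ x, |e x| * ‖x‖ ≤ M * |w| := by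
  obtain ⟨C, hC, hCκ⟩ := D.κ_deriv_bounded
  have hα := D.α_pos
  have hkα : D.k * D.α ≠ 0 := mul_ne_zero hk hα.ne'
  set a : ℝ := 2 - D.α - D.β with ha
  have ha0 : a ≤ 0 := by linarith
  set c : ℝ := |D.k * D.α|⁻¹ with hc
  have hc0 : 0 ≤ c := by positivity
  refine ⟨c * (1 + C + |a|), by positivity, fun w => ?_⟩
  -- Up to lower order `ν' = r W`, since `(cos (k r^α))' = -k α r^{α-1} sin (k r^α)`.
  set ν : ℝ → ℝ := fun r => -(w / (D.k * D.α)) * ((1 - D.κ r) * r ^ a * Real.cos (D.k * r ^ D.α))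
    with hν
  set ν' : ℝ → ℝ := fun r => -(w / (D.k * D.α)) *
    (-deriv D.κ r * r ^ a * Real.cos (D.k * r ^ D.α)
        + (1 - D.κ r) * (a * r ^ (a - 1)) * Real.cos (D.k * r ^ D.α)
        + (1 - D.κ r) * r ^ a * (-Real.sin (D.k * r ^ D.α) * (D.k * (D.α * r ^ (D.α - 1)))))
    with hν'
  have h0 : ∀ r, 0 ≤ r → r < 1 → ν r = 0 := by
    intro r h0 h1
    simp only [hν]
    rw [D.κ_of_lt_one h0 h1]
    ring
  have hd : ∀ r, 0 < r → HasDerivAt ν (ν' r) r := fun r hr =>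
    (D.hasDerivAt_profile_aux a Real.hasDerivAt_cos hr).const_mul _
  have hcw : |-(w / (D.k * D.α))| = c * |w| := by
    rw [abs_neg, abs_div, hc]
    field_simp
  have ra : ∀ r : ℝ, 1 ≤ r → r ^ a ≤ 1 := fun r hr => Real.rpow_le_one_of_one_le_of_nonpos hr ha0
  refine ⟨fun x => ν ‖x‖, fun x => ν' ‖x‖ / ‖x‖ - D.W w x, ?_, fun x => ?_, fun j x => ?_,
    fun x => ?_⟩
  · refine contDiff_radial h0 fun r hr => ?_
    have hκ : ContDiffAt ℝ 1 D.κ r := (contDiff_one_of_smooth D.κ_smooth).contDiffAt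
    exact contDiffAt_const.mul (((contDiffAt_const.sub hκ).mul
      (Real.contDiffAt_rpow_const_of_ne hr.ne')).mul
      ((contDiffAt_const.mul (Real.contDiffAt_rpow_const_of_ne hr.ne')).cos))
  · rcases lt_or_ge ‖x‖ 1 with h1 | h1
    · simp only [h0 _ (norm_nonneg x) h1, abs_zero]
      positivity
    · simp only [hν]
      rw [abs_mul, hcw, abs_mul, abs_mul, abs_of_nonneg (Real.rpow_nonneg (norm_nonneg x) a)]
      calc c * |w| * (|1 - D.κ ‖x‖| * ‖x‖ ^ a * |Real.cos (D.k * ‖x‖ ^ D.α)|)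
          ≤ c * |w| * (1 * 1 * 1) := by
            gcongr
            · exact D.abs_one_sub_κ_le _
            · exact ra _ h1
            · exact Real.abs_cos_le_one _
        _ = c * 1 * |w| := by ring
        _ ≤ c * (1 + C + |a|) * |w| := by
            gcongr
            linarith [abs_nonneg a]
  · rw [pd, fderiv_radial h0 hd]
    simp [EuclideanSpace.inner_single_right]
  · rcases lt_or_ge ‖x‖ 1 with h1 | h1
    · have : D.W w x = 0 := D.profile_of_lt_one w _ (norm_nonneg x) h1
      simp only [hν', this, D.deriv_κ_of_lt_one (norm_nonneg x) h1, D.κ_of_lt_one (norm_nonneg x) h1]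
      simp
      positivity
    · set r := ‖x‖ with hr
      have hr0 : 0 < r := by linarith
      have p1 : r ^ a * r ^ (D.α - 1) = r ^ (-D.β) * r := by
        rw [← Real.rpow_add_one hr0.ne', ← Real.rpow_add hr0]
        congr 1
        rw [ha]
        ring
      have e : |ν' r / r - D.W w x| * r = |-(w / (D.k * D.α)) *
          (-deriv D.κ r * r ^ a * Real.cos (D.k * r ^ D.α)
            + (1 - D.κ r) * (a * r ^ (a - 1)) * Real.cos (D.k * r ^ D.α))| := by
        rw [← abs_of_pos hr0, ← abs_mul, abs_of_pos hr0]
        congr 1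
        have hW : D.W w x = w * (1 - D.κ r) * r ^ (-D.β) * Real.sin (D.k * r ^ D.α) := rfl
        have h3 : (1 - D.κ r) * r ^ a * (-Real.sin (D.k * r ^ D.α)
            * (D.k * (D.α * r ^ (D.α - 1))))
            = -(D.k * D.α) * ((1 - D.κ r) * (r ^ (-D.β) * r) * Real.sin (D.k * r ^ D.α)) := by
          rw [← p1]
          ring
        simp only [hν']
        rw [h3, hW]
        field_simp
        ring
      rw [e, abs_mul, hcw]
      have q1 : |-deriv D.κ r * r ^ a * Real.cos (D.k * r ^ D.α)| ≤ C * 1 * 1 := by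
        rw [abs_mul, abs_mul, abs_neg, abs_of_nonneg (Real.rpow_nonneg hr0.le a)]
        gcongr
        · exact (hCκ r).1
        · exact ra r h1
        · exact Real.abs_cos_le_one _
      have q2 : |(1 - D.κ r) * (a * r ^ (a - 1)) * Real.cos (D.k * r ^ D.α)|
          ≤ 1 * (|a| * 1) * 1 := by
        rw [abs_mul, abs_mul, abs_mul, abs_of_nonneg (Real.rpow_nonneg hr0.le (a - 1))]
        gcongr
        · exact D.abs_one_sub_κ_le _
        · exact Real.rpow_le_one_of_one_le_of_nonpos h1 (by linarith)
        · exact Real.abs_cos_le_one _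
      calc c * |w| * |-deriv D.κ r * r ^ a * Real.cos (D.k * r ^ D.α)
            + (1 - D.κ r) * (a * r ^ (a - 1)) * Real.cos (D.k * r ^ D.α)|
          ≤ c * |w| * (1 + C + |a|) := by
            gcongr
            refine (abs_add_le _ _).trans ?_
            linarith
        _ = _ := by ring

end PotentialData

end

/-! ### Smooth functions as elements of the operator domains -/

section

variable {d : ℕ}

theorem HasFieldDeriv.congr {F : Type*} [NormedAddCommGroup F] [NormedSpace ℝ F]
    {b : Space d → Space d} {u u' g g' : Space d → F} (h : HasFieldDeriv b u g) (hu : u =ᵐ[volume] u')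
    (hg : g =ᵐ[volume] g') : HasFieldDeriv b u' g' := by
  intro φ hφ hc
  have e1 : ∫ x, divergence (fun y => φ y • b y) x • u' x
      = ∫ x, divergence (fun y => φ y • b y) x • u x := by
    refine integral_congr_ae ?_
    filter_upwards [hu] with x hx
    rw [hx]
  have e2 : ∫ x, φ x • g' x = ∫ x, φ x • g x := by
    refine integral_congr_ae ?_
    filter_upwards [hg] with x hx
    rw [hx]
  rw [e1, e2, h φ hφ hc]

theorem divergence_eq_sum_pd {b : Space d → Space d} {x : Space d} (hb : DifferentiableAt ℝ b x) :
    divergence b x = ∑ i, pd i (fun y => b y i) x := by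
  refine Finset.sum_congr rfl fun i _ => ?_
  have h := ((EuclideanSpace.proj i : Space d →L[ℝ] ℝ).hasFDerivAt).comp x hb.hasFDerivAt
  have e : (fun y => b y i) = (EuclideanSpace.proj i : Space d →L[ℝ] ℝ) ∘ b := rfl
  rw [pd, e, h.fderiv]
  simp

/-- For `C¹` functions the weak derivative along a field is the classical one. -/
theorem hasFieldDeriv_of_contDiff {F : Type*} [NormedAddCommGroup F] [NormedSpace ℝ F]
    {b : Space d → Space d} (hb : ContDiff ℝ 1 b) {f : Space d → F} (hf : ContDiff ℝ 1 f) :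
    HasFieldDeriv b f fun x => fderiv ℝ f x (b x) := by
  intro φ hφ hc
  have hφ1 : ContDiff ℝ 1 φ := contDiff_one_of_smooth hφ
  have hbi : ∀ i, ContDiff ℝ 1 fun y => (φ y • b y) i := fun i =>
    (EuclideanSpace.proj i : Space d →L[ℝ] ℝ).contDiff.comp (hφ1.smul hb)
  have hs : ContDiff ℝ 1 fun y => φ y • b y := hφ1.smul hb
  have hcs : HasCompactSupport fun y => φ y • b y := hc.smul_right
  have i1 : Integrable fun x => divergence (fun y => φ y • b y) x • f x :=
    ((continuous_divergence hs).smul hf.continuous).integrable_of_hasCompactSupport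
      (hasCompactSupport_divergence hcs).smul_right
  have i2 : Integrable fun x => φ x • fderiv ℝ f x (b x) :=
    (hφ.continuous.smul ((hf.continuous_fderiv (by norm_num)).clm_apply
      hb.continuous)).integrable_of_hasCompactSupport hc.smul_right
  rw [← add_eq_zero_iff_eq_neg, ← integral_add i1 i2]
  refine integral_eq_zero_of_eq_sum_pd (h := fun i x => (φ x • b x) i • f x)
    (fun i => (hbi i).smul hf) (fun i => ?_) fun x => ?_
  · refine hc.mono fun x hx => ?_
    contrapose! hx
    simp only [Function.mem_support, not_not] at hx ⊢
    simp [hx]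
  · rw [divergence_eq_sum_pd (hs.differentiable (by norm_num) x), fderiv_apply_eq_sum,
      Finset.sum_smul, Finset.smul_sum, ← Finset.sum_add_distrib]
    refine Finset.sum_congr rfl fun i _ => ?_
    rw [pd_smul i ((hbi i).differentiable (by norm_num) x) (hf.differentiable (by norm_num) x),
      add_comm]
    simp [smul_smul]

theorem partialOp_eq {j : Fin d} {f g : L2 d} (hf : f ∈ (partialOp d j).domain)
    (h : HasFieldDeriv (fun _ => EuclideanSpace.single j 1) f g) : partialOp d j ⟨f, hf⟩ = g :=
  (fieldOp_spec _ _ ⟨f, hf⟩).unique h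

/-- Smooth functions in `H²(ℝ^d)`. -/
structure IsSmoothH2 (u : Space d → ℂ) : Prop where
  smooth : ContDiff ℝ ∞ u
  memLp : MemLp u 2 volume
  memLp_pd : ∀ j, MemLp (pd j u) 2 volume
  memLp_pd_pd : ∀ i j, MemLp (pd j (pd i u)) 2 volume

theorem IsTest.isSmoothH2 {f : Space d → ℂ} (hf : IsTest f) : IsSmoothH2 f :=
  ⟨hf.smooth, hf.memLp, fun j => (hf.pd j).memLp, fun i j => ((hf.pd i).pd j).memLp⟩

namespace IsSmoothH2

variable {u : Space d → ℂ}

theorem lap (hu : IsSmoothH2 u) : MemLp (lap u) 2 volume :=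
  memLp_finsetSum _ fun j _ => hu.memLp_pd_pd j j

theorem hasFieldDeriv_toLp {u : Space d → ℂ} (hs : ContDiff ℝ ∞ u) (h : MemLp u 2 volume) {j : Fin d}
    (h' : MemLp (pd j u) 2 volume) :
    HasFieldDeriv (fun _ => EuclideanSpace.single j 1) (h.toLp u) (h'.toLp (pd j u)) :=
  (hasFieldDeriv_of_contDiff contDiff_const (contDiff_one_of_smooth hs)).congr h.coeFn_toLp.symm
    h'.coeFn_toLp.symm

theorem mem_partialOp (hs : ContDiff ℝ ∞ u) (h : MemLp u 2 volume) {j : Fin d}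
    (h' : MemLp (pd j u) 2 volume) : h.toLp u ∈ (partialOp d j).domain :=
  ⟨_, hasFieldDeriv_toLp hs h h'⟩

theorem partialOp_toLp (hs : ContDiff ℝ ∞ u) (h : MemLp u 2 volume) {j : Fin d}
    (h' : MemLp (pd j u) 2 volume) (hm : h.toLp u ∈ (partialOp d j).domain) :
    partialOp d j ⟨h.toLp u, hm⟩ = h'.toLp (pd j u) :=
  partialOp_eq _ (hasFieldDeriv_toLp hs h h')

theorem mem_sobolevTwo (hu : IsSmoothH2 u) : hu.memLp.toLp u ∈ sobolevTwo d := by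
  intro i
  refine ⟨mem_partialOp hu.smooth hu.memLp (hu.memLp_pd i), fun j => ?_⟩
  rw [partialOp_toLp hu.smooth hu.memLp (hu.memLp_pd i)]
  exact mem_partialOp (contDiff_pd hu.smooth i) (hu.memLp_pd i) (hu.memLp_pd_pd i j)

theorem secondPartial_toLp (hu : IsSmoothH2 u) (i : Fin d) :
    secondPartial i ⟨_, hu.mem_sobolevTwo⟩ = (hu.memLp_pd_pd i i).toLp _ := by
  have h1 := partialOp_toLp hu.smooth hu.memLp (hu.memLp_pd i)
    (sobolevTwo_mem_fst ⟨_, hu.mem_sobolevTwo⟩ i)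
  refine partialOp_eq _ ?_
  rw [h1]
  exact hasFieldDeriv_toLp (contDiff_pd hu.smooth i) (hu.memLp_pd i) (hu.memLp_pd_pd i i)

theorem freeH_toLp (hu : IsSmoothH2 u) :
    freeH d ⟨_, hu.mem_sobolevTwo⟩ = -hu.lap.toLp (OscSchrodinger.lap u) := by
  change (-∑ i : Fin d, secondPartial i) ⟨_, hu.mem_sobolevTwo⟩ = _
  rw [LinearMap.neg_apply, LinearMap.sum_apply]
  congr 1
  simp only [hu.secondPartial_toLp]
  refine Lp.ext ?_
  refine (Lp.coeFn_fun_finsetSum _ _).trans ?_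
  have h : ∀ᵐ x, ∀ i, (hu.memLp_pd_pd i i).toLp _ x = pd i (pd i u) x :=
    ae_all_iff.2 fun i => (hu.memLp_pd_pd i i).coeFn_toLp
  filter_upwards [h, hu.lap.coeFn_toLp] with x h1 h2
  rw [h2]
  simp only [h1, OscSchrodinger.lap]

end IsSmoothH2

theorem re_inner_toLp {f g : Space d → ℂ} (hf : MemLp f 2 volume) (hg : MemLp g 2 volume) :
    (inner ℂ (hf.toLp f) (hg.toLp g)).re = ∫ x, inner ℝ (f x) (g x) := by
  have hi : Integrable fun x => inner ℂ (hf.toLp f x) (hg.toLp g x) :=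
    L2.integrable_inner (𝕜 := ℂ) (hf.toLp f) (hg.toLp g)
  rw [L2.inner_def]
  rw [← RCLike.re_eq_complex_re, ← integral_re hi]
  refine integral_congr_ae ?_
  filter_upwards [hf.coeFn_toLp, hg.coeFn_toLp] with x h1 h2
  rw [h1, h2]
  simp [Complex.inner]

theorem norm_sq_toLp {f : Space d → ℂ} (hf : MemLp f 2 volume) :
    ‖hf.toLp f‖ ^ 2 = ∫ x, ‖f x‖ ^ 2 := by
  have h := re_inner_toLp hf hf
  simp only [real_inner_self_eq_norm_sq] at h
  rw [← h, inner_self_eq_norm_sq_to_K]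
  norm_cast

theorem hasFieldDeriv_id {f : Space d → ℂ} (hf : IsTest f)
    (h : MemLp (fun x => fderiv ℝ f x x) 2 volume) :
    HasFieldDeriv (fun x => x) (hf.memLp.toLp f) (h.toLp fun x => fderiv ℝ f x x) :=
  (hasFieldDeriv_of_contDiff contDiff_id (contDiff_one_of_smooth hf.smooth)).congr
    hf.memLp.coeFn_toLp.symm h.coeFn_toLp.symm

theorem IsTest.memLp_fderiv_self {f : Space d → ℂ} (hf : IsTest f) :
    MemLp (fun x => fderiv ℝ f x x) 2 volume := by
  refine (hf.eul.memLp.sub (hf.memLp.const_smul ((d : ℝ) / 2))).ae_eq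
    (Filter.Eventually.of_forall fun x => ?_)
  simp [OscSchrodinger.eul]

theorem mem_dilationGen {f : Space d → ℂ} (hf : IsTest f) :
    hf.memLp.toLp f ∈ (dilationGen d).domain :=
  ⟨⟨_, hasFieldDeriv_id hf hf.memLp_fderiv_self⟩, trivial⟩

theorem I_smul_dilationGen {f : Space d → ℂ} (hf : IsTest f)
    (h : hf.memLp.toLp f ∈ (dilationGen d).domain) :
    Complex.I • dilationGen d ⟨_, h⟩ = hf.eul.memLp.toLp (eul f) := by
  have hdom : hf.memLp.toLp f ∈ (fieldOp (d := d) (fun x => x) contDiff_id).domain := h.1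
  have h1 : fieldOp (d := d) (fun x => x) contDiff_id ⟨_, hdom⟩
      = hf.memLp_fderiv_self.toLp fun x => fderiv ℝ f x x :=
    (fieldOp_spec _ _ ⟨_, hdom⟩).unique (hasFieldDeriv_id hf hf.memLp_fderiv_self)
  have h2 : dilationGen d ⟨_, h⟩ = (-Complex.I) • (fieldOp (d := d) (fun x => x) contDiff_id ⟨_, hdom⟩
      + ((d : ℂ) / 2) • hf.memLp.toLp f) := rfl
  rw [h2, h1, smul_smul]
  simp only [mul_neg, Complex.I_mul_I, neg_neg, one_smul]
  refine Lp.ext ?_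
  filter_upwards [Lp.coeFn_add (hf.memLp_fderiv_self.toLp fun x => fderiv ℝ f x x)
    (((d : ℂ) / 2) • hf.memLp.toLp f), Lp.coeFn_smul ((d : ℂ) / 2) (hf.memLp.toLp f),
    hf.memLp.coeFn_toLp, hf.memLp_fderiv_self.coeFn_toLp, hf.eul.memLp.coeFn_toLp]
    with x h1 h2 h3 h4 h5
  rw [h1, h5, Pi.add_apply, h2, Pi.smul_apply, h3, h4, OscSchrodinger.eul]
  simp

theorem toLp_mem_mulDomain {U : Space d → ℝ} {f : Space d → ℂ} (hf : MemLp f 2 volume)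
    (h : MemLp (fun x => U x • f x) 2 volume) : hf.toLp f ∈ mulDomain U := by
  refine h.ae_eq ?_
  filter_upwards [hf.coeFn_toLp] with x hx
  rw [hx]
  simp

theorem memLp_of_mem_mulDomain {U : Space d → ℝ} {f : Space d → ℂ} (hf : MemLp f 2 volume)
    (h : hf.toLp f ∈ mulDomain U) : MemLp (fun x => U x • f x) 2 volume := by
  refine MemLp.ae_eq ?_ h
  filter_upwards [hf.coeFn_toLp] with x hx
  rw [hx]
  simp

theorem mulOp_toLp {U : Space d → ℝ} {f : Space d → ℂ} (hf : MemLp f 2 volume)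
    (h : MemLp (fun x => U x • f x) 2 volume) (hm : hf.toLp f ∈ (mulOp U).domain) :
    mulOp U ⟨_, hm⟩ = h.toLp fun x => U x • f x := by
  change (mulDomain_memLp (U := U) ⟨hf.toLp f, hm⟩).toLp (fun x => (U x : ℂ) * hf.toLp f x) = _
  refine MemLp.toLp_congr _ _ ?_
  filter_upwards [hf.coeFn_toLp] with x hx
  rw [hx]
  simp

theorem commutatorForm_toLp {U : Space d → ℝ} {f : Space d → ℂ} (hf : IsTest f)
    (h : MemLp (fun x => U x • f x) 2 volume) (hU : hf.memLp.toLp f ∈ (mulOp U).domain)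
    (hA : hf.memLp.toLp f ∈ (dilationGen d).domain) :
    commutatorForm (mulOp U) (dilationGen d) (hf.memLp.toLp f) hU hA
      = ∫ x, U x * (2 * inner ℝ (f x) (eul f x)) := by
  rw [commutatorForm, I_smul_dilationGen hf, mulOp_toLp hf.memLp h, Complex.add_re,
    re_inner_toLp h hf.eul.memLp, re_inner_toLp hf.eul.memLp h,
    ← integral_add (integrable_inner_of_memLp h hf.eul.memLp)
      (integrable_inner_of_memLp hf.eul.memLp h)]
  refine integral_congr_ae (Filter.Eventually.of_forall fun x => ?_)
  simp only [real_inner_smul_left, inner_smul_right]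
  rw [real_inner_comm (f x) (eul f x)]
  ring

theorem re_inner_freeH_toLp {f : Space d → ℂ} (hf : IsTest f)
    (h0 : hf.memLp.toLp f ∈ (freeH d).domain) :
    (inner ℂ (hf.memLp.toLp f) (freeH d ⟨_, h0⟩)).re = ∫ x, gradSq f x := by
  have h1 : freeH d ⟨_, h0⟩ = -hf.lap.memLp.toLp (lap f) := hf.isSmoothH2.freeH_toLp
  rw [h1, inner_neg_right, Complex.neg_re, re_inner_toLp hf.memLp hf.lap.memLp]
  have h2 := integral_energy (m := fun _ => 1) contDiff_const hf.smooth hf.supp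
  have h3 : ∀ x : Space d, (1 : ℝ) * inner ℝ (f x) (lap f x) + 1 * gradSq f x
      + ∑ j, pd j (fun _ : Space d => (1 : ℝ)) x * inner ℝ (f x) (pd j f x)
      = inner ℝ (f x) (lap f x) + gradSq f x := by
    intro x
    simp [pd]
  simp only [h3] at h2
  rw [integral_add (integrable_inner_of_memLp hf.memLp hf.lap.memLp) hf.gradSq] at h2
  linarith

/-! ### Relative boundedness -/

/-- A relatively compact multiplication operator has relative bound zero: multiplication operators
are closed, so that a sequence tending to zero cannot have images of norm one that converge. -/
theorem relCompact_bound {U : Space d → ℝ} (h : IsRelCompact (mulOp U) (freeH d)) :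
    ∃ hdom : (freeH d).domain ≤ (mulOp U).domain, ∀ η : ℝ, 0 < η → ∃ C : ℝ, 0 ≤ C ∧
      ∀ u : (freeH d).domain, ‖mulOp U ⟨u, hdom u.2⟩‖ ≤ η * ‖freeH d u‖ + C * ‖(u : L2 d)‖ := by
  obtain ⟨hdom, hseq⟩ := h
  refine ⟨hdom, fun η hη => ?_⟩
  by_contra! hcon
  choose u hu using fun n : ℕ => hcon (n + 1) (by positivity)
  set t : ℕ → ℝ := fun n => ‖mulOp U ⟨u n, hdom (u n).2⟩‖ with ht
  have htpos : ∀ n, 0 < t n := fun n => lt_of_le_of_lt (by positivity) (hu n)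
  set v : ℕ → (freeH d).domain := fun n => ((t n)⁻¹ : ℂ) • u n with hv
  have hvn : ∀ n, ‖(v n : L2 d)‖ = (t n)⁻¹ * ‖(u n : L2 d)‖ := by
    intro n
    rw [hv, Submodule.coe_smul, norm_smul]
    simp [abs_of_pos (htpos n)]
  have hTv : ∀ n, ‖freeH d (v n)‖ = (t n)⁻¹ * ‖freeH d (u n)‖ := by
    intro n
    rw [hv, LinearPMap.map_smul, norm_smul]
    simp [abs_of_pos (htpos n)]
  have hSv : ∀ n, ‖mulOp U ⟨v n, hdom (v n).2⟩‖ = 1 := by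
    intro n
    have e : (⟨v n, hdom (v n).2⟩ : (mulOp U).domain)
        = ((t n)⁻¹ : ℂ) • ⟨u n, hdom (u n).2⟩ := rfl
    rw [e, LinearPMap.map_smul, norm_smul]
    have : ‖mulOp U ⟨u n, hdom (u n).2⟩‖ = t n := rfl
    rw [this]
    simp [abs_of_pos (htpos n), (htpos n).ne']
  have hbd : ∀ n, η * ‖freeH d (v n)‖ + (n + 1) * ‖(v n : L2 d)‖ ≤ 1 := by
    intro n
    rw [hvn, hTv]
    have := htpos n
    have h2 : η * ‖freeH d (u n)‖ + (n + 1) * ‖(u n : L2 d)‖ ≤ t n := (hu n).le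
    calc _ = (t n)⁻¹ * (η * ‖freeH d (u n)‖ + (n + 1) * ‖(u n : L2 d)‖) := by ring
      _ ≤ (t n)⁻¹ * t n := by gcongr
      _ = 1 := inv_mul_cancel₀ this.ne'
  have hv0 : ∀ n, ‖(v n : L2 d)‖ ≤ 1 / ((n : ℝ) + 1) := by
    intro n
    rw [le_div_iff₀ (by positivity)]
    nlinarith [hbd n, mul_nonneg hη.le (norm_nonneg (freeH d (v n)))]
  have hT : ∀ n, ‖freeH d (v n)‖ ≤ 1 / η := by
    intro n
    rw [le_div_iff₀ hη]
    have : 0 ≤ ((n : ℝ) + 1) * ‖(v n : L2 d)‖ := by positivity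
    nlinarith [hbd n]
  obtain ⟨ns, hns, g, hg⟩ := hseq v ⟨max 1 (1 / η), fun n =>
    ⟨((hv0 n).trans (by
      rw [div_le_one (by positivity)]
      linarith [(Nat.cast_nonneg n : (0 : ℝ) ≤ n)])).trans (le_max_left _ _),
      (hT n).trans (le_max_right _ _)⟩⟩
  have hgn : ‖g‖ = 1 := by
    refine tendsto_nhds_unique hg.norm ?_
    simp only [hSv]
    exact tendsto_const_nhds
  have hvt : Filter.Tendsto (fun m => (v (ns m) : L2 d)) Filter.atTop (nhds 0) := by
    refine squeeze_zero_norm (fun m => hv0 (ns m)) ?_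
    exact tendsto_one_div_add_atTop_nhds_zero_nat.comp hns.tendsto_atTop
  obtain ⟨ks, hks, hks'⟩ := (tendstoInMeasure_of_tendsto_Lp hvt).exists_seq_tendsto_ae
  obtain ⟨ls, hls, hls'⟩ := (tendstoInMeasure_of_tendsto_Lp
    (hg.comp hks.tendsto_atTop)).exists_seq_tendsto_ae
  have hg0 : g = 0 := by
    refine Lp.ext ?_
    have hS : ∀ᵐ x, ∀ m, mulOp U ⟨v (ns m), hdom (v (ns m)).2⟩ x
        = (U x : ℂ) * (v (ns m) : L2 d) x :=
      ae_all_iff.2 fun m =>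
        (mulDomain_memLp (U := U) ⟨v (ns m), hdom (v (ns m)).2⟩).coeFn_toLp
    filter_upwards [hks', hls', hS, Lp.coeFn_zero ℂ 2 (volume : Measure (Space d))]
      with x h1 h2 h3 h4
    rw [h4] at h1 ⊢
    have h5 : Filter.Tendsto (fun i => (U x : ℂ) * (v (ns (ks (ls i))) : L2 d) x) Filter.atTop
        (nhds ((U x : ℂ) * 0)) := (h1.comp hls.tendsto_atTop).const_mul _
    rw [mul_zero] at h5
    refine tendsto_nhds_unique (h2.congr fun i => ?_) h5
    exact h3 _
  rw [hg0, norm_zero] at hgn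
  exact zero_ne_one hgn

end

/-! ### The commutator bound for the potential -/

section

variable {d : ℕ}

theorem EssBounded.mul_bracket {ρ : ℝ} {u : Space d → ℝ}
    (h : EssBounded fun x => bracket x ^ ρ * u x) {σ : ℝ} (hσ : σ ≤ ρ) :
    ∃ C : ℝ, 0 ≤ C ∧ ∀ᵐ x, bracket x ^ σ * |u x| ≤ C := by
  obtain ⟨C, hC⟩ := h
  refine ⟨|C|, abs_nonneg _, ?_⟩
  filter_upwards [hC] with x hx
  rw [abs_mul, abs_of_pos (Real.rpow_pos_of_pos (bracket_pos x) _)] at hx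
  refine le_trans ?_ (hx.trans (le_abs_self C))
  gcongr
  exact one_le_bracket x

theorem EssBounded.of_bracket {ρ : ℝ} {u : Space d → ℝ}
    (h : EssBounded fun x => bracket x ^ ρ * u x) (hρ : 0 ≤ ρ) : EssBounded u := by
  obtain ⟨C, _, hC⟩ := h.mul_bracket hρ
  exact ⟨C, by simpa using hC⟩

theorem EssBounded.add {u v : Space d → ℝ} (hu : EssBounded u) (hv : EssBounded v) :
    EssBounded fun x => u x + v x := by
  obtain ⟨C, hC⟩ := hu
  obtain ⟨C', hC'⟩ := hv
  refine ⟨C + C', ?_⟩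
  filter_upwards [hC, hC'] with x h1 h2
  exact (abs_add_le _ _).trans (add_le_add h1 h2)

theorem EssBounded.memLp {u : Space d → ℝ} (hb : EssBounded u) (hm : AEMeasurable u volume)
    {f : Space d → ℂ} (hf : MemLp f 2 volume) : MemLp (fun x => u x • f x) 2 volume := by
  obtain ⟨C, hC⟩ := hb
  refine MemLp.of_le_mul (c := C) hf (hm.aestronglyMeasurable.smul hf.1) ?_
  filter_upwards [hC] with x hx
  rw [norm_smul, Real.norm_eq_abs]
  gcongr

theorem EssBounded.isTestMultiplier {u : Space d → ℝ} (hb : EssBounded u)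
    (hm : AEMeasurable u volume) : IsTestMultiplier u :=
  fun _ hf => hb.memLp hm hf.memLp

theorem IsTestMultiplier.add {u v : Space d → ℝ} (hu : IsTestMultiplier u)
    (hv : IsTestMultiplier v) : IsTestMultiplier fun x => u x + v x := by
  intro f hf
  refine ((hu f hf).add (hv f hf)).ae_eq (Filter.Eventually.of_forall fun x => ?_)
  simp [add_mul]

theorem IsTestMultiplier.integrable_commutator {q : Space d → ℝ} (hq : IsTestMultiplier q)
    {f : Space d → ℂ} (hf : IsTest f) :
    Integrable fun x => q x * (2 * inner ℝ (f x) (eul f x)) := by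
  refine ((hq.integrable_inner hf hf.eul).const_mul 2).congr (Filter.Eventually.of_forall fun x => ?_)
  ring

/-- A potential of size `⟨x⟩^{-1/2}` has a commutator with `iA` that is controlled by a quarter of
the positive term `4 ‖(γ/⟨x⟩)^{1/2} A f‖²` of the virial identity. -/
theorem commutator_le_of_sq_mul_bracket {p : Space d → ℝ} (hp : IsTestMultiplier p) {K : ℝ}
    (hK : ∀ᵐ x, p x ^ 2 * bracket x ≤ K) {γ : ℝ} (hγ : 1 ≤ γ) {f : Space d → ℂ} (hf : IsTest f) :
    ∫ x, -(p x * (2 * inner ℝ (f x) (eul f x)))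
      ≤ (∫ x, γ / bracket x * ‖eul f x‖ ^ 2) + K * ∫ x, ‖f x‖ ^ 2 := by
  have cb : Continuous fun x : Space d => γ / bracket x :=
    continuous_const.div (contDiff_bracket (n := 0)).continuous fun x => (bracket_pos x).ne'
  rw [← integral_const_mul, ← integral_add (hf.eul.norm_sq cb) (hf.norm_sq'.const_mul K)]
  refine integral_mono_ae (hp.integrable_commutator hf).neg
    ((hf.eul.norm_sq cb).add (hf.norm_sq'.const_mul K)) ?_
  filter_upwards [hK] with x hx
  have hb := bracket_pos x
  have hγ0 : 0 < γ := by linarith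
  have h1 := abs_real_inner_le_norm (f x) (eul f x)
  have h2 : p x ^ 2 * bracket x / γ * ‖f x‖ ^ 2 ≤ K * ‖f x‖ ^ 2 := by
    gcongr
    exact (div_le_self (by positivity) hγ).trans hx
  have h3 : γ / bracket x * ‖eul f x‖ ^ 2 + p x ^ 2 * bracket x / γ * ‖f x‖ ^ 2
      = γ / bracket x * (‖eul f x‖ - |p x| * bracket x / γ * ‖f x‖) ^ 2
        + 2 * |p x| * (‖f x‖ * ‖eul f x‖) := by
    rw [← sq_abs (p x)]
    field_simp
    ring
  have h4 : 0 ≤ γ / bracket x * (‖eul f x‖ - |p x| * bracket x / γ * ‖f x‖) ^ 2 := by positivity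
  have h5 : -(p x * (2 * inner ℝ (f x) (eul f x))) ≤ 2 * |p x| * (‖f x‖ * ‖eul f x‖) := by
    calc _ ≤ |-(p x * (2 * inner ℝ (f x) (eul f x)))| := le_abs_self _
      _ = 2 * |p x| * |inner ℝ (f x) (eul f x)| := by
        rw [abs_neg, abs_mul, abs_mul, abs_two]
        ring
      _ ≤ _ := by gcongr
  linarith

/-- The commutator of a potential `p` with bounded `x · ∇p` is bounded, since
`2 Re ⟪f, iAf⟫ = div (|f|² x)`. -/
theorem commutator_le_of_hasFieldDeriv {p g : Space d → ℝ} (hg : HasFieldDeriv (fun x => x) p g)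
    {C : ℝ} (hgm : AEMeasurable g volume) (hC : ∀ᵐ x, |g x| ≤ C) {f : Space d → ℂ}
    (hf : IsTest f) :
    ∫ x, -(p x * (2 * inner ℝ (f x) (eul f x))) ≤ C * ∫ x, ‖f x‖ ^ 2 := by
  have df : Differentiable ℝ f := hf.smooth.differentiable (by simp)
  have hφ : ContDiff ℝ ∞ fun x => ‖f x‖ ^ 2 := hf.smooth.norm_sq ℝ
  have hc : HasCompactSupport fun x => ‖f x‖ ^ 2 := by
    refine hf.supp.mono fun x hx => ?_
    contrapose! hx
    simp only [Function.mem_support, not_not] at hx ⊢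
    simp [hx]
  have hdiv : ∀ x, divergence (fun y => ‖f y‖ ^ 2 • y) x = 2 * inner ℝ (f x) (eul f x) := by
    intro x
    have hd : DifferentiableAt ℝ (fun y => ‖f y‖ ^ 2) x := hφ.differentiable (by simp) x
    rw [divergence_eq_sum_pd (hd.fun_smul differentiableAt_fun_id)]
    have h : ∀ i, pd i (fun y : Space d => (‖f y‖ ^ 2 • y) i) x
        = ‖f x‖ ^ 2 + 2 * inner ℝ (f x) (x i • pd i f x) := by
      intro i
      change pd i (fun y : Space d => ‖f y‖ ^ 2 * y i) x = _
      rw [pd_mul i hd ((contDiff_coord (n := 1) i).differentiable (by norm_num) x),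
        pd_norm_sq i (df x), pd_coord, inner_smul_right]
      simp only [if_true]
      ring
    simp only [h, Finset.sum_add_distrib, eul, fderiv_apply_eq_sum, inner_add_right, inner_sum,
      ← Finset.mul_sum, Finset.sum_const, inner_smul_right, real_inner_self_eq_norm_sq,
      Finset.card_univ, Fintype.card_fin, nsmul_eq_mul]
    ring
  have h := hg _ hφ hc
  simp only [hdiv, smul_eq_mul] at h
  have e : ∫ x, -(p x * (2 * inner ℝ (f x) (eul f x))) = ∫ x, ‖f x‖ ^ 2 * g x := by
    rw [integral_neg, eq_comm, ← neg_eq_iff_eq_neg, ← h]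
    refine integral_congr_ae (Filter.Eventually.of_forall fun x => ?_)
    ring
  rw [e, ← integral_const_mul]
  have hi : Integrable fun x => ‖f x‖ ^ 2 * g x := by
    have hg' : IsTestMultiplier g := EssBounded.isTestMultiplier ⟨C, hC⟩ hgm
    refine (hg'.norm_sq hf).congr (Filter.Eventually.of_forall fun x => ?_)
    ring
  refine integral_mono_ae hi (hf.norm_sq'.const_mul C) ?_
  filter_upwards [hC] with x hx
  have := (le_abs_self _).trans hx
  nlinarith [sq_nonneg ‖f x‖]

namespace PotentialData

variable (D : PotentialData d)

theorem essBounded_W (w : ℝ) : EssBounded (D.W w) :=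
  ⟨|w|, Filter.Eventually.of_forall fun x => D.abs_W_le w x⟩

theorem isTestMultiplier_W (w : ℝ) : IsTestMultiplier (D.W w) :=
  (D.essBounded_W w).isTestMultiplier (D.contDiff_W w).continuous.aemeasurable

theorem isTestMultiplier_Vc : IsTestMultiplier D.Vc := by
  obtain ⟨hdom, -⟩ := D.Vc_relCompact
  exact fun f hf => memLp_of_mem_mulDomain hf.memLp (hdom hf.isSmoothH2.mem_sobolevTwo)

/-- The part of `V - E` other than `V_c`. -/
def boundedPart (w E : ℝ) (x : Space d) : ℝ :=
  D.Vsr x + D.vgradVtsr x + D.Vlr x + D.W w x + -E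

theorem V_sub_eq (w E : ℝ) (x : Space d) : D.V w x - E = D.Vc x + D.boundedPart w E x := by
  simp only [V, boundedPart]
  ring

theorem essBounded_boundedPart (w E : ℝ) : EssBounded (D.boundedPart w E) :=
  ((((D.Vsr_bounded.of_bracket (by linarith [D.ρsr_mem.1])).add
    (D.vgradVtsr_bounded.of_bracket D.ρsr_mem.1.le)).add
    (D.Vlr_bounded.of_bracket D.ρlr_mem.1.le)).add (D.essBounded_W w)).add
    ⟨|E|, Filter.Eventually.of_forall fun _ => by rw [abs_neg]⟩

theorem aemeasurable_boundedPart (w E : ℝ) : AEMeasurable (D.boundedPart w E) volume :=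
  (((D.Vsr_meas.add D.vgradVtsr_meas).add D.Vlr_meas).add
    (D.contDiff_W w).continuous.aemeasurable).add aemeasurable_const

theorem isTestMultiplier_V (w E : ℝ) : IsTestMultiplier fun x => D.V w x - E := by
  simp only [V_sub_eq]
  exact D.isTestMultiplier_Vc.add
    ((D.essBounded_boundedPart w E).isTestMultiplier (D.aemeasurable_boundedPart w E))

/-- `V - E` is infinitesimally bounded: `V_c` by relative compactness, the rest being bounded. -/
theorem isInfinitesimal_V (w E : ℝ) : IsInfinitesimal fun x => D.V w x - E := by
  obtain ⟨hdom, hrel⟩ := relCompact_bound D.Vc_relCompact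
  obtain ⟨K, hK⟩ := D.essBounded_boundedPart w E
  intro η hη
  obtain ⟨C, hC, hCb⟩ := hrel (Real.sqrt (η / 4)) (by positivity)
  refine ⟨4 * C ^ 2 + 2 * K ^ 2, by positivity, fun f hf => ?_⟩
  have hVc := D.isTestMultiplier_Vc f hf
  have h1 := hCb ⟨_, hf.isSmoothH2.mem_sobolevTwo⟩
  rw [mulOp_toLp hf.memLp hVc, hf.isSmoothH2.freeH_toLp, norm_neg] at h1
  have h2 : ‖hVc.toLp _‖ ^ 2
      ≤ 2 * (η / 4) * ‖hf.lap.memLp.toLp (lap f)‖ ^ 2 + 2 * C ^ 2 * ‖hf.memLp.toLp f‖ ^ 2 := by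
    have hs : Real.sqrt (η / 4) ^ 2 = η / 4 := Real.sq_sqrt (by positivity)
    calc _ ≤ (Real.sqrt (η / 4) * ‖hf.lap.memLp.toLp (lap f)‖
          + C * ‖hf.memLp.toLp f‖) ^ 2 := by gcongr
      _ ≤ 2 * Real.sqrt (η / 4) ^ 2 * ‖hf.lap.memLp.toLp (lap f)‖ ^ 2
          + 2 * C ^ 2 * ‖hf.memLp.toLp f‖ ^ 2 := by
        nlinarith [sq_nonneg (Real.sqrt (η / 4) * ‖hf.lap.memLp.toLp (lap f)‖
          - C * ‖hf.memLp.toLp f‖)]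
      _ = _ := by rw [hs]
  rw [norm_sq_toLp, norm_sq_toLp, norm_sq_toLp] at h2
  have i1 : Integrable fun x => ‖D.Vc x • f x‖ ^ 2 :=
    (memLp_two_iff_integrable_sq_norm hVc.1).1 hVc
  have h3 : ∫ x, (D.V w x - E) ^ 2 * ‖f x‖ ^ 2
      ≤ 2 * (∫ x, ‖D.Vc x • f x‖ ^ 2) + 2 * K ^ 2 * ∫ x, ‖f x‖ ^ 2 := by
    rw [← integral_const_mul, ← integral_const_mul,
      ← integral_add (i1.const_mul 2) (hf.norm_sq'.const_mul _)]
    refine integral_mono_ae ((D.isTestMultiplier_V w E).sq_norm_sq hf)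
      ((i1.const_mul 2).add (hf.norm_sq'.const_mul _)) ?_
    filter_upwards [hK] with x hx
    simp only [V_sub_eq, norm_smul, mul_pow, Real.norm_eq_abs, sq_abs]
    have h4 : D.boundedPart w E x ^ 2 ≤ K ^ 2 := by
      rw [← sq_abs]
      gcongr
    have h5 : (D.Vc x + D.boundedPart w E x) ^ 2 ≤ 2 * D.Vc x ^ 2 + 2 * K ^ 2 := by
      nlinarith [sq_nonneg (D.Vc x - D.boundedPart w E x)]
    calc _ ≤ (2 * D.Vc x ^ 2 + 2 * K ^ 2) * ‖f x‖ ^ 2 := by gcongr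
      _ = _ := by ring
  linarith

/-- The hypothesis on the commutator of `V_c + v · ∇Ṽ_sr`, on test functions. -/
theorem CommutatorLowerBound.isTest (h : D.CommutatorLowerBound) :
    ∃ ε : ℝ, 0 < ε ∧ ∃ l : ℝ, 0 < l ∧ ∀ f : Space d → ℂ, IsTest f →
      ∫ x, -((D.Vc x + D.vgradVtsr x) * (2 * inner ℝ (f x) (eul f x)))
        ≤ (2 - ε) * (∫ x, gradSq f x) + l * ∫ x, ‖f x‖ ^ 2 := by
  obtain ⟨ε, hε, l, hl, hb⟩ := h
  refine ⟨ε, hε, l, hl, fun f hf => ?_⟩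
  have hm : MemLp (fun x => (D.Vc x + D.vgradVtsr x) • f x) 2 volume :=
    (D.isTestMultiplier_Vc.add ((D.vgradVtsr_bounded.of_bracket
      D.ρsr_mem.1.le).isTestMultiplier D.vgradVtsr_meas)) f hf
  have hU : hf.memLp.toLp f ∈ (mulOp fun x => D.Vc x + D.vgradVtsr x).domain :=
    toLp_mem_mulDomain hf.memLp hm
  have h1 := hb _ hf.isSmoothH2.mem_sobolevTwo (mem_dilationGen hf) hU
  have h2 := commutatorForm_toLp hf hm hU (mem_dilationGen hf)
  have h3 := re_inner_freeH_toLp hf hf.isSmoothH2.mem_sobolevTwo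
  rw [h2, h3, norm_sq_toLp] at h1
  rw [integral_neg]
  linarith

/-- The commutator of the oscillating part with `iA`. For `β ≥ 1/2` its decay suffices. For `α ≤ β`
its radial derivative is bounded. Otherwise `α + β > 2`, it oscillates rapidly, and it has to be
small. -/
theorem commutator_W_le (hβ : ¬ (|D.α - 1| + D.β > 1) → D.β ≥ 1 / 2) {ε : ℝ} (hε : 0 < ε) :
    ∃ w₀ : ℝ, 0 < w₀ ∧ ∀ w : ℝ, (¬ (D.α + D.β ≤ 2 ∨ D.β ≥ 1 / 2) → |w| ≤ w₀) →
      ∃ K : ℝ, 0 ≤ K ∧ ∀ q : Space d → ℝ, IsTestMultiplier q → ∀ γ : ℝ, 1 ≤ γ →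
        ∀ f : Space d → ℂ, IsTest f →
        ∫ x, -(D.W w x * (2 * inner ℝ (f x) (eul f x)))
          ≤ (∫ x, γ / bracket x * ‖eul f x‖ ^ 2)
            + ε * ((∫ x, gradSq f x) + γ ^ 2 * (∫ x, slopeSq x * ‖f x‖ ^ 2)
              + ∫ x, |q x| * ‖f x‖ ^ 2)
            + K * γ * ((∫ x, ‖f x‖ ^ 2) + ∫ x, ‖bracket x • conjOp γ q f x‖ ^ 2) := by
  have aux : ∀ (q : Space d → ℝ) (γ : ℝ), 1 ≤ γ → ∀ f : Space d → ℂ, IsTest f →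
      0 ≤ (∫ x, γ / bracket x * ‖eul f x‖ ^ 2) ∧
      0 ≤ ε * ((∫ x, gradSq f x) + γ ^ 2 * (∫ x, slopeSq x * ‖f x‖ ^ 2)
              + ∫ x, |q x| * ‖f x‖ ^ 2) ∧
      ∀ K : ℝ, 0 ≤ K → K * (∫ x, ‖f x‖ ^ 2)
        ≤ K * γ * ((∫ x, ‖f x‖ ^ 2) + ∫ x, ‖bracket x • conjOp γ q f x‖ ^ 2) := by
    intro q γ hγ f hf
    have hγ0 : 0 < γ := by linarith
    have a1 : 0 ≤ ∫ x, gradSq f x := integral_nonneg fun x => gradSq_nonneg f x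
    have a2 : 0 ≤ ∫ x, slopeSq x * ‖f x‖ ^ 2 :=
      integral_nonneg fun x => mul_nonneg (slopeSq_nonneg x) (by positivity)
    have a3 : 0 ≤ ∫ x, |q x| * ‖f x‖ ^ 2 := integral_nonneg fun x => by positivity
    have a4 : 0 ≤ ∫ x, ‖f x‖ ^ 2 := integral_nonneg fun x => by positivity
    have a5 : 0 ≤ ∫ x, ‖bracket x • conjOp γ q f x‖ ^ 2 := integral_nonneg fun x => by positivity
    refine ⟨integral_nonneg fun x => ?_, by positivity, fun K hK => ?_⟩
    · have := bracket_pos x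
      positivity
    · have h1 : K * (∫ x, ‖f x‖ ^ 2) ≤ γ * (K * ∫ x, ‖f x‖ ^ 2) :=
        le_mul_of_one_le_left (by positivity) hγ
      have h2 : 0 ≤ K * γ * ∫ x, ‖bracket x • conjOp γ q f x‖ ^ 2 := by positivity
      linarith
  have decay : ∀ w K : ℝ, (∀ x, D.W w x ^ 2 * bracket x ≤ K) → 0 ≤ K →
      ∃ K : ℝ, 0 ≤ K ∧ ∀ q : Space d → ℝ, IsTestMultiplier q → ∀ γ : ℝ, 1 ≤ γ →
        ∀ f : Space d → ℂ, IsTest f →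
        ∫ x, -(D.W w x * (2 * inner ℝ (f x) (eul f x)))
          ≤ (∫ x, γ / bracket x * ‖eul f x‖ ^ 2)
            + ε * ((∫ x, gradSq f x) + γ ^ 2 * (∫ x, slopeSq x * ‖f x‖ ^ 2)
              + ∫ x, |q x| * ‖f x‖ ^ 2)
            + K * γ * ((∫ x, ‖f x‖ ^ 2) + ∫ x, ‖bracket x • conjOp γ q f x‖ ^ 2) := by
    intro w K hK hK0
    refine ⟨K, hK0, fun q _ γ hγ f hf => ?_⟩
    obtain ⟨b1, b2, b3⟩ := aux q γ hγ f hf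
    have h := commutator_le_of_sq_mul_bracket (D.isTestMultiplier_W w)
      (Filter.Eventually.of_forall hK) hγ hf
    linarith [b3 K hK0]
  by_cases h1 : 1 / 2 ≤ D.β
  · exact ⟨1, one_pos, fun w _ => decay w _ (D.W_sq_mul_bracket_le h1 w) (by positivity)⟩
  by_cases h2 : D.α ≤ D.β
  · refine ⟨1, one_pos, fun w _ => ?_⟩
    obtain ⟨C, hC, hCb⟩ := D.xgradW_bounded h2 w
    refine ⟨C, hC, fun q _ γ hγ f hf => ?_⟩
    obtain ⟨b1, b2, b3⟩ := aux q γ hγ f hf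
    have hg : HasFieldDeriv (fun x => x) (D.W w) fun x => fderiv ℝ (D.W w) x x :=
      hasFieldDeriv_of_contDiff contDiff_id (D.contDiff_W w)
    have h := commutator_le_of_hasFieldDeriv hg
      (((D.contDiff_W w).continuous_fderiv (by norm_num)).clm_apply continuous_id).aemeasurable
      (Filter.Eventually.of_forall hCb) hf
    linarith [b3 C hC]
  -- `β < 1/2` forces `|α - 1| + β > 1`, and `α ≤ 1` would then give `α < β`.
  have h3 : 2 < D.α + D.β := by
    have h : |D.α - 1| + D.β > 1 := by
      by_contra hcon
      exact h1 (hβ hcon)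
    rcases le_total D.α 1 with h4 | h4
    · rw [abs_of_nonpos (by linarith)] at h
      linarith
    · rw [abs_of_nonneg (by linarith)] at h
      linarith
  by_cases hk : D.k = 0
  · refine ⟨1, one_pos, fun w _ => decay w 0 (fun x => ?_) le_rfl⟩
    simp [W, hk]
  obtain ⟨M, hM, hMw⟩ := D.W_eq_gradient h3 hk
  refine ⟨ε / (5 * (M + 1)), by positivity, fun w hw => ?_⟩
  have hw' : |w| * (5 * (M + 1)) ≤ ε := by
    rw [← le_div_iff₀ (by positivity)]
    refine hw ?_
    rintro (h | h)
    · linarith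
    · exact h1 h
  obtain ⟨m, e, c1, c2, c3, c4⟩ := hMw w
  refine ⟨M * |w| * (2 * (d + 1) + 2) + d * |w|, by positivity, fun q hq γ hγ f hf => ?_⟩
  obtain ⟨b1, b2, b3⟩ := aux q γ hγ f hf
  have h := oscillating_commutator_le (by positivity) (D.contDiff_W w).continuous (D.abs_W_le w)
    c1 c2 c3 c4 hq hγ hf
  have h5 : 5 * (M * |w|) ≤ ε := by nlinarith [abs_nonneg w]
  have h6 : 5 * (M * |w|) * ((∫ x, gradSq f x) + γ ^ 2 * (∫ x, slopeSq x * ‖f x‖ ^ 2)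
      + ∫ x, |q x| * ‖f x‖ ^ 2) ≤ ε * ((∫ x, gradSq f x)
        + γ ^ 2 * (∫ x, slopeSq x * ‖f x‖ ^ 2) + ∫ x, |q x| * ‖f x‖ ^ 2) := by
    refine mul_le_mul_of_nonneg_right h5 ?_
    exact nonneg_of_mul_nonneg_right b2 hε
  linarith

/-- The commutator bound for the full potential. Half of the term `4 ‖(γ/⟨x⟩)^{1/2} A f‖²` is shared
between `V_sr` and `W`; the hypothesis handles `V_c + v · ∇Ṽ_sr` and `x · ∇V_lr` is bounded. -/
theorem commutatorBound (hcomm : D.CommutatorLowerBound)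
    (hβ : ¬ (|D.α - 1| + D.β > 1) → D.β ≥ 1 / 2) :
    ∃ w₀ : ℝ, 0 < w₀ ∧ ∀ w : ℝ, (¬ (D.α + D.β ≤ 2 ∨ D.β ≥ 1 / 2) → |w| ≤ w₀) →
      ∀ E : ℝ, CommutatorBound fun x => D.V w x - E := by
  obtain ⟨ε, hε, l, hl, hU⟩ := CommutatorLowerBound.isTest D hcomm
  obtain ⟨w₀, hw₀, hW⟩ := D.commutator_W_le hβ (ε := ε / 4) (by positivity)
  refine ⟨w₀, hw₀, fun w hw E => ?_⟩
  obtain ⟨K, hK, hWK⟩ := hW w hw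
  obtain ⟨C, hC, hsr⟩ := D.Vsr_bounded.mul_bracket (σ := 1) (by linarith [D.ρsr_mem.1])
  obtain ⟨g, hgm, hg, hgb⟩ := D.xgradVlr_bounded
  obtain ⟨C', hC', hlr⟩ := hgb.mul_bracket (σ := 0) D.ρlr'_mem.1.le
  simp only [Real.rpow_zero, one_mul] at hlr
  refine ⟨ε, hε, K + l + C ^ 2 + C', by positivity, fun γ hγ f hf => ?_⟩
  have mU : IsTestMultiplier fun x => D.Vc x + D.vgradVtsr x :=
    D.isTestMultiplier_Vc.add ((D.vgradVtsr_bounded.of_bracket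
      D.ρsr_mem.1.le).isTestMultiplier D.vgradVtsr_meas)
  have mS : IsTestMultiplier D.Vsr :=
    (D.Vsr_bounded.of_bracket (by linarith [D.ρsr_mem.1])).isTestMultiplier D.Vsr_meas
  have mL : IsTestMultiplier D.Vlr :=
    (D.Vlr_bounded.of_bracket D.ρlr_mem.1.le).isTestMultiplier D.Vlr_meas
  have mE : IsTestMultiplier fun _ : Space d => -E :=
    EssBounded.isTestMultiplier ⟨|E|, Filter.Eventually.of_forall fun _ => by rw [abs_neg]⟩
      aemeasurable_const
  have iU := (mU.integrable_commutator hf).neg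
  have iS := (mS.integrable_commutator hf).neg
  have iL := (mL.integrable_commutator hf).neg
  have iW := ((D.isTestMultiplier_W w).integrable_commutator hf).neg
  have iE := (mE.integrable_commutator hf).neg
  have hsr' : ∀ᵐ x, D.Vsr x ^ 2 * bracket x ≤ C ^ 2 := by
    filter_upwards [hsr] with x hx
    rw [Real.rpow_one] at hx
    have hb := one_le_bracket x
    have hb0 := bracket_pos x
    calc D.Vsr x ^ 2 * bracket x ≤ |D.Vsr x| ^ 2 * (bracket x * bracket x) := by
          rw [sq_abs]
          gcongr
          exact le_mul_of_one_le_left hb0.le hb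
      _ = (bracket x * |D.Vsr x|) ^ 2 := by ring
      _ ≤ C ^ 2 := by gcongr
  have eU := hU f hf
  have eS := commutator_le_of_sq_mul_bracket mS hsr' hγ hf
  have eL := commutator_le_of_hasFieldDeriv hg hgm hlr hf
  have eW := hWK _ (D.isTestMultiplier_V w E) γ hγ f hf
  have eE : ∫ x, -(-E * (2 * inner ℝ (f x) (eul f x))) = 0 := by
    have h := integral_mul_inner_eul (h := fun _ => -E) contDiff_const hf.smooth hf.supp
    rw [integral_neg, neg_eq_zero, ← h]
    simp
  have key : ∫ x, -((D.V w x - E) * (2 * inner ℝ (f x) (eul f x)))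
      = (∫ x, -((D.Vc x + D.vgradVtsr x) * (2 * inner ℝ (f x) (eul f x))))
        + (∫ x, -(D.Vsr x * (2 * inner ℝ (f x) (eul f x))))
        + (∫ x, -(D.Vlr x * (2 * inner ℝ (f x) (eul f x))))
        + (∫ x, -(D.W w x * (2 * inner ℝ (f x) (eul f x))))
        + ∫ x, -(-E * (2 * inner ℝ (f x) (eul f x))) := by
    have h := integral_add' (((iU.add iS).add iL).add iW) iE
    rw [integral_add' ((iU.add iS).add iL) iW, integral_add' (iU.add iS) iL,
      integral_add' iU iS] at h
    simp only [Pi.neg_apply] at h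
    rw [← h]
    refine integral_congr_ae (Filter.Eventually.of_forall fun x => ?_)
    simp only [Pi.add_apply, Pi.neg_apply, V]
    ring
  have hN : 0 ≤ ∫ x, ‖f x‖ ^ 2 := integral_nonneg fun x => by positivity
  have hR : 0 ≤ ∫ x, ‖bracket x • conjOp γ (fun x => D.V w x - E) f x‖ ^ 2 :=
    integral_nonneg fun x => by positivity
  set N := ∫ x, ‖f x‖ ^ 2
  set R := ∫ x, ‖bracket x • conjOp γ (fun x => D.V w x - E) f x‖ ^ 2
  have h7 : (l + C ^ 2 + C') * N ≤ (l + C ^ 2 + C') * (γ * (N + R)) := by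
    gcongr
    calc N ≤ N + R := by linarith
      _ ≤ γ * (N + R) := le_mul_of_one_le_left (by linarith) hγ
  rw [key, eE]
  linarith

end PotentialData

end

/-! ### Approximation by smooth functions -/

section

variable {d : ℕ}

/-- The regularization `ρ ∗ ψ`. -/
def mollify (ρ : Space d → ℝ) (ψ : Space d → ℂ) (x : Space d) : ℂ := ∫ t, ρ (x - t) • ψ t

theorem mollify_eq_convolution (ρ : Space d → ℝ) (ψ : Space d → ℂ) :
    mollify ρ ψ = convolution ψ ρ (ContinuousLinearMap.lsmul ℝ ℝ).flip volume := by
  funext x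
  rfl

theorem contDiff_mollify {ρ : Space d → ℝ} (hρ : IsTest ρ) (ψ : L2 d) :
    ContDiff ℝ ∞ (mollify ρ ψ) := by
  rw [mollify_eq_convolution]
  exact hρ.supp.contDiff_convolution_right _ ((Lp.memLp ψ).locallyIntegrable (by norm_num)) hρ.smooth

/-- Regularization commutes with weak derivatives. -/
theorem pd_mollify {ρ : Space d → ℝ} (hρ : IsTest ρ) {ψ ψ' : L2 d} {j : Fin d}
    (h : HasFieldDeriv (fun _ => EuclideanSpace.single j 1) ψ ψ') :
    pd j (mollify ρ ψ) = mollify ρ ψ' := by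
  have hl : LocallyIntegrable ψ volume := (Lp.memLp ψ).locallyIntegrable (by norm_num)
  have hρ1 := contDiff_one_of_smooth hρ.smooth
  funext x
  have h1 := hρ.supp.hasFDerivAt_convolution_right (ContinuousLinearMap.lsmul ℝ ℝ).flip hl hρ1 x
  rw [pd, mollify_eq_convolution, h1.fderiv, convolution_precompR_apply _ hl
    (hρ.supp.fderiv (𝕜 := ℝ)) (hρ1.continuous_fderiv (by norm_num))]
  have hs : ContDiff ℝ ∞ fun y : Space d => ρ (x - y) := hρ.smooth.comp (contDiff_const.sub contDiff_id)
  have hc : HasCompactSupport fun y : Space d => ρ (x - y) :=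
    hρ.supp.comp_homeomorph (Homeomorph.subLeft x)
  have h2 := h _ hs hc
  have h3 : ∀ y, divergence (fun z : Space d => ρ (x - z) • EuclideanSpace.single j (1 : ℝ)) y
      = -pd j ρ (x - y) := by
    intro y
    have hd : DifferentiableAt ℝ (fun z : Space d => ρ (x - z)) y := hs.differentiable (by simp) y
    rw [divergence_eq_sum_pd (hd.smul_const _), Finset.sum_eq_single j]
    · have e : (fun z : Space d => (ρ (x - z) • EuclideanSpace.single j (1 : ℝ)) j)
          = fun z => ρ (x - z) := by
        funext z
        simp
      have h4 : HasFDerivAt (fun z : Space d => x - z) (-ContinuousLinearMap.id ℝ (Space d)) y :=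
        (hasFDerivAt_id y).const_sub x
      have h5 := (hρ1.differentiable (by norm_num) (x - y)).hasFDerivAt.comp y h4
      have e' : (fun z : Space d => ρ (x - z)) = ρ ∘ fun z => x - z := rfl
      rw [e, pd, e', h5.fderiv]
      simp [pd]
    · intro i _ hi
      have e : (fun z : Space d => (ρ (x - z) • EuclideanSpace.single j (1 : ℝ)) i)
          = fun _ => 0 := by
        funext z
        simp [hi]
      rw [e, pd]
      simp
    · simp
  simp only [h3, neg_smul, integral_neg, neg_inj] at h2
  rw [mollify, ← h2]
  rfl

/-- Translations act continuously on `L²`. -/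
theorem translation_continuous (ψ : L2 d) {ε : ℝ} (hε : 0 < ε) : ∃ δ : ℝ, 0 < δ ∧
    ∀ t : Space d, ‖t‖ < δ → ∫⁻ x, ‖ψ (x - t) - ψ x‖ₑ ^ 2 ≤ ENNReal.ofReal ε ^ 2 := by
  have : Fact ((2 : ENNReal) ≠ ⊤) := ⟨by norm_num⟩
  have hc : Continuous fun t : Space d => DomAddAct.mk (-t) +ᵥ ψ := by
    have h1 : Continuous fun t : Space d => DomAddAct.mk (-t) :=
      (DomAddAct.continuous_mk (M := Space d)).comp continuous_neg
    exact h1.vadd continuous_const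
  have h0 := Metric.continuous_iff.1 hc 0 ε hε
  obtain ⟨δ, hδ, h⟩ := h0
  refine ⟨δ, hδ, fun t ht => ?_⟩
  have h1 := (h t (by simpa using ht)).le
  have e0 : DomAddAct.mk (-(0 : Space d)) +ᵥ ψ = ψ := by simp
  rw [e0, dist_eq_norm] at h1
  have h2 : (DomAddAct.mk (-t) +ᵥ ψ : L2 d) =ᵐ[volume] fun x => ψ (x - t) := by
    filter_upwards [DomAddAct.vadd_Lp_ae_eq (DomAddAct.mk (-t)) ψ] with x hx
    rw [hx]
    simp [neg_add_eq_sub]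
  have h3 : ∫⁻ x, ‖ψ (x - t) - ψ x‖ₑ ^ 2 = ‖(DomAddAct.mk (-t) +ᵥ ψ) - ψ‖ₑ ^ 2 := by
    rw [Lp.enorm_def, eLpNorm_eq_lintegral_rpow_enorm_toReal (by norm_num) (by norm_num)]
    rw [← ENNReal.rpow_natCast, ← ENNReal.rpow_mul]
    simp only [ENNReal.toReal_ofNat, Nat.cast_ofNat, one_div]
    rw [inv_mul_cancel₀ (by norm_num), ENNReal.rpow_one]
    refine lintegral_congr_ae ?_
    filter_upwards [h2, Lp.coeFn_sub (DomAddAct.mk (-t) +ᵥ ψ : L2 d) ψ] with x h4 h5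
    rw [h5, Pi.sub_apply, h4]
    simp
  rw [h3]
  gcongr
  rw [← ofReal_norm]
  exact ENNReal.ofReal_le_ofReal h1

/-- Jensen's inequality for the square and a probability density `p`. -/
theorem sq_lintegral_mul_le {α : Type*} [MeasurableSpace α] {μ : Measure α} {p h : α → ENNReal}
    (hp : AEMeasurable p μ) (hh : AEMeasurable h μ) (h1 : ∫⁻ t, p t ∂μ = 1) :
    (∫⁻ t, p t * h t ∂μ) ^ 2 ≤ ∫⁻ t, p t * h t ^ 2 ∂μ := by
  have hs : ∀ a : ENNReal, (a ^ (1 / 2 : ℝ)) ^ (2 : ℝ) = a := by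
    intro a
    rw [← ENNReal.rpow_mul]
    norm_num
  have e : ∀ t, p t * h t = (p t ^ (1 / 2 : ℝ)) * (p t ^ (1 / 2 : ℝ) * h t) := by
    intro t
    rw [← mul_assoc, ← ENNReal.rpow_add_of_nonneg _ _ (by norm_num) (by norm_num)]
    norm_num
  have key := ENNReal.lintegral_mul_le_Lp_mul_Lq μ (p := 2) (q := 2) ⟨by norm_num, by norm_num, by norm_num⟩
    (hp.pow_const (1 / 2 : ℝ)) ((hp.pow_const (1 / 2 : ℝ)).mul hh)
  simp only [Pi.mul_apply, hs, h1, ENNReal.one_rpow, one_mul,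
    ENNReal.mul_rpow_of_nonneg _ _ (show (0 : ℝ) ≤ 2 by norm_num)] at key
  simp only [← e] at key
  calc (∫⁻ t, p t * h t ∂μ) ^ 2 ≤ ((∫⁻ t, p t * h t ^ (2 : ℝ) ∂μ) ^ (1 / 2 : ℝ)) ^ 2 := by
        gcongr
    _ = ∫⁻ t, p t * h t ^ (2 : ℝ) ∂μ := by
        rw [← ENNReal.rpow_natCast]
        exact hs _
    _ = _ := by simp

/-- A regularization differs from `ψ` by an average of translations. -/
theorem lintegral_mollify_sub_le {ρ : Space d → ℝ} (hρ : IsTest ρ) (h0 : ∀ t, 0 ≤ ρ t)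
    (h1 : ∫ t, ρ t = 1) (ψ : L2 d) {C : ENNReal}
    (hC : ∀ t, ρ t ≠ 0 → ∫⁻ x, ‖ψ (x - t) - ψ x‖ₑ ^ 2 ≤ C) :
    ∫⁻ x, ‖mollify ρ ψ x - ψ x‖ₑ ^ 2 ≤ C := by
  have hcρ := hρ.smooth.continuous
  have iρ : Integrable ρ := hcρ.integrable_of_hasCompactSupport hρ.supp
  have hl : LocallyIntegrable ψ volume := (Lp.memLp ψ).locallyIntegrable (by norm_num)
  have mψ : Measurable (ψ : Space d → ℂ) := (Lp.stronglyMeasurable ψ).measurable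
  set p : Space d → ENNReal := fun t => ENNReal.ofReal (ρ t) with hp
  have mp : Measurable p := ENNReal.measurable_ofReal.comp hcρ.measurable
  have hp1 : ∫⁻ t, p t = 1 := by
    rw [hp, ← ofReal_integral_eq_lintegral_ofReal iρ (Filter.Eventually.of_forall h0), h1,
      ENNReal.ofReal_one]
  have hpt : ∀ x, ‖mollify ρ ψ x - ψ x‖ₑ ^ 2 ≤ ∫⁻ t, p t * ‖ψ (x - t) - ψ x‖ₑ ^ 2 := by
    intro x
    have e1 : mollify ρ ψ x = ∫ t, ρ t • ψ (x - t) := by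
      rw [mollify, ← integral_sub_left_eq_self (fun t => ρ t • ψ (x - t)) volume x]
      simp
    have i1 : Integrable fun t => ρ t • ψ (x - t) := by
      have h := hρ.supp.convolutionExists_right (ContinuousLinearMap.lsmul ℝ ℝ).flip hl hcρ x
      have h' := Integrable.comp_sub_left h x
      refine h'.congr (Filter.Eventually.of_forall fun t => ?_)
      simp
    have e2 : ψ x = ∫ t, ρ t • ψ x := by
      rw [integral_smul_const, h1, one_smul]
    have e3 : mollify ρ ψ x - ψ x = ∫ t, ρ t • (ψ (x - t) - ψ x) := by
      conv_lhs => rw [e1, e2]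
      rw [← integral_sub i1 (iρ.smul_const _)]
      simp only [smul_sub]
    rw [e3]
    refine le_trans ?_ (sq_lintegral_mul_le mp.aemeasurable ?_ hp1)
    · gcongr
      refine (enorm_integral_le_lintegral_enorm _).trans_eq ?_
      refine lintegral_congr fun t => ?_
      rw [enorm_smul, Real.enorm_eq_ofReal (h0 t)]
    · exact ((mψ.comp (measurable_const.sub measurable_id)).sub measurable_const).enorm.aemeasurable
  calc ∫⁻ x, ‖mollify ρ ψ x - ψ x‖ₑ ^ 2
      ≤ ∫⁻ x, ∫⁻ t, p t * ‖ψ (x - t) - ψ x‖ₑ ^ 2 := lintegral_mono hpt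
    _ = ∫⁻ t, ∫⁻ x, p t * ‖ψ (x - t) - ψ x‖ₑ ^ 2 := by
        refine lintegral_lintegral_swap ?_
        refine Measurable.aemeasurable ?_
        refine (mp.comp measurable_snd).mul (Measurable.pow_const (Measurable.enorm ?_) 2)
        exact (mψ.comp (measurable_fst.sub measurable_snd)).sub (mψ.comp measurable_fst)
    _ ≤ ∫⁻ t, p t * C := by
        refine lintegral_mono fun t => ?_
        have hm : Measurable fun x => ‖ψ (x - t) - ψ x‖ₑ ^ 2 :=
          ((mψ.comp (measurable_id.sub measurable_const)).sub mψ).enorm.pow_const 2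
        rw [lintegral_const_mul _ hm]
        by_cases ht : ρ t = 0
        · simp [hp, ht]
        · gcongr
          exact hC t ht
    _ = C := by rw [lintegral_mul_const _ mp, hp1, one_mul]

theorem memLp_mollify {ρ : Space d → ℝ} (hρ : IsTest ρ) (h0 : ∀ t, 0 ≤ ρ t)
    (h1 : ∫ t, ρ t = 1) (ψ : L2 d) {ε : ℝ} (hε : 0 ≤ ε)
    (hC : ∀ t, ρ t ≠ 0 → ∫⁻ x, ‖ψ (x - t) - ψ x‖ₑ ^ 2 ≤ ENNReal.ofReal ε ^ 2) :
    ∃ h : MemLp (mollify ρ ψ) 2 volume, ‖h.toLp _ - ψ‖ ≤ ε := by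
  have hb := lintegral_mollify_sub_le hρ h0 h1 ψ hC
  have hn : eLpNorm (fun x => mollify ρ ψ x - ψ x) 2 volume ≤ ENNReal.ofReal ε := by
    rw [eLpNorm_eq_lintegral_rpow_enorm_toReal (by norm_num) (by norm_num)]
    simp only [ENNReal.toReal_ofNat, ENNReal.rpow_ofNat]
    calc _ ≤ (ENNReal.ofReal ε ^ 2) ^ (1 / 2 : ℝ) := by gcongr
      _ = _ := by
        rw [← ENNReal.rpow_natCast, ← ENNReal.rpow_mul]
        norm_num
  have hm : MemLp (fun x => mollify ρ ψ x - ψ x) 2 volume :=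
    ⟨(contDiff_mollify hρ ψ).continuous.aestronglyMeasurable.sub (Lp.aestronglyMeasurable ψ),
      hn.trans_lt ENNReal.ofReal_lt_top⟩
  have h : MemLp (mollify ρ ψ) 2 volume := by
    refine (hm.add (Lp.memLp ψ)).ae_eq (Filter.Eventually.of_forall fun x => ?_)
    simp
  refine ⟨h, ?_⟩
  have e : h.toLp _ - ψ = hm.toLp _ := by
    refine Lp.ext ?_
    filter_upwards [Lp.coeFn_sub (h.toLp _) ψ, h.coeFn_toLp, hm.coeFn_toLp] with x a b c
    rw [a, c, Pi.sub_apply, b]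
  rw [e, Lp.norm_toLp]
  exact ENNReal.toReal_le_of_le_ofReal hε hn

set_option maxHeartbeats 1000000 in
/-- Smooth functions are dense in `H²(ℝ^d)` for the graph norm of `H₀`. -/
theorem exists_isSmoothH2_approx (ψ : sobolevTwo d) {ε : ℝ} (hε : 0 < ε) :
    ∃ u : Space d → ℂ, ∃ hu : IsSmoothH2 u, ‖hu.memLp.toLp u - ψ‖ ≤ ε ∧
      ‖freeH d ⟨_, hu.mem_sobolevTwo⟩ - freeH d ψ‖ ≤ ε := by
  set ψ₁ : Fin d → L2 d := fun i => partialOp d i ⟨ψ, sobolevTwo_mem_fst ψ i⟩ with hψ₁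
  set ψ₂ : Fin d → Fin d → L2 d := fun i j => partialOp d j ⟨ψ₁ i, sobolevTwo_mem_snd ψ i j⟩
    with hψ₂
  have hd1 : ∀ i, HasFieldDeriv (fun _ => EuclideanSpace.single i 1) (ψ : L2 d) (ψ₁ i) :=
    fun i => fieldOp_spec (fun _ => EuclideanSpace.single i 1) contDiff_const
      ⟨ψ, sobolevTwo_mem_fst ψ i⟩
  have hd2 : ∀ i j, HasFieldDeriv (fun _ => EuclideanSpace.single j 1) (ψ₁ i) (ψ₂ i j) :=
    fun i j => fieldOp_spec (fun _ => EuclideanSpace.single j 1) contDiff_const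
      ⟨ψ₁ i, sobolevTwo_mem_snd ψ i j⟩
  set η : ℝ := ε / (d + 1) with hη
  have hη0 : 0 < η := by positivity
  have hηε : η ≤ ε := div_le_self hε.le (by linarith [(Nat.cast_nonneg d : (0 : ℝ) ≤ d)])
  have hfin : ∀ g : L2 d, ∃ δ : ℝ, 0 < δ ∧
      ∀ t : Space d, ‖t‖ < δ → ∫⁻ x, ‖g (x - t) - g x‖ₑ ^ 2 ≤ ENNReal.ofReal η ^ 2 :=
    fun g => translation_continuous g hη0
  choose δ hδ hδt using hfin
  obtain ⟨r, hr, hrψ, hr1, hr2⟩ : ∃ r : ℝ, 0 < r ∧ r ≤ δ ψ ∧ (∀ i, r ≤ δ (ψ₁ i)) ∧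
      ∀ i j, r ≤ δ (ψ₂ i j) := by
    have hev : ∀ᶠ r : ℝ in nhdsWithin 0 (Set.Ioi 0), r ≤ δ ψ ∧ (∀ i, r ≤ δ (ψ₁ i)) ∧
        ∀ i j, r ≤ δ (ψ₂ i j) := by
      have hg : ∀ g : L2 d, ∀ᶠ r : ℝ in nhdsWithin 0 (Set.Ioi 0), r ≤ δ g := fun g =>
        nhdsWithin_le_nhds (Iic_mem_nhds (hδ g))
      exact (hg _).and ((Filter.eventually_all.2 fun i => hg _).and
        (Filter.eventually_all.2 fun i => Filter.eventually_all.2 fun j => hg _))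
    obtain ⟨r, h1, h2⟩ := (hev.and self_mem_nhdsWithin).exists
    exact ⟨r, h2, h1⟩
  let φ : ContDiffBump (0 : Space d) := ⟨r / 2, r, by linarith, by linarith⟩
  set ρ : Space d → ℝ := φ.normed volume with hρ
  have tρ : IsTest ρ := ⟨φ.contDiff_normed, φ.hasCompactSupport_normed⟩
  have hs : ∀ t, ρ t ≠ 0 → ‖t‖ < r := by
    intro t ht
    have h : t ∈ Function.support (φ.normed volume) := ht
    rw [φ.support_normed_eq] at h
    simpa using h
  have key : ∀ g : L2 d, r ≤ δ g →
      ∃ h : MemLp (mollify ρ g) 2 volume, ‖h.toLp _ - g‖ ≤ η := fun g hg =>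
    memLp_mollify tρ (fun t => φ.nonneg_normed t) (φ.integral_normed) g hη0.le
      fun t ht => hδt g t ((hs t ht).trans_le hg)
  have e1 : ∀ i, pd i (mollify ρ (ψ : L2 d)) = mollify ρ (ψ₁ i) := fun i => pd_mollify tρ (hd1 i)
  have e2 : ∀ i j, pd j (pd i (mollify ρ (ψ : L2 d))) = mollify ρ (ψ₂ i j) := by
    intro i j
    rw [e1, pd_mollify tρ (hd2 i j)]
  obtain ⟨m0, b0⟩ := key ψ hrψ
  choose m2 b2 using fun i j => key (ψ₂ i j) (hr2 i j)
  have hu : IsSmoothH2 (mollify ρ (ψ : L2 d)) := by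
    refine ⟨contDiff_mollify tρ _, m0, fun i => ?_, fun i j => ?_⟩
    · rw [e1]
      exact (key (ψ₁ i) (hr1 i)).1
    · rw [e2]
      exact m2 i j
  refine ⟨_, hu, b0.trans hηε, ?_⟩
  have f1 : freeH d ⟨_, hu.mem_sobolevTwo⟩ - freeH d ψ
      = -∑ i, ((m2 i i).toLp _ - ψ₂ i i) := by
    change (-∑ i : Fin d, secondPartial i) ⟨_, hu.mem_sobolevTwo⟩
      - (-∑ i : Fin d, secondPartial i) ψ = _
    rw [LinearMap.neg_apply, LinearMap.neg_apply, LinearMap.sum_apply, LinearMap.sum_apply,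
      Finset.sum_sub_distrib]
    have f2 : ∀ i, secondPartial i ⟨_, hu.mem_sobolevTwo⟩ = (m2 i i).toLp _ := by
      intro i
      rw [hu.secondPartial_toLp]
      exact MemLp.toLp_congr _ _ (Filter.Eventually.of_forall fun x => by rw [e2])
    simp only [f2]
    have f3 : ∀ i, secondPartial i ψ = ψ₂ i i := fun i => rfl
    simp only [f3]
    abel
  rw [f1, norm_neg]
  calc ‖∑ i, ((m2 i i).toLp _ - ψ₂ i i)‖ ≤ ∑ i : Fin d, η :=
        norm_sum_le_of_le _ fun i _ => b2 i i
    _ = d * η := by simp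
    _ ≤ (d + 1) * η := by nlinarith
    _ = ε := by
      rw [hη]
      field_simp

end

/-! ### The Caccioppoli inequality and cut-off functions -/

section

variable {d : ℕ}

theorem gradSq_of_notMem_tsupport {F : Type*} [NormedAddCommGroup F] [NormedSpace ℝ F]
    {f : Space d → F} {x : Space d} (hx : x ∉ tsupport f) : gradSq f x = 0 := by
  refine Finset.sum_eq_zero fun j _ => ?_
  rw [pd, fderiv_of_notMem_tsupport _ hx]
  simp

/-- The Caccioppoli inequality: local control of the gradient by the function and its Laplacian. The
weight `ζ⁴` keeps the Laplacian term unweighted. -/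
theorem caccioppoli {ζ : Space d → ℝ} (hζ : IsTest ζ) {u : Space d → ℂ} (hu : IsSmoothH2 u) :
    ∫ x, ζ x ^ 2 * gradSq u x
      ≤ (∫ x, (ζ x ^ 4 + 4 * gradSq ζ x) * ‖u x‖ ^ 2) + ∫ x, ‖lap u x‖ ^ 2 := by
  have dζ : Differentiable ℝ ζ := hζ.smooth.differentiable (by simp)
  have du : Differentiable ℝ u := hu.smooth.differentiable (by simp)
  have duu : ∀ j, Differentiable ℝ (pd j u) :=
    fun j => (contDiff_pd hu.smooth j).differentiable (by simp)
  have cu := hu.smooth.continuous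
  have cζ := hζ.smooth.continuous
  have sζ : ∀ p : Space d → ℝ, Continuous p → Integrable fun x => ζ x * p x := by
    intro p hp
    exact (cζ.mul hp).integrable_of_hasCompactSupport hζ.supp.mul_right
  have cgζ : Continuous (gradSq ζ) := continuous_gradSq (contDiff_one_of_smooth hζ.smooth)
  have cgu : Continuous (gradSq u) := continuous_gradSq (contDiff_one_of_smooth hu.smooth)
  have cl : Continuous (lap u) := (contDiff_lap hu.smooth).continuous
  have cpu : ∀ j, Continuous (pd j u) := fun j => (contDiff_pd hu.smooth j).continuous
  have cpζ : ∀ j, Continuous (pd j ζ) := fun j => (contDiff_pd hζ.smooth j).continuous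
  have h0 : ∫ x, (ζ x ^ 2 * inner ℝ (u x) (lap u x) + ζ x ^ 2 * gradSq u x
      + ∑ j, 2 * ζ x * pd j ζ x * inner ℝ (u x) (pd j u x)) = 0 := by
    refine integral_eq_zero_of_eq_sum_pd (h := fun j x => ζ x ^ 2 * inner ℝ (u x) (pd j u x)) ?_ ?_ ?_
    · intro j
      exact ((contDiff_one_of_smooth hζ.smooth).pow 2).mul
        ((contDiff_one_of_smooth hu.smooth).inner ℝ (contDiff_one_of_smooth (contDiff_pd hu.smooth j)))
    · intro j
      refine hζ.supp.mono fun x hx => ?_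
      contrapose! hx
      simp only [Function.mem_support, not_not] at hx ⊢
      simp [hx]
    · intro x
      have e : ∀ j, pd j (fun x => ζ x ^ 2 * inner ℝ (u x) (pd j u x)) x
          = ζ x ^ 2 * (inner ℝ (u x) (pd j (pd j u) x) + ‖pd j u x‖ ^ 2)
            + 2 * ζ x * pd j ζ x * inner ℝ (u x) (pd j u x) := by
        intro j
        rw [pd_mul j (by fun_prop) ((du x).inner ℝ (duu j x)), pd_inner j (du x) (duu j x),
          real_inner_self_eq_norm_sq]
        have e2 : pd j (fun x => ζ x ^ 2) x = 2 * ζ x * pd j ζ x := by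
          have : (fun x => ζ x ^ 2) = fun x => ζ x * ζ x := by
            funext y
            ring
          rw [this, pd_mul j (dζ x) (dζ x)]
          ring
        rw [e2]
      simp only [e, Finset.sum_add_distrib, ← Finset.mul_sum]
      rw [lap, gradSq, inner_sum]
      ring
  have i1 : Integrable fun x => ζ x ^ 2 * inner ℝ (u x) (lap u x) + ζ x ^ 2 * gradSq u x
      + ∑ j, 2 * ζ x * pd j ζ x * inner ℝ (u x) (pd j u x) := by
    refine (sζ (fun x => ζ x * inner ℝ (u x) (lap u x) + ζ x * gradSq u x
      + ∑ j, 2 * pd j ζ x * inner ℝ (u x) (pd j u x)) (by fun_prop)).congr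
      (Filter.Eventually.of_forall fun x => ?_)
    simp only [mul_add, Finset.mul_sum]
    congr 1
    · ring
    · exact Finset.sum_congr rfl fun j _ => by ring
  have i2 : Integrable fun x => (ζ x ^ 4 + 4 * gradSq ζ x) * ‖u x‖ ^ 2 := by
    have j1 : Integrable fun x => ζ x ^ 4 * ‖u x‖ ^ 2 :=
      (sζ (fun x => ζ x ^ 3 * ‖u x‖ ^ 2) (by fun_prop)).congr
        (Filter.Eventually.of_forall fun x => by ring)
    have j2 : Integrable fun x => gradSq ζ x * ‖u x‖ ^ 2 := by
      have : ∀ x, gradSq ζ x * ‖u x‖ ^ 2 = ∑ j, pd j ζ x * (pd j ζ x * ‖u x‖ ^ 2) := by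
        intro x
        rw [gradSq, Finset.sum_mul]
        refine Finset.sum_congr rfl fun j _ => ?_
        rw [Real.norm_eq_abs, sq_abs]
        ring
      simp only [this]
      have cu2 : ∀ j, Continuous fun x => pd j ζ x * ‖u x‖ ^ 2 := fun j => by fun_prop
      exact integrable_finsetSum _ fun j _ =>
        ((cpζ j).mul (cu2 j)).integrable_of_hasCompactSupport (hζ.pd j).supp.mul_right
    refine (j1.add (j2.const_mul 4)).congr (Filter.Eventually.of_forall fun x => ?_)
    simp only [Pi.add_apply]
    ring
  have i3 : Integrable fun x => ‖lap u x‖ ^ 2 := (memLp_two_iff_integrable_sq_norm hu.lap.1).1 hu.lap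
  have i4 : Integrable fun x => ζ x ^ 2 * gradSq u x :=
    (sζ (fun x => ζ x * gradSq u x) (by fun_prop)).congr
      (Filter.Eventually.of_forall fun x => by ring)
  have key : ∫ x, ζ x ^ 2 * gradSq u x
      ≤ ∫ x, (2 * (ζ x ^ 2 * inner ℝ (u x) (lap u x) + ζ x ^ 2 * gradSq u x
      + ∑ j, 2 * ζ x * pd j ζ x * inner ℝ (u x) (pd j u x))
        + ((ζ x ^ 4 + 4 * gradSq ζ x) * ‖u x‖ ^ 2 + ‖lap u x‖ ^ 2)) := by
    refine integral_mono i4 ((i1.const_mul 2).add (i2.add i3)) fun x => ?_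
    dsimp only
    have k1 : -(∑ j, 2 * ζ x * pd j ζ x * inner ℝ (u x) (pd j u x))
        ≤ ζ x ^ 2 * gradSq u x / 2 + 2 * gradSq ζ x * ‖u x‖ ^ 2 := by
      have : ζ x ^ 2 * gradSq u x / 2 + 2 * gradSq ζ x * ‖u x‖ ^ 2
          = ∑ j, (ζ x ^ 2 * ‖pd j u x‖ ^ 2 / 2 + 2 * ‖pd j ζ x‖ ^ 2 * ‖u x‖ ^ 2) := by
        rw [Finset.sum_add_distrib, gradSq, gradSq, Finset.mul_sum, Finset.sum_div, Finset.mul_sum,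
          Finset.sum_mul]
      rw [this, ← Finset.sum_neg_distrib]
      refine Finset.sum_le_sum fun j _ => ?_
      have h1 := abs_real_inner_le_norm (u x) (pd j u x)
      rw [Real.norm_eq_abs]
      set I : ℝ := inner ℝ (u x) (pd j u x)
      have h2 : -(2 * ζ x * pd j ζ x * I) ≤ 2 * |ζ x| * |pd j ζ x| * (‖u x‖ * ‖pd j u x‖) := by
        refine (neg_le_abs _).trans ?_
        rw [abs_mul, abs_mul, abs_mul, abs_two]
        gcongr
      have h3 : ζ x ^ 2 = |ζ x| ^ 2 := (sq_abs _).symm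
      rw [h3]
      nlinarith [sq_nonneg (|ζ x| * ‖pd j u x‖ - 2 * |pd j ζ x| * ‖u x‖)]
    have k2 : -(ζ x ^ 2 * inner ℝ (u x) (lap u x)) ≤ ζ x ^ 4 * ‖u x‖ ^ 2 / 2 + ‖lap u x‖ ^ 2 / 2 := by
      have h1 := neg_le_of_abs_le (abs_real_inner_le_norm (u x) (lap u x))
      nlinarith [sq_nonneg (ζ x ^ 2 * ‖u x‖ - ‖lap u x‖),
        mul_le_mul_of_nonneg_left h1 (sq_nonneg (ζ x))]
    nlinarith [k1, k2]
  have i5 : Integrable fun x => (ζ x ^ 4 + 4 * gradSq ζ x) * ‖u x‖ ^ 2 + ‖lap u x‖ ^ 2 := i2.add i3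
  rw [integral_add (i1.const_mul 2) i5, integral_const_mul, h0, mul_zero, zero_add] at key
  exact key.trans_eq (integral_add i2 i3)

/-- Cut-off functions `χ` that equal `1` for `ε |x| ≤ 1` and whose derivatives are of order `ε` and
are supported where a wider cut-off function `θ` equals `1`. -/
theorem exists_cutoff (d : ℕ) : ∃ C : ℝ, 0 ≤ C ∧ ∀ ε : ℝ, 0 < ε → ε ≤ 1 → ∃ χ θ : Space d → ℝ,
    IsTest χ ∧ IsTest θ ∧ (∀ x, χ x ∈ Set.Icc (0 : ℝ) 1) ∧ (∀ x, θ x ∈ Set.Icc (0 : ℝ) 1) ∧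
    (∀ x, ε * ‖x‖ ≤ 1 → χ x = 1) ∧ (∀ x, gradSq χ x ≤ C * ε ^ 2 * θ x ^ 2) ∧
    (∀ x, lap χ x ^ 2 ≤ C * ε ^ 2 * θ x ^ 2) ∧ ∀ x, gradSq θ x ≤ C := by
  let φ : ContDiffBump (0 : Space d) := ⟨1, 2, by norm_num, by norm_num⟩
  have hφ : IsTest (φ : Space d → ℝ) := ⟨φ.contDiff, φ.hasCompactSupport⟩
  obtain ⟨C₁, hC₁⟩ : ∃ C, ∀ x, gradSq φ x ≤ C := by
    choose K hK using fun j => (hφ.pd j).supp.exists_bound_of_continuous (hφ.pd j).smooth.continuous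
    exact ⟨∑ j, K j ^ 2, fun x => Finset.sum_le_sum fun j _ =>
      pow_le_pow_left₀ (norm_nonneg _) (hK j x) 2⟩
  obtain ⟨C₂, hC₂⟩ := hφ.lap.supp.exists_bound_of_continuous hφ.lap.smooth.continuous
  have hC₁0 : 0 ≤ C₁ := (gradSq_nonneg _ _).trans (hC₁ 0)
  have hpd : ∀ (f : Space d → ℝ) (ε : ℝ) (j : Fin d) (x : Space d), ContDiff ℝ ∞ f →
      pd j (fun y => f (ε • y)) x = ε * pd j f (ε • x) := by
    intro f ε j x hf
    have h1 : HasFDerivAt (fun y : Space d => ε • y) (ε • ContinuousLinearMap.id ℝ (Space d)) x :=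
      (hasFDerivAt_id x).const_smul ε
    have h2 := ((hf.differentiable (by simp) (ε • x)).hasFDerivAt).comp x h1
    have e : (fun y => f (ε • y)) = f ∘ fun y => ε • y := rfl
    rw [pd, e, h2.fderiv]
    simp [pd]
  have hgrad : ∀ (ε : ℝ) (x : Space d), gradSq (fun y => φ (ε • y)) x = ε ^ 2 * gradSq φ (ε • x) := by
    intro ε x
    rw [gradSq, gradSq, Finset.mul_sum]
    refine Finset.sum_congr rfl fun j _ => ?_
    rw [hpd _ _ _ _ hφ.smooth, norm_mul, mul_pow, Real.norm_eq_abs ε, sq_abs]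
  have hlap : ∀ (ε : ℝ) (x : Space d), lap (fun y => φ (ε • y)) x = ε ^ 2 * lap φ (ε • x) := by
    intro ε x
    rw [lap, lap, Finset.mul_sum]
    refine Finset.sum_congr rfl fun j _ => ?_
    have e : pd j (fun y => φ (ε • y)) = fun y => ε * pd j φ (ε • y) :=
      funext fun y => hpd _ _ _ _ hφ.smooth
    have h3 : DifferentiableAt ℝ (fun y => pd j φ (ε • y)) x :=
      ((contDiff_pd hφ.smooth j).comp (contDiff_const_smul ε)).differentiable (by simp) x
    rw [e, pd_mul j (differentiableAt_const _) h3, hpd _ _ _ _ (contDiff_pd hφ.smooth j)]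
    have h4 : pd j (fun _ : Space d => ε) x = 0 := by simp [pd]
    rw [h4]
    ring
  have htest : ∀ ε : ℝ, 0 < ε → IsTest fun x => φ (ε • x) := fun ε hε =>
    ⟨hφ.smooth.comp (contDiff_const_smul ε), hφ.supp.comp_smul hε.ne'⟩
  have hsupp : ∀ y : Space d, y ∉ tsupport φ → gradSq φ y = 0 ∧ lap φ y = 0 := by
    intro y hy
    refine ⟨gradSq_of_notMem_tsupport hy, ?_⟩
    refine Finset.sum_eq_zero fun j _ => ?_
    have h2 : y ∉ tsupport (pd j φ) := fun h => hy (tsupport_fderiv_apply_subset ℝ _ h)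
    rw [pd, fderiv_of_notMem_tsupport _ h2]
    rfl
  refine ⟨C₁ + C₂ ^ 2, by positivity, fun ε hε hε1 => ?_⟩
  have hmem : ∀ x : Space d, φ x ∈ Set.Icc (0 : ℝ) 1 := fun x => ⟨φ.nonneg, φ.le_one⟩
  have hε2 : ε ^ 2 ≤ 1 := pow_le_one₀ hε.le hε1
  have hθ : ∀ x : Space d, (ε • x) ∈ tsupport φ → φ ((ε / 2) • x) = 1 := by
    intro x hx
    rw [φ.tsupport_eq, mem_closedBall_zero_iff] at hx
    refine φ.one_of_mem_closedBall (mem_closedBall_zero_iff.2 ?_)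
    have : φ.rOut = 2 := rfl
    have h1 : φ.rIn = 1 := rfl
    rw [norm_smul, Real.norm_eq_abs, abs_of_pos (by positivity)] at hx ⊢
    linarith
  refine ⟨fun x => φ (ε • x), fun x => φ ((ε / 2) • x), htest ε hε, htest (ε / 2) (by positivity),
    fun x => hmem _, fun x => hmem _, fun x hx => ?_, fun x => ?_, fun x => ?_, fun x => ?_⟩
  · refine φ.one_of_mem_closedBall (mem_closedBall_zero_iff.2 ?_)
    rwa [norm_smul, Real.norm_eq_abs, abs_of_pos hε]
  · rw [hgrad]
    dsimp only
    by_cases hx : (ε • x) ∈ tsupport φ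
    · rw [hθ x hx, one_pow, mul_one, mul_comm]
      gcongr
      exact (hC₁ _).trans (by nlinarith [sq_nonneg C₂])
    · rw [(hsupp _ hx).1, mul_zero]
      positivity
  · rw [hlap]
    dsimp only
    by_cases hx : (ε • x) ∈ tsupport φ
    · rw [hθ x hx, one_pow, mul_one, mul_pow]
      have h1 : lap φ (ε • x) ^ 2 ≤ C₂ ^ 2 := by
        have := hC₂ (ε • x)
        rw [Real.norm_eq_abs] at this
        exact sq_le_sq' (by linarith [neg_abs_le (lap φ (ε • x))]) ((le_abs_self _).trans this)
      calc (ε ^ 2) ^ 2 * lap φ (ε • x) ^ 2 ≤ (ε ^ 2 * 1) * C₂ ^ 2 := by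
            rw [sq (ε ^ 2)]
            gcongr
        _ ≤ (C₁ + C₂ ^ 2) * ε ^ 2 := by nlinarith [mul_nonneg hC₁0 (sq_nonneg ε)]
    · rw [(hsupp _ hx).2, mul_zero, zero_pow two_ne_zero]
      positivity
  · rw [hgrad]
    have h1 : (ε / 2) ^ 2 ≤ 1 := by nlinarith
    nlinarith [hC₁ ((ε / 2) • x), gradSq_nonneg φ ((ε / 2) • x), sq_nonneg C₂]

end

/-! ### The localized Carleman estimate -/

section

variable {d : ℕ} {γ η : ℝ} {q : Space d → ℝ}

theorem contDiff_exp_bracket (c : ℝ) : ContDiff ℝ ∞ fun x : Space d => Real.exp (c * bracket x) :=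
  (contDiff_const.mul contDiff_bracket).exp

theorem gradSq_exp_bracket_le (c : ℝ) (x : Space d) :
    gradSq (fun y : Space d => Real.exp (c * bracket y)) x
      ≤ c ^ 2 * Real.exp (c * bracket x) ^ 2 := by
  have h1 : ∀ j, pd j (fun y : Space d => Real.exp (c * bracket y)) x
      = c * Real.exp (c * bracket x) * (x j / bracket x) := by
    intro j
    have h := ((hasFDerivAt_bracket x).const_mul c).exp
    rw [pd, h.fderiv, ← pd_bracket, pd, (hasFDerivAt_bracket x).fderiv]
    simp
    ring
  have h2 : gradSq (fun y : Space d => Real.exp (c * bracket y)) x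
      = c ^ 2 * Real.exp (c * bracket x) ^ 2 * slopeSq x := by
    rw [gradSq, slopeSq, EuclideanSpace.norm_sq_eq, Finset.sum_div, Finset.mul_sum]
    refine Finset.sum_congr rfl fun j _ => ?_
    rw [h1, norm_mul, mul_pow, norm_div, div_pow, Real.norm_eq_abs, Real.norm_eq_abs (bracket x),
      sq_abs, sq_abs]
    ring
  rw [h2]
  exact mul_le_of_le_one_right (by positivity) (slopeSq_le_one x)

theorem gradSq_mul_le {p f : Space d → ℝ} {x : Space d} (hp : DifferentiableAt ℝ p x)
    (hf : DifferentiableAt ℝ f x) : gradSq (fun y => p y * f y) x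
      ≤ 2 * (p x ^ 2 * gradSq f x + f x ^ 2 * gradSq p x) := by
  rw [gradSq, gradSq, gradSq, Finset.mul_sum, Finset.mul_sum, ← Finset.sum_add_distrib,
    Finset.mul_sum]
  refine Finset.sum_le_sum fun j _ => ?_
  rw [pd_mul j hp hf]
  simp only [Real.norm_eq_abs, sq_abs]
  nlinarith [sq_nonneg (p x * pd j f x - pd j p x * f x)]

theorem norm_sq_sum_pd_smul_le (p : Space d → ℝ) (f : Space d → ℂ) (x : Space d) :
    ‖∑ j, pd j p x • pd j f x‖ ^ 2 ≤ gradSq p x * gradSq f x := by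
  calc ‖∑ j, pd j p x • pd j f x‖ ^ 2 ≤ (∑ j, ‖pd j p x‖ * ‖pd j f x‖) ^ 2 := by
        gcongr
        exact (norm_sum_le _ _).trans_eq (by simp only [norm_smul])
    _ ≤ _ := Finset.sum_mul_sq_le_sq_mul_sq _ _ _

/-- The Carleman estimate applied to `χ u` for a cut-off function `χ`. The commutator of `-Δ` with
`χ` contains the gradient of `u`, which the Caccioppoli inequality replaces by `u` at the price of
a larger exponential weight; the derivatives of `χ` provide the factor `ε²`. -/
theorem carleman_cutoff (hγ : 0 ≤ γ) (hη : 0 ≤ η)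
    (hcar : ∀ u : Space d → ℂ, IsTest u →
      ∫ x, (slopeSq x - η) * ‖Real.exp (γ * bracket x) • u x‖ ^ 2
        ≤ η * ∫ x, ‖(bracket x * Real.exp (γ * bracket x)) • (-lap u x + q x • u x)‖ ^ 2) :
    ∃ K : ℝ, 0 ≤ K ∧ ∀ ε : ℝ, 0 < ε → ε ≤ 1 → ∃ (χ b : Space d → ℝ) (M : ℝ),
      IsTest χ ∧ (∀ x, χ x ∈ Set.Icc (0 : ℝ) 1) ∧ (∀ x, ε * ‖x‖ ≤ 1 → χ x = 1) ∧
      Continuous b ∧ HasCompactSupport b ∧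
      (∀ x, b x ∈ Set.Icc 0 (K * Real.exp ((γ + 1) * bracket x) ^ 4)) ∧
      ∀ u : Space d → ℂ, IsSmoothH2 u → MemLp (fun x => -lap u x + q x • u x) 2 volume →
        ∫ x, (slopeSq x - η) * Real.exp (γ * bracket x) ^ 2 * χ x ^ 2 * ‖u x‖ ^ 2
          ≤ M * (∫ x, ‖-lap u x + q x • u x‖ ^ 2)
            + K * ε ^ 2 * ((∫ x, b x * ‖u x‖ ^ 2) + ∫ x, ‖lap u x‖ ^ 2) := by
  obtain ⟨C, hC, hcut⟩ := exists_cutoff d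
  have hK1 : (0 : ℝ) ≤ 2 + 8 * (γ + 1) ^ 2 + 8 * C := by positivity
  refine ⟨max (12 * η * C) (2 + 8 * (γ + 1) ^ 2 + 8 * C), le_max_of_le_right hK1,
    fun ε hε hε1 => ?_⟩
  set K : ℝ := max (12 * η * C) (2 + 8 * (γ + 1) ^ 2 + 8 * C) with hK
  obtain ⟨χ, θ, hχ, hθ, mχ, mθ, hχ1, gχ, lχ, gθ⟩ := hcut ε hε hε1
  -- `P` dominates the weight `⟨x⟩ e^{γ⟨x⟩}` because `⟨x⟩ ≤ e^{⟨x⟩}`.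
  set P : Space d → ℝ := fun x => Real.exp ((γ + 1) * bracket x) with hP
  have sP : ContDiff ℝ ∞ P := contDiff_exp_bracket _
  have P1 : ∀ x, 1 ≤ P x := fun x =>
    Real.one_le_exp (mul_nonneg (by linarith) (bracket_pos x).le)
  have hpP : ∀ x : Space d, bracket x * Real.exp (γ * bracket x) ≤ P x := by
    intro x
    have h1 : bracket x ≤ Real.exp (bracket x) := by linarith [Real.add_one_le_exp (bracket x)]
    calc bracket x * Real.exp (γ * bracket x) ≤ Real.exp (bracket x) * Real.exp (γ * bracket x) := by
          gcongr
      _ = P x := by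
          rw [← Real.exp_add]
          congr 1
          ring
  set ζ : Space d → ℝ := fun x => θ x * P x with hζ
  have tζ : IsTest ζ := ⟨hθ.smooth.mul sP, hθ.supp.mul_right⟩
  have cζ := tζ.smooth.continuous
  have gζ : ∀ x, gradSq ζ x ≤ (2 * (γ + 1) ^ 2 + 2 * C) * P x ^ 2 := by
    intro x
    have h1 := gradSq_mul_le (hθ.smooth.differentiable (by simp) x) (sP.differentiable (by simp) x)
    have h2 := gradSq_exp_bracket_le (γ + 1) x
    have h3 : θ x ^ 2 ≤ 1 := pow_le_one₀ (mθ x).1 (mθ x).2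
    have h4 := gradSq_nonneg P x
    have h5 : θ x ^ 2 * gradSq P x ≤ 1 * ((γ + 1) ^ 2 * P x ^ 2) := by gcongr
    have h6 : P x ^ 2 * gradSq θ x ≤ P x ^ 2 * C := by
      gcongr
      exact gθ x
    linarith
  obtain ⟨M, hM⟩ := (show HasCompactSupport fun x => (bracket x * Real.exp (γ * bracket x)) * χ x from
    hχ.supp.mul_left).exists_bound_of_continuous ((contDiff_bracket (n := 0)).continuous.mul
      (contDiff_exp_bracket γ).continuous |>.mul hχ.smooth.continuous)
  refine ⟨χ, fun x => ζ x ^ 4 + 4 * gradSq ζ x + ζ x ^ 2, η * (3 * M ^ 2), hχ, mχ, hχ1, ?_, ?_, ?_, ?_⟩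
  · have := continuous_gradSq (contDiff_one_of_smooth tζ.smooth)
    fun_prop
  · refine tζ.supp.mono' fun x hx => ?_
    contrapose! hx
    simp [image_eq_zero_of_notMem_tsupport hx, gradSq_of_notMem_tsupport hx]
  · intro x
    have h0 := gradSq_nonneg ζ x
    refine ⟨by positivity, ?_⟩
    have hp := P1 x
    have h1 : ζ x ^ 2 ≤ P x ^ 2 := by
      simp only [hζ, mul_pow]
      exact mul_le_of_le_one_left (by positivity) (pow_le_one₀ (mθ x).1 (mθ x).2)
    have h2 : P x ^ 2 ≤ P x ^ 4 := pow_le_pow_right₀ hp (by norm_num)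
    have h3 : ζ x ^ 4 ≤ P x ^ 4 := by
      calc ζ x ^ 4 = (ζ x ^ 2) ^ 2 := by ring
        _ ≤ (P x ^ 2) ^ 2 := by gcongr
        _ = P x ^ 4 := by ring
    calc ζ x ^ 4 + 4 * gradSq ζ x + ζ x ^ 2
        ≤ P x ^ 4 + 4 * ((2 * (γ + 1) ^ 2 + 2 * C) * P x ^ 4) + P x ^ 4 := by
          gcongr
          · exact (gζ x).trans (by gcongr)
          · exact h1.trans h2
      _ = (2 + 8 * (γ + 1) ^ 2 + 8 * C) * P x ^ 4 := by ring
      _ ≤ K * P x ^ 4 := by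
          gcongr
          exact le_max_right _ _
  · intro u hu hL
    have tu : IsTest fun x => χ x • u x :=
      ⟨hχ.smooth.smul hu.smooth, hχ.supp.smul_right⟩
    have h1 := hcar _ tu
    have e1 : ∀ x, (slopeSq x - η) * Real.exp (γ * bracket x) ^ 2 * χ x ^ 2 * ‖u x‖ ^ 2
        = (slopeSq x - η) * ‖Real.exp (γ * bracket x) • χ x • u x‖ ^ 2 := by
      intro x
      rw [norm_smul, norm_smul, mul_pow, mul_pow, Real.norm_eq_abs, Real.norm_eq_abs, sq_abs, sq_abs]
      ring
    simp only [e1]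
    refine h1.trans ?_
    have cgu : Continuous (gradSq u) := continuous_gradSq (contDiff_one_of_smooth hu.smooth)
    have cu := hu.smooth.continuous
    have i1 : Integrable fun x => ‖-lap u x + q x • u x‖ ^ 2 :=
      (memLp_two_iff_integrable_sq_norm hL.1).1 hL
    have sζ : ∀ p : Space d → ℝ, Continuous p → Integrable fun x => ζ x ^ 2 * p x := by
      intro p hp
      refine ((cζ.mul (cζ.mul hp)).integrable_of_hasCompactSupport tζ.supp.mul_right).congr
        (Filter.Eventually.of_forall fun x => by simp only [Pi.mul_apply]; ring)
    have i2 := sζ _ cgu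
    have i3 : Integrable fun x => ζ x ^ 2 * ‖u x‖ ^ 2 := sζ _ (cu.norm.pow 2)
    have i4 : Integrable fun x => (ζ x ^ 4 + 4 * gradSq ζ x) * ‖u x‖ ^ 2 := by
      have j2 := continuous_gradSq (contDiff_one_of_smooth tζ.smooth)
      refine Continuous.integrable_of_hasCompactSupport (by fun_prop) (tζ.supp.mono' fun x hx => ?_)
      contrapose! hx
      simp [image_eq_zero_of_notMem_tsupport hx, gradSq_of_notMem_tsupport hx]
    have key : ∫ x, ‖(bracket x * Real.exp (γ * bracket x)) •
          (-lap (fun y => χ y • u y) x + q x • χ x • u x)‖ ^ 2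
        ≤ ∫ x, (3 * M ^ 2 * ‖-lap u x + q x • u x‖ ^ 2
          + 12 * C * ε ^ 2 * (ζ x ^ 2 * gradSq u x + ζ x ^ 2 * ‖u x‖ ^ 2)) := by
      refine integral_mono_of_nonneg (Filter.Eventually.of_forall fun x => by positivity)
        ((i1.const_mul _).add ((i2.add i3).const_mul _)) (Filter.Eventually.of_forall fun x => ?_)
      dsimp only
      set p : ℝ := bracket x * Real.exp (γ * bracket x) with hp
      have hp0 : 0 ≤ p := mul_nonneg (bracket_pos x).le (Real.exp_pos _).le
      -- `(-Δ + q)(χ u) = χ (-Δ + q) u - 2 ∇χ · ∇u - (Δχ) u`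
      have e2 : p • (-lap (fun y => χ y • u y) x + q x • χ x • u x)
          = (p * χ x) • (-lap u x + q x • u x) - ((2 * p) • ∑ j, pd j χ x • pd j u x)
            - (p * lap χ x) • u x := by
        rw [lap_smul hχ.smooth hu.smooth]
        module
      have n3 : ∀ a b c : ℂ, ‖a - b - c‖ ^ 2 ≤ 3 * (‖a‖ ^ 2 + ‖b‖ ^ 2 + ‖c‖ ^ 2) := by
        intro a b c
        have h : ‖a - b - c‖ ≤ ‖a‖ + ‖b‖ + ‖c‖ :=
          (norm_sub_le _ _).trans (by gcongr; exact norm_sub_le _ _)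
        nlinarith [norm_nonneg (a - b - c), sq_nonneg (‖a‖ - ‖b‖), sq_nonneg (‖b‖ - ‖c‖),
          sq_nonneg (‖a‖ - ‖c‖)]
      have hpθ : (p * θ x) ^ 2 ≤ ζ x ^ 2 := by
        have h0 := (mθ x).1
        have := hpP x
        rw [hζ]
        dsimp only
        rw [mul_comm]
        gcongr
      have b1 : ‖(p * χ x) • (-lap u x + q x • u x)‖ ^ 2 ≤ M ^ 2 * ‖-lap u x + q x • u x‖ ^ 2 := by
        rw [norm_smul, mul_pow]
        gcongr
        exact hM x
      have b2 : ‖(2 * p) • ∑ j, pd j χ x • pd j u x‖ ^ 2 ≤ 4 * C * ε ^ 2 * (ζ x ^ 2 * gradSq u x) := by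
        have g0 := gradSq_nonneg u x
        rw [norm_smul, mul_pow, Real.norm_eq_abs, sq_abs]
        calc (2 * p) ^ 2 * ‖∑ j, pd j χ x • pd j u x‖ ^ 2
            ≤ (2 * p) ^ 2 * ((C * ε ^ 2 * θ x ^ 2) * gradSq u x) := by
              gcongr
              exact (norm_sq_sum_pd_smul_le χ u x).trans (by gcongr; exact gχ x)
          _ = 4 * C * ε ^ 2 * ((p * θ x) ^ 2 * gradSq u x) := by ring
          _ ≤ _ := by gcongr
      have b3 : ‖(p * lap χ x) • u x‖ ^ 2 ≤ C * ε ^ 2 * (ζ x ^ 2 * ‖u x‖ ^ 2) := by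
        rw [norm_smul, mul_pow, Real.norm_eq_abs, sq_abs]
        calc (p * lap χ x) ^ 2 * ‖u x‖ ^ 2 = p ^ 2 * (lap χ x ^ 2) * ‖u x‖ ^ 2 := by ring
          _ ≤ p ^ 2 * (C * ε ^ 2 * θ x ^ 2) * ‖u x‖ ^ 2 := by
              gcongr
              exact lχ x
          _ = C * ε ^ 2 * ((p * θ x) ^ 2 * ‖u x‖ ^ 2) := by ring
          _ ≤ _ := by gcongr
      have b4 : 0 ≤ C * ε ^ 2 * (ζ x ^ 2 * ‖u x‖ ^ 2) := by positivity
      rw [e2]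
      linarith [n3 ((p * χ x) • (-lap u x + q x • u x)) ((2 * p) • ∑ j, pd j χ x • pd j u x)
        ((p * lap χ x) • u x)]
    have h3 := caccioppoli tζ hu
    have e3 : ∫ x, (ζ x ^ 4 + 4 * gradSq ζ x + ζ x ^ 2) * ‖u x‖ ^ 2
        = (∫ x, (ζ x ^ 4 + 4 * gradSq ζ x) * ‖u x‖ ^ 2) + ∫ x, ζ x ^ 2 * ‖u x‖ ^ 2 := by
      rw [← integral_add i4 i3]
      simp only [add_mul]
    have i5 : Integrable fun x => ζ x ^ 2 * gradSq u x + ζ x ^ 2 * ‖u x‖ ^ 2 := i2.add i3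
    rw [integral_add (i1.const_mul _) (i5.const_mul _), integral_const_mul, integral_const_mul,
      integral_add i2 i3] at key
    rw [e3]
    have nn1 : 0 ≤ ∫ x, ζ x ^ 2 * gradSq u x := integral_nonneg fun x =>
      mul_nonneg (sq_nonneg _) (gradSq_nonneg u x)
    have nn2 : 0 ≤ ∫ x, ζ x ^ 2 * ‖u x‖ ^ 2 := integral_nonneg fun x => by positivity
    have hKη : 12 * η * C ≤ K := le_max_left _ _
    calc η * ∫ x, ‖(bracket x * Real.exp (γ * bracket x)) •
            (-lap (fun y => χ y • u y) x + q x • χ x • u x)‖ ^ 2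
        ≤ η * (3 * M ^ 2 * (∫ x, ‖-lap u x + q x • u x‖ ^ 2)
          + 12 * C * ε ^ 2 * ((∫ x, ζ x ^ 2 * gradSq u x) + ∫ x, ζ x ^ 2 * ‖u x‖ ^ 2)) := by
          gcongr
      _ = η * (3 * M ^ 2) * (∫ x, ‖-lap u x + q x • u x‖ ^ 2)
          + 12 * η * C * ε ^ 2 * ((∫ x, ζ x ^ 2 * gradSq u x) + ∫ x, ζ x ^ 2 * ‖u x‖ ^ 2) := by ring
      _ ≤ _ := by
          have h4 : (∫ x, ζ x ^ 2 * gradSq u x) + ∫ x, ζ x ^ 2 * ‖u x‖ ^ 2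
              ≤ (∫ x, (ζ x ^ 4 + 4 * gradSq ζ x) * ‖u x‖ ^ 2) + (∫ x, ζ x ^ 2 * ‖u x‖ ^ 2)
                + ∫ x, ‖lap u x‖ ^ 2 := by linarith
          exact add_le_add_right (mul_le_mul (mul_le_mul_of_nonneg_right hKη (sq_nonneg ε)) h4
            (by linarith) (by positivity)) _

end

/-! ### Eigenfunctions -/

section

variable {d : ℕ}

theorem coeFn_mulOp {U : Space d → ℝ} (f : (mulOp U).domain) :
    mulOp U f =ᵐ[volume] fun x => U x • (f : L2 d) x := by
  refine (MemLp.coeFn_toLp (mulDomain_memLp (U := U) f)).trans ?_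
  exact Filter.Eventually.of_forall fun x => (Complex.real_smul).symm

theorem EssBounded.mem_mulDomain {U : Space d → ℝ} (hb : EssBounded U)
    (hm : AEMeasurable U volume) (f : L2 d) : f ∈ mulDomain U :=
  (hb.memLp hm (Lp.memLp f)).ae_eq (Filter.Eventually.of_forall fun _ => Complex.real_smul)

theorem norm_mulOp_le {U : Space d → ℝ} {C : ℝ} (hC : ∀ᵐ x, |U x| ≤ C) (f : (mulOp U).domain) :
    ‖mulOp U f‖ ≤ C * ‖(f : L2 d)‖ := by
  refine Lp.norm_le_mul_norm_of_ae_le_mul ?_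
  filter_upwards [coeFn_mulOp f, hC] with x h1 h2
  rw [h1, norm_smul, Real.norm_eq_abs]
  gcongr

theorem tendsto_integral_mul_norm_sq {a : Space d → ℝ} (ha : Continuous a)
    (hc : HasCompactSupport a) {ι : Type*} {l : Filter ι} {f : ι → L2 d} {g : L2 d}
    (h : Filter.Tendsto f l (nhds g)) :
    Filter.Tendsto (fun n => ∫ x, a x * ‖f n x‖ ^ 2) l (nhds (∫ x, a x * ‖g x‖ ^ 2)) := by
  obtain ⟨A, hA⟩ := hc.exists_bound_of_continuous ha
  have hdom : ∀ f : L2 d, f ∈ (mulOp a).domain :=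
    EssBounded.mem_mulDomain ⟨A, Filter.Eventually.of_forall hA⟩ ha.aemeasurable
  have e : ∀ f : L2 d, ∫ x, a x * ‖f x‖ ^ 2 = (inner ℂ (mulOp a ⟨f, hdom f⟩) f).re := by
    intro f
    have h1 := re_inner_toLp (Lp.memLp (mulOp a ⟨f, hdom f⟩)) (Lp.memLp f)
    rw [Lp.toLp_coeFn, Lp.toLp_coeFn] at h1
    rw [h1]
    refine integral_congr_ae ?_
    filter_upwards [coeFn_mulOp ⟨f, hdom f⟩] with x hx
    rw [hx, real_inner_smul_left, real_inner_self_eq_norm_sq]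
  simp only [e]
  have h2 : Filter.Tendsto (fun n => mulOp a ⟨f n, hdom (f n)⟩) l (nhds (mulOp a ⟨g, hdom g⟩)) := by
    rw [tendsto_iff_norm_sub_tendsto_zero]
    have h3 := (tendsto_iff_norm_sub_tendsto_zero.1 h).const_mul A
    rw [mul_zero] at h3
    refine squeeze_zero (fun _ => norm_nonneg _) (fun n => ?_) h3
    rw [← LinearPMap.map_sub]
    exact norm_mulOp_le (Filter.Eventually.of_forall hA) _
  exact (Complex.continuous_re.tendsto _).comp (h2.inner h)

theorem integrable_of_mem_mulOp_domain {U : Space d → ℝ} {f : L2 d} (h : f ∈ (mulOp U).domain) :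
    Integrable fun x => U x ^ 2 * ‖f x‖ ^ 2 := by
  have h' : MemLp (fun x => (U x : ℂ) * f x) 2 volume := h
  refine ((memLp_two_iff_integrable_sq_norm h'.1).1 h').congr
    (Filter.Eventually.of_forall fun x => ?_)
  dsimp only
  rw [norm_mul, mul_pow, Complex.norm_real, Real.norm_eq_abs, sq_abs]

/-- The Carleman estimate for an eigenfunction that decays faster than every exponential: the
right-hand side, being the eigenvalue equation, disappears. -/
theorem carleman_eigenfunction {γ η : ℝ} (hγ : 0 ≤ γ) (hη : 0 ≤ η) {q : Space d → ℝ}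
    (hcar : ∀ u : Space d → ℂ, IsTest u →
      ∫ x, (slopeSq x - η) * ‖Real.exp (γ * bracket x) • u x‖ ^ 2
        ≤ η * ∫ x, ‖(bracket x * Real.exp (γ * bracket x)) • (-lap u x + q x • u x)‖ ^ 2)
    (hdom : (freeH d).domain ≤ (mulOp q).domain) {C : ℝ}
    (hC : ∀ f : (freeH d).domain, ‖mulOp q ⟨f, hdom f.2⟩‖ ≤ C * (‖freeH d f‖ + ‖(f : L2 d)‖))
    {ψ : (freeH d).domain} (hψ : freeH d ψ + mulOp q ⟨ψ, hdom ψ.2⟩ = 0)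
    (hdec : ∀ c : ℝ, 0 ≤ c → (ψ : L2 d) ∈ (mulOp fun x => Real.exp (c * bracket x)).domain) :
    ∫ x, (slopeSq x - η) * Real.exp (γ * bracket x) ^ 2 * ‖(ψ : L2 d) x‖ ^ 2 ≤ 0 := by
  have hint : ∀ c : ℝ, 0 ≤ c → Integrable fun x => Real.exp (c * bracket x) ^ 2 * ‖(ψ : L2 d) x‖ ^ 2 :=
    fun c hc => integrable_of_mem_mulOp_domain (hdec c hc)
  obtain ⟨K, hK, hcut⟩ := carleman_cutoff hγ hη hcar
  have happrox : ∀ n : ℕ, ∃ u, ∃ hu : IsSmoothH2 u,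
      ‖hu.memLp.toLp u - (ψ : L2 d)‖ ≤ 1 / ((n : ℝ) + 1) ∧
      ‖freeH d ⟨_, hu.mem_sobolevTwo⟩ - freeH d ψ‖ ≤ 1 / ((n : ℝ) + 1) :=
    fun n => exists_isSmoothH2_approx ψ (by positivity)
  choose u hu hu1 hu2 using happrox
  set U : ℕ → (freeH d).domain := fun n => ⟨_, (hu n).mem_sobolevTwo⟩ with hU
  have t0 : Filter.Tendsto (fun n : ℕ => 1 / ((n : ℝ) + 1)) Filter.atTop (nhds 0) :=
    tendsto_one_div_add_atTop_nhds_zero_nat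
  have t1 : Filter.Tendsto (fun n => (U n : L2 d)) Filter.atTop (nhds (ψ : L2 d)) :=
    tendsto_iff_norm_sub_tendsto_zero.2 (squeeze_zero (fun _ => norm_nonneg _) hu1 t0)
  have t2 : Filter.Tendsto (fun n => freeH d (U n)) Filter.atTop (nhds (freeH d ψ)) :=
    tendsto_iff_norm_sub_tendsto_zero.2 (squeeze_zero (fun _ => norm_nonneg _) hu2 t0)
  have t3 : Filter.Tendsto (fun n => mulOp q ⟨U n, hdom (U n).2⟩) Filter.atTop
      (nhds (mulOp q ⟨ψ, hdom ψ.2⟩)) := by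
    rw [tendsto_iff_norm_sub_tendsto_zero]
    have h3 := ((tendsto_iff_norm_sub_tendsto_zero.1 t2).add
      (tendsto_iff_norm_sub_tendsto_zero.1 t1)).const_mul C
    rw [add_zero, mul_zero] at h3
    refine squeeze_zero (fun _ => norm_nonneg _) (fun n => ?_) h3
    rw [← LinearPMap.map_sub, ← LinearPMap.map_sub]
    exact hC (U n - ψ)
  have t4 : Filter.Tendsto (fun n => freeH d (U n) + mulOp q ⟨U n, hdom (U n).2⟩) Filter.atTop
      (nhds 0) := hψ ▸ t2.add t3
  have mq : ∀ n, MemLp (fun x => q x • u n x) 2 volume := fun n =>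
    memLp_of_mem_mulDomain (hu n).memLp (hdom (U n).2)
  have mL : ∀ n, MemLp (fun x => -lap (u n) x + q x • u n x) 2 volume := fun n =>
    (hu n).lap.neg.add (mq n)
  have e1 : ∀ n, ∫ x, ‖-lap (u n) x + q x • u n x‖ ^ 2
      = ‖freeH d (U n) + mulOp q ⟨U n, hdom (U n).2⟩‖ ^ 2 := by
    intro n
    rw [← norm_sq_toLp (mL n), (hu n).freeH_toLp, mulOp_toLp (hu n).memLp (mq n)]
    rfl
  have e2 : ∀ n, ∫ x, ‖lap (u n) x‖ ^ 2 = ‖freeH d (U n)‖ ^ 2 := by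
    intro n
    rw [(hu n).freeH_toLp, norm_neg, norm_sq_toLp]
  have e3 : ∀ (a : Space d → ℝ) (n : ℕ), ∫ x, a x * ‖u n x‖ ^ 2 = ∫ x, a x * ‖(U n : L2 d) x‖ ^ 2 := by
    intro a n
    refine integral_congr_ae ?_
    filter_upwards [(hu n).memLp.coeFn_toLp] with x hx
    rw [hx]
  -- In the limit of smooth approximations the equation removes the first term of the localized
  -- estimate. The rest is of order `ε²`, since the weight `b` is bounded uniformly in `ε` by
  -- `e^{4(γ+1)⟨x⟩}`, which is integrable against `|ψ|²`.
  set B : ℝ := K * ((∫ x, K * (Real.exp (2 * (γ + 1) * bracket x) ^ 2 * ‖(ψ : L2 d) x‖ ^ 2))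
    + ‖freeH d ψ‖ ^ 2) with hB
  have hlim : ∀ ε : ℝ, 0 < ε → ε ≤ 1 → ∃ χ : Space d → ℝ, IsTest χ ∧
      (∀ x, χ x ∈ Set.Icc (0 : ℝ) 1) ∧ (∀ x, ε * ‖x‖ ≤ 1 → χ x = 1) ∧
      ∫ x, (slopeSq x - η) * Real.exp (γ * bracket x) ^ 2 * χ x ^ 2 * ‖(ψ : L2 d) x‖ ^ 2
        ≤ ε ^ 2 * B := by
    intro ε hε hε1
    obtain ⟨χ, b, M, hχ, mχ, hχ1, cb, sb, mb, h⟩ := hcut ε hε hε1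
    refine ⟨χ, hχ, mχ, hχ1, ?_⟩
    have ca : Continuous fun x => (slopeSq x - η) * Real.exp (γ * bracket x) ^ 2 * χ x ^ 2 :=
      (((contDiff_slopeSq (n := 0)).continuous.sub continuous_const).mul
        ((contDiff_exp_bracket γ).continuous.pow 2)).mul (hχ.smooth.continuous.pow 2)
    have sa : HasCompactSupport fun x => (slopeSq x - η) * Real.exp (γ * bracket x) ^ 2 * χ x ^ 2 := by
      refine hχ.supp.mono fun x hx => ?_
      contrapose! hx
      simp only [Function.mem_support, not_not] at hx ⊢
      simp [hx]
    have l1 := tendsto_integral_mul_norm_sq ca sa t1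
    have l2 := ((t4.norm.pow 2).const_mul M).add
      (((tendsto_integral_mul_norm_sq cb sb t1).add (t2.norm.pow 2)).const_mul (K * ε ^ 2))
    have l3 := le_of_tendsto_of_tendsto' l1 l2 fun n => by
      have h1 := h (u n) (hu n) (mL n)
      rwa [e1, e2, e3, e3] at h1
    refine l3.trans ?_
    have h4 : ∫ x, b x * ‖(ψ : L2 d) x‖ ^ 2
        ≤ ∫ x, K * (Real.exp (2 * (γ + 1) * bracket x) ^ 2 * ‖(ψ : L2 d) x‖ ^ 2) := by
      refine integral_mono_of_nonneg (Filter.Eventually.of_forall fun x =>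
        mul_nonneg (mb x).1 (sq_nonneg _)) ((hint _ (by linarith)).const_mul K)
        (Filter.Eventually.of_forall fun x => ?_)
      dsimp only
      rw [← mul_assoc]
      refine mul_le_mul_of_nonneg_right ((mb x).2.trans_eq ?_) (sq_nonneg _)
      rw [← Real.exp_nat_mul, ← Real.exp_nat_mul]
      congr 2
      push_cast
      ring
    rw [norm_zero, zero_pow two_ne_zero, mul_zero, zero_add, hB]
    calc K * ε ^ 2 * ((∫ x, b x * ‖(ψ : L2 d) x‖ ^ 2) + ‖freeH d ψ‖ ^ 2)
        ≤ K * ε ^ 2 * ((∫ x, K * (Real.exp (2 * (γ + 1) * bracket x) ^ 2 * ‖(ψ : L2 d) x‖ ^ 2))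
          + ‖freeH d ψ‖ ^ 2) := by gcongr
      _ = _ := by ring
  choose χ hχ mχ hχ1 hχB using fun m : ℕ =>
    hlim (1 / ((m : ℝ) + 1)) (by positivity) (by rw [div_le_one (by positivity)]; simp)
  have l1 : Filter.Tendsto (fun m => ∫ x, (slopeSq x - η) * Real.exp (γ * bracket x) ^ 2
        * χ m x ^ 2 * ‖(ψ : L2 d) x‖ ^ 2) Filter.atTop
      (nhds (∫ x, (slopeSq x - η) * Real.exp (γ * bracket x) ^ 2 * ‖(ψ : L2 d) x‖ ^ 2)) := by
    refine tendsto_integral_of_dominated_convergence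
      (fun x => (1 + η) * (Real.exp (γ * bracket x) ^ 2 * ‖(ψ : L2 d) x‖ ^ 2)) (fun m => ?_)
      ((hint γ hγ).const_mul _) (fun m => Filter.Eventually.of_forall fun x => ?_)
      (Filter.Eventually.of_forall fun x => ?_)
    · have ca : Continuous fun x => (slopeSq x - η) * Real.exp (γ * bracket x) ^ 2 * χ m x ^ 2 :=
        (((contDiff_slopeSq (n := 0)).continuous.sub continuous_const).mul
          ((contDiff_exp_bracket γ).continuous.pow 2)).mul ((hχ m).smooth.continuous.pow 2)
      exact ca.aestronglyMeasurable.mul ((Lp.aestronglyMeasurable _).norm.pow 2)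
    · have h1 : |slopeSq x - η| ≤ 1 + η := by
        rw [abs_le]
        constructor <;> linarith [slopeSq_nonneg x, slopeSq_le_one x]
      have h2 : χ m x ^ 2 ≤ 1 := pow_le_one₀ (mχ m x).1 (mχ m x).2
      rw [Real.norm_eq_abs, abs_mul, abs_mul, abs_mul, abs_of_nonneg (sq_nonneg (χ m x)),
        abs_of_nonneg (sq_nonneg (Real.exp _)), abs_of_nonneg (sq_nonneg ‖_‖), ← mul_assoc]
      refine mul_le_mul_of_nonneg_right ?_ (sq_nonneg _)
      calc _ ≤ (1 + η) * Real.exp (γ * bracket x) ^ 2 * 1 := by gcongr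
        _ = _ := mul_one _
    · refine tendsto_const_nhds.congr' ?_
      have h1 : Filter.Tendsto (fun m : ℕ => 1 / ((m : ℝ) + 1) * ‖x‖) Filter.atTop (nhds 0) := by
        simpa using t0.mul_const ‖x‖
      filter_upwards [h1.eventually (ge_mem_nhds one_pos)] with m hm
      rw [hχ1 m x hm, one_pow, mul_one]
  have l2 : Filter.Tendsto (fun m : ℕ => (1 / ((m : ℝ) + 1)) ^ 2 * B) Filter.atTop (nhds 0) := by
    simpa using (t0.pow 2).mul_const B
  exact le_of_tendsto_of_tendsto' l1 l2 hχB

/-- If `∫ (|x|²/⟨x⟩² - η) e^{2γ⟨x⟩} |f|² ≤ 0` for every `η > 0` and all large `γ`, the mass of `f`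
cannot sit away from the origin: for `r' < r` the weight on `|x| ≥ r` exceeds that on `|x| < r'` by an
exponential factor, and outside `|x| < r'` the integrand is nonnegative for small `η`. -/
theorem eq_zero_of_weighted_integral_nonpos (hd : 1 ≤ d) {f : L2 d}
    (hdec : ∀ c : ℝ, 0 ≤ c → Integrable fun x => Real.exp (c * bracket x) ^ 2 * ‖f x‖ ^ 2)
    (h : ∀ η : ℝ, 0 < η → ∃ γ₀ : ℝ, ∀ γ : ℝ, γ₀ ≤ γ →
      ∫ x, (slopeSq x - η) * Real.exp (γ * bracket x) ^ 2 * ‖f x‖ ^ 2 ≤ 0) : f = 0 := by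
  have i0 : Integrable fun x => ‖f x‖ ^ 2 :=
    (memLp_two_iff_integrable_sq_norm (Lp.aestronglyMeasurable f)).1 (Lp.memLp f)
  have key : ∀ r : ℝ, 0 < r → ∀ᵐ x, r ≤ ‖x‖ → f x = 0 := by
    intro r hr
    set S : Set (Space d) := {x | r ≤ ‖x‖} with hS
    have mS : MeasurableSet S := measurableSet_le measurable_const measurable_norm
    -- Twice `η` is the value of `|x|² / ⟨x⟩²` at `|x| = r / 2`.
    set b : ℝ := Real.sqrt (1 + (r / 2) ^ 2) with hb
    set b' : ℝ := Real.sqrt (1 + r ^ 2) with hb'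
    have hb0 : 0 < b := Real.sqrt_pos.2 (by positivity)
    have hbb : b < b' := Real.sqrt_lt_sqrt (by positivity) (by nlinarith)
    set η : ℝ := (1 - 1 / b ^ 2) / 2 with hη
    have hb1 : 1 < b ^ 2 := by
      rw [hb, Real.sq_sqrt (by positivity)]
      nlinarith
    have hη0 : 0 < η := by
      have : 1 / b ^ 2 < 1 := by rwa [div_lt_one (by positivity)]
      rw [hη]
      linarith
    obtain ⟨γ₀, hγ₀⟩ := h η hη0
    have i1 : Integrable (S.indicator fun x => ‖f x‖ ^ 2) := i0.indicator mS
    have bound : ∀ γ : ℝ, max γ₀ 0 ≤ γ → ∫ x, S.indicator (fun x => ‖f x‖ ^ 2) x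
        ≤ Real.exp (-(2 * (b' - b)) * γ) * ∫ x, ‖f x‖ ^ 2 := by
      intro γ hγ
      have hγ0 : 0 ≤ γ := (le_max_right _ _).trans hγ
      have h1 := hγ₀ γ ((le_max_left _ _).trans hγ)
      have i2 : Integrable fun x => (slopeSq x - η) * Real.exp (γ * bracket x) ^ 2 * ‖f x‖ ^ 2 := by
        refine ((hdec γ hγ0).bdd_mul (c := 1 + η)
          ((contDiff_slopeSq (n := 0)).continuous.sub continuous_const).aestronglyMeasurable
          (Filter.Eventually.of_forall fun x => ?_)).congr
          (Filter.Eventually.of_forall fun x => (mul_assoc _ _ _).symm)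
        change |slopeSq x - η| ≤ 1 + η
        rw [abs_le]
        constructor <;> linarith [slopeSq_nonneg x, slopeSq_le_one x]
      have h2 : ∫ x, (η * Real.exp (γ * b') ^ 2 * S.indicator (fun x => ‖f x‖ ^ 2) x
          - η * Real.exp (γ * b) ^ 2 * ‖f x‖ ^ 2)
          ≤ ∫ x, (slopeSq x - η) * Real.exp (γ * bracket x) ^ 2 * ‖f x‖ ^ 2 := by
        refine integral_mono ((i1.const_mul _).sub (i0.const_mul _)) i2 fun x => ?_
        dsimp only
        have hbx := bracket_pos x
        have p1 := sq_nonneg ‖f x‖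
        have p2 : 0 ≤ η * Real.exp (γ * b) ^ 2 * ‖f x‖ ^ 2 := by positivity
        rcases lt_or_ge (bracket x) b with hlt | hge
        · have hx : x ∉ S := by
            intro hx
            have : b' ≤ bracket x := Real.sqrt_le_sqrt (by
              have : r ≤ ‖x‖ := hx
              gcongr)
            linarith
          rw [Set.indicator_of_notMem hx, mul_zero, zero_sub, ← neg_mul]
          refine mul_le_mul_of_nonneg_right ?_ p1
          have h3 : Real.exp (γ * bracket x) ^ 2 ≤ Real.exp (γ * b) ^ 2 := by gcongr
          nlinarith [slopeSq_nonneg x, sq_nonneg (Real.exp (γ * bracket x)),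
            mul_nonneg (slopeSq_nonneg x) (sq_nonneg (Real.exp (γ * bracket x))),
            mul_le_mul_of_nonneg_left h3 hη0.le]
        · have hs : η ≤ slopeSq x - η := by
            have : 1 / bracket x ^ 2 ≤ 1 / b ^ 2 := by gcongr
            rw [slopeSq_eq]
            linarith
          have hs0 : 0 ≤ slopeSq x - η := hη0.le.trans hs
          have h3 : 0 ≤ (slopeSq x - η) * Real.exp (γ * bracket x) ^ 2 * ‖f x‖ ^ 2 := by positivity
          by_cases hx : x ∈ S
          · have hbr : b' ≤ bracket x := Real.sqrt_le_sqrt (by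
              have : r ≤ ‖x‖ := hx
              gcongr)
            rw [Set.indicator_of_mem hx]
            have h4 : η * Real.exp (γ * b') ^ 2 * ‖f x‖ ^ 2
                ≤ (slopeSq x - η) * Real.exp (γ * bracket x) ^ 2 * ‖f x‖ ^ 2 := by gcongr
            linarith
          · rw [Set.indicator_of_notMem hx, mul_zero]
            linarith
      rw [integral_sub (i1.const_mul _) (i0.const_mul _), integral_const_mul, integral_const_mul]
        at h2
      have h3 : η * Real.exp (γ * b') ^ 2 * (∫ x, S.indicator (fun x => ‖f x‖ ^ 2) x)
          ≤ η * Real.exp (γ * b') ^ 2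
            * (Real.exp (-(2 * (b' - b)) * γ) * ∫ x, ‖f x‖ ^ 2) := by
        have e : Real.exp (γ * b') ^ 2 * Real.exp (-(2 * (b' - b)) * γ) = Real.exp (γ * b) ^ 2 := by
          rw [← Real.exp_nat_mul, ← Real.exp_nat_mul, ← Real.exp_add]
          congr 1
          push_cast
          ring
        calc _ ≤ η * Real.exp (γ * b) ^ 2 * ∫ x, ‖f x‖ ^ 2 := by linarith
          _ = _ := by
            rw [← e]
            ring
      exact le_of_mul_le_mul_left h3 (by positivity)
    have lim : Filter.Tendsto (fun γ : ℝ => Real.exp (-(2 * (b' - b)) * γ) * ∫ x, ‖f x‖ ^ 2)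
        Filter.atTop (nhds 0) := by
      have h1 : Filter.Tendsto (fun γ : ℝ => -(2 * (b' - b)) * γ) Filter.atTop Filter.atBot :=
        Filter.tendsto_id.const_mul_atTop_of_neg (by linarith)
      simpa using (Real.tendsto_exp_atBot.comp h1).mul_const (∫ x, ‖f x‖ ^ 2)
    have nn : ∀ x, 0 ≤ S.indicator (fun x => ‖f x‖ ^ 2) x := fun x =>
      Set.indicator_nonneg (fun _ _ => sq_nonneg _) x
    have h0 : ∫ x, S.indicator (fun x => ‖f x‖ ^ 2) x = 0 :=
      le_antisymm (ge_of_tendsto lim (Filter.eventually_atTop.2 ⟨_, bound⟩)) (integral_nonneg nn)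
    filter_upwards [(integral_eq_zero_iff_of_nonneg nn i1).1 h0] with x hx hxr
    rw [Set.indicator_of_mem (show x ∈ S from hxr)] at hx
    simpa using hx
  have : Nonempty (Fin d) := ⟨⟨0, hd⟩⟩
  refine Lp.ext ?_
  have h1 : ∀ᵐ x : Space d, ∀ n : ℕ, 1 / ((n : ℝ) + 1) ≤ ‖x‖ → f x = 0 :=
    ae_all_iff.2 fun n => key _ (by positivity)
  have h2 : ∀ᵐ x : Space d, x ≠ 0 := by
    rw [ae_iff]
    simp
  filter_upwards [h1, h2, Lp.coeFn_zero ℂ 2 (volume : Measure (Space d))] with x hx hx0 hz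
  obtain ⟨n, hn⟩ := exists_nat_one_div_lt (norm_pos_iff.2 hx0)
  rw [hx n hn.le, hz, Pi.zero_apply]

/-- Multiplication by `V - E` is bounded relative to `H₀`. -/
theorem PotentialData.relBound_V (D : PotentialData d) (w E : ℝ) :
    ∃ hdom : (freeH d).domain ≤ (mulOp fun x => D.V w x - E).domain, ∃ C : ℝ,
      ∀ f : (freeH d).domain,
        ‖mulOp (fun x => D.V w x - E) ⟨f, hdom f.2⟩‖ ≤ C * (‖freeH d f‖ + ‖(f : L2 d)‖) := by
  obtain ⟨hc, hrel⟩ := relCompact_bound D.Vc_relCompact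
  obtain ⟨C, hC, hCb⟩ := hrel 1 one_pos
  obtain ⟨K, hK⟩ := D.essBounded_boundedPart w E
  have hb : ∀ f : L2 d, f ∈ (mulOp (D.boundedPart w E)).domain :=
    EssBounded.mem_mulDomain ⟨K, hK⟩ (D.aemeasurable_boundedPart w E)
  have hdom : (freeH d).domain ≤ (mulOp fun x => D.V w x - E).domain := by
    intro f hf
    refine (MemLp.add (hc hf) (hb f)).ae_eq (Filter.Eventually.of_forall fun x => ?_)
    simp only [V_sub_eq, Pi.add_apply]
    push_cast
    ring
  refine ⟨hdom, 1 + C + |K|, fun f => ?_⟩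
  have e : mulOp (fun x => D.V w x - E) ⟨f, hdom f.2⟩
      = mulOp D.Vc ⟨f, hc f.2⟩ + mulOp (D.boundedPart w E) ⟨f, hb f⟩ := by
    refine Lp.ext ?_
    filter_upwards [coeFn_mulOp (U := fun x => D.V w x - E) ⟨f, hdom f.2⟩,
      coeFn_mulOp (U := D.Vc) ⟨f, hc f.2⟩, coeFn_mulOp (U := D.boundedPart w E) ⟨f, hb f⟩,
      Lp.coeFn_add (mulOp D.Vc ⟨f, hc f.2⟩) (mulOp (D.boundedPart w E) ⟨f, hb f⟩)] with x h1 h2 h3 h4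
    rw [h1, h4, Pi.add_apply, h2, h3, V_sub_eq, add_smul]
  rw [e]
  refine (norm_add_le _ _).trans ?_
  have h1 := hCb f
  have h2 := norm_mulOp_le hK ⟨f, hb f⟩
  have h3 := mul_le_mul_of_nonneg_right (le_abs_self K) (norm_nonneg (f : L2 d))
  have h4 := norm_nonneg (f : L2 d)
  have h5 := norm_nonneg (freeH d f)
  have h6 := abs_nonneg K
  simp only at h2
  nlinarith [mul_nonneg hC h5, mul_nonneg h6 h5]

end

/-- The eigenvalue equation in terms of the potential `V - E`. -/
theorem PotentialData.freeH_add_mulOp_eq_zero {d : ℕ} (D : PotentialData d) (w E : ℝ)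
    (hdom : (freeH d).domain ≤ (mulOp fun x => D.V w x - E).domain) (ψ : (D.H w).domain)
    (hψ : D.H w ψ = (E : ℂ) • (ψ : L2 d)) :
    freeH d ⟨ψ, ψ.2.1⟩ + mulOp (fun x => D.V w x - E) ⟨ψ, hdom ψ.2.1⟩ = 0 := by
  have h1 : freeH d ⟨ψ, ψ.2.1⟩ + mulOp (D.V w) ⟨ψ, ψ.2.2⟩ = (E : ℂ) • (ψ : L2 d) := hψ
  have h2 : mulOp (fun x => D.V w x - E) ⟨ψ, hdom ψ.2.1⟩
      = mulOp (D.V w) ⟨ψ, ψ.2.2⟩ - (E : ℂ) • (ψ : L2 d) := by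
    refine Lp.ext ?_
    filter_upwards [coeFn_mulOp (U := fun x => D.V w x - E) ⟨(ψ : L2 d), hdom ψ.2.1⟩,
      coeFn_mulOp (U := D.V w) ⟨(ψ : L2 d), ψ.2.2⟩,
      Lp.coeFn_sub (mulOp (D.V w) ⟨(ψ : L2 d), ψ.2.2⟩) ((E : ℂ) • (ψ : L2 d)),
      Lp.coeFn_smul (E : ℂ) (ψ : L2 d)] with x a1 a2 a3 a4
    rw [a1, a3, Pi.sub_apply, a2, a4, Pi.smul_apply, sub_smul, smul_eq_mul, Complex.real_smul,
      Complex.real_smul]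
  rw [h2, ← add_sub_assoc, h1, sub_self]

end OscSchrodinger

end

theorem proposition8p2 (d : ℕ) (hd : 1 ≤ d) (D : OscSchrodinger.PotentialData d)
    (hcomm : D.CommutatorLowerBound)
    (hβ : ¬ (|D.α - 1| + D.β > 1) → D.β ≥ 1 / 2) :
    ∃ w₀ : ℝ, 0 < w₀ ∧ ∀ w : ℝ, (¬ (D.α + D.β ≤ 2 ∨ D.β ≥ 1 / 2) → |w| ≤ w₀) →
      ∀ (E : ℝ) (ψ : (D.H w).domain),
        D.H w ψ = (E : ℂ) • (ψ : OscSchrodinger.L2 d) →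
        (∀ γ : ℝ, 0 ≤ γ → (ψ : OscSchrodinger.L2 d) ∈
          (OscSchrodinger.mulOp fun x => Real.exp (γ * OscSchrodinger.bracket x)).domain) →
        (ψ : OscSchrodinger.L2 d) = 0 := by
  obtain ⟨w₀, hw₀, hbound⟩ := D.commutatorBound hcomm hβ
  refine ⟨w₀, hw₀, fun w hw E ψ hψ hdec => ?_⟩
  obtain ⟨hdom, C, hC⟩ := D.relBound_V w E
  have hEψ := D.freeH_add_mulOp_eq_zero w E hdom ψ hψ
  refine OscSchrodinger.eq_zero_of_weighted_integral_nonpos hd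
    (fun c hc => OscSchrodinger.integrable_of_mem_mulOp_domain (hdec c hc)) fun η hη => ?_
  obtain ⟨γ₀, h1, hcar⟩ := OscSchrodinger.carleman (D.isTestMultiplier_V w E)
    (D.isInfinitesimal_V w E) (hbound w hw E) hη
  exact ⟨γ₀, fun γ hγ => OscSchrodinger.carleman_eigenfunction (by linarith) hη.le (hcar γ hγ) hdom
    hC (ψ := ⟨ψ, ψ.2.1⟩) hEψ hdec⟩
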